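/- All graphs are finite and simple, and their vertices are natural numbers (labels); two graphs are equal if they have the same vertex set and the same edge set. For an edge $uv$ of $G$, the labeled contraction $G/(u,v)$ is obtained by making $u$ adjacent to every neighbor of $v$ other than $u$ and then deleting $v$. A labeled contraction sequence on $G$ is a list $S=((u_1,v_1),\dots,(u_m,v_m))$ such that each $u_iv_i$ is an edge of the graph obtained from $G$ by the first $i-1$ contractions; $G/S$ is the graph obtained after all of them, and $|S|=m$. The degeneracy of $G$ is the smallest integer $\delta$ such that every nonempty subgraph of $G$ has a vertex of degree at most $\delta$. Maximum Common Labeled Contraction is the following decision problem. Input: two graphs $G$ and $H$ and an integer $k\ge 0$ (the vertex sets of $G$ and $H$ may overlap arbitrarily). Question: are there labeled contraction sequences $S_1$ on $G$ and $S_2$ on $H$ such that $G/S_1=H/S_2$ and $|S_1|+|S_2|\le k$? The parameter is $k$. A parameterized reduction from $P$ to $Q$ maps each instance $x$ of $P$ with parameter $k$ to an instance $x'$ of $Q$ with parameter $k'\le h(k)$ and the same answer, in time $f(k)\cdot n^{c}$, where $n$ is the size of $(x,k)$, $c$ is a constant, and $f,h$ are computable functions. $\mathrm{W}[1]$ is the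 class of parameterized problems that, for some constant $d$, have a parameterized reduction to Weighted Circuit Satisfiability on Boolean circuits of weft at most $1$ and depth at most $d$ (is there a satisfying assignment with exactly $k$ true inputs? parameter $k$; the weft is the maximum number of gates of fan-in greater than two on a path to the output). A parameterized problem is $\mathrm{W}[1]$-hard if every problem in $\mathrm{W}[1]$ has a parameterized reduction to it. **Theorem.** Maximum Common Labeled Contraction is $\mathrm{W}[1]$-hard with respect to the parameter $k$, the total number of contractions. It remains $\mathrm{W}[1]$-hard when restricted to instances in which both input graphs have degeneracy $4$. -/

import Mathlib

namespace ParamComplexity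

/-! ## A random access machine with a step count

The machine has number registers `reg 0, reg 1, …` (of which a program addresses finitely many),
an indirectly addressed memory `mem`, a read-only input word with random access, and an
append-only output word. Words are lists of natural numbers, and every number counts with its
binary length. Arithmetic is addition and (truncated) subtraction at unit cost, so that numbers
grow by at most one bit per step and the model is polynomially equivalent to Turing machines. -/

/-- A configuration: registers, memory, and the output written so far. -/
structure State where
  reg : ℕ → ℕ
  mem : ℕ → ℕ
  out : List ℕ

/-- The initial configuration: all registers and memory cells are `0`, the output is empty. -/
def State.init : State := ⟨fun _ => 0, fun _ => 0, []⟩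

def State.setReg (s : State) (d x : ℕ) : State := { s with reg := Function.update s.reg d x }

def State.setMem (s : State) (a x : ℕ) : State := { s with mem := Function.update s.mem a x }

def State.write (s : State) (x : ℕ) : State := { s with out := s.out ++ [x] }

/-- Programs of the random access machine, in structured form. -/
inductive Prog : Type
  /-- `reg d := c` -/
  | const (d c : ℕ)
  /-- `reg d := reg a + reg b` -/
  | add (d a b : ℕ)
  /-- `reg d := reg a - reg b`, truncated at `0` -/
  | sub (d a b : ℕ)
  /-- `reg d := mem (reg a)` -/
  | load (d a : ℕ)
  /-- `mem (reg a) := reg b` -/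
  | store (a b : ℕ)
  /-- `reg d :=` the entry with index `reg a` of the input word (`0` beyond its end) -/
  | input (d a : ℕ)
  /-- `reg d :=` the number of entries of the input word -/
  | inputLen (d : ℕ)
  /-- append `reg a` to the output word -/
  | emit (a : ℕ)
  /-- first `p`, then `q` -/
  | seq (p q : Prog)
  /-- `p` if `reg a ≠ 0`, else `q` -/
  | ifNZ (a : ℕ) (p q : Prog)
  /-- repeat `p` as long as `reg a ≠ 0` -/
  | whileNZ (a : ℕ) (p : Prog)

/-- `Run w p s s' t`: on the input word `w`, the program `p` started in configuration `s` halts in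
configuration `s'` after exactly `t` steps. Every elementary operation and every test is a step. -/
inductive Run (w : List ℕ) : Prog → State → State → ℕ → Prop
  | const (d c : ℕ) (s : State) : Run w (.const d c) s (s.setReg d c) 1
  | add (d a b : ℕ) (s : State) : Run w (.add d a b) s (s.setReg d (s.reg a + s.reg b)) 1
  | sub (d a b : ℕ) (s : State) : Run w (.sub d a b) s (s.setReg d (s.reg a - s.reg b)) 1
  | load (d a : ℕ) (s : State) : Run w (.load d a) s (s.setReg d (s.mem (s.reg a))) 1
  | store (a b : ℕ) (s : State) : Run w (.store a b) s (s.setMem (s.reg a) (s.reg b)) 1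
  | input (d a : ℕ) (s : State) : Run w (.input d a) s (s.setReg d (w.getD (s.reg a) 0)) 1
  | inputLen (d : ℕ) (s : State) : Run w (.inputLen d) s (s.setReg d w.length) 1
  | emit (a : ℕ) (s : State) : Run w (.emit a) s (s.write (s.reg a)) 1
  | seq {p q : Prog} {s s' s'' : State} {t t' : ℕ} :
      Run w p s s' t → Run w q s' s'' t' → Run w (.seq p q) s s'' (t + t')
  | ifTrue {a : ℕ} {p q : Prog} {s s' : State} {t : ℕ} :
      s.reg a ≠ 0 → Run w p s s' t → Run w (.ifNZ a p q) s s' (t + 1)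
  | ifFalse {a : ℕ} {p q : Prog} {s s' : State} {t : ℕ} :
      s.reg a = 0 → Run w q s s' t → Run w (.ifNZ a p q) s s' (t + 1)
  | whileDone {a : ℕ} {p : Prog} {s : State} :
      s.reg a = 0 → Run w (.whileNZ a p) s s 1
  | whileStep {a : ℕ} {p : Prog} {s s' s'' : State} {t t' : ℕ} :
      s.reg a ≠ 0 → Run w p s s' t → Run w (.whileNZ a p) s' s'' t' →
        Run w (.whileNZ a p) s s'' (t + t' + 1)

/-- On the input word `w`, the program `p` halts after exactly `t` steps with output word `y`. -/
def Outputs (p : Prog) (w y : List ℕ) (t : ℕ) : Prop :=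
  ∃ s : State, Run w p State.init s t ∧ s.out = y

/-- The size of a word: the total binary length of its entries, plus one separator for each. -/
def wordSize (w : List ℕ) : ℕ := (w.map fun a => Nat.size a + 1).sum

/-! ## Parameterized problems and reductions -/

/-- A parameterized decision problem: its instances with their encoding as words, the parameter of
an instance, and the set of yes-instances. -/
structure ParamProblem where
  Inst : Type
  code : Inst → List ℕ
  param : Inst → ℕ
  yes : Inst → Prop

namespace ParamProblem

/-- The word handed to a machine: the parameter followed by the encoded instance. -/
def word (P : ParamProblem) (x : P.Inst) : List ℕ := P.param x :: P.code x

/-- The problem `P` restricted to the instances in `S`. -/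
def restrict (P : ParamProblem) (S : Set P.Inst) : ParamProblem where
  Inst := S
  code x := P.code x
  param x := P.param x
  yes x := P.yes x

end ParamProblem

/-- Parameterized (many-one) reducibility: a map `g` of instances that preserves the answer,
bounds the new parameter by a computable function of the old one, and is computed by a machine in
time `f (k) * n ^ c`, where `k` is the parameter, `n` the input size and `f` is computable. -/
def FPTReducible (P Q : ParamProblem) : Prop :=
  ∃ g : P.Inst → Q.Inst,
    (∀ x, P.yes x ↔ Q.yes (g x)) ∧
    (∃ h : ℕ → ℕ, Computable h ∧ ∀ x, Q.param (g x) ≤ h (P.param x)) ∧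
    ∃ (p : Prog) (f : ℕ → ℕ) (c : ℕ), Computable f ∧
      ∀ x, ∃ t ≤ f (P.param x) * wordSize (P.word x) ^ c, Outputs p (P.word x) (Q.word (g x)) t

/-! ## Boolean circuits and the W-hierarchy -/

/-- A gate of a circuit with `n` nodes. Conjunctions and disjunctions have arbitrary fan-in. -/
inductive Gate (n : ℕ) : Type
  | input
  | not (i : Fin n)
  | and (l : Finset (Fin n))
  | or (l : Finset (Fin n))

namespace Gate

variable {n : ℕ}

/-- The nodes that are wired into the gate. -/
def preds : Gate n → Finset (Fin n)
  | input => ∅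
  | not i => {i}
  | and l => l
  | or l => l

/-- A large gate is one of fan-in greater than two. -/
def IsLarge (g : Gate n) : Prop := 2 < g.preds.card

/-- The value `b` is what the gate computes from the values `v` of the nodes wired into it; the
value of an input is free. -/
def Computes (v : Fin n → Prop) (b : Prop) : Gate n → Prop
  | input => True
  | not i => (b ↔ ¬ v i)
  | and l => (b ↔ ∀ i ∈ l, v i)
  | or l => (b ↔ ∃ i ∈ l, v i)

/-- `0` for an input, `1, i` for a negation, and `2` (conjunction) or `3` (disjunction), followed
by the fan-in and the increasing list of the nodes wired in. -/
def code : Gate n → List ℕ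
  | input => [0]
  | not i => [1, i]
  | and l => 2 :: l.card :: (l.sort (· ≤ ·)).map Fin.val
  | or l => 3 :: l.card :: (l.sort (· ≤ ·)).map Fin.val

end Gate

/-- A Boolean circuit: a directed acyclic graph of gates, numbered in a topological order, with a
designated output node. -/
structure Circuit where
  n : ℕ
  gate : Fin n → Gate n
  out : Fin n
  acyclic : ∀ i, ∀ j ∈ (gate i).preds, j < i

namespace Circuit

/-- A directed path of the circuit that ends in the output node, as its list of nodes. -/
def IsPath (C : Circuit) (p : List (Fin C.n)) : Prop :=
  p.IsChain (fun i j => i ∈ (C.gate j).preds) ∧ p.getLast? = some C.out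

/-- The depth, the maximal number of wires on a path to the output, is at most `d`. -/
def DepthLE (C : Circuit) (d : ℕ) : Prop := ∀ p, C.IsPath p → p.length ≤ d + 1

open Classical in
/-- The weft, the maximal number of large gates on a path to the output, is at most `t`. -/
def WeftLE (C : Circuit) (t : ℕ) : Prop :=
  ∀ p, C.IsPath p → p.countP (fun i => decide (C.gate i).IsLarge) ≤ t

/-- Some assignment that sets exactly `k` input nodes to true satisfies the circuit. Here `v` is
the family of values of all nodes; it is determined by its restriction to the input nodes. -/
def WeightedSat (C : Circuit) (k : ℕ) : Prop :=
  ∃ v : Fin C.n → Prop, (∀ i, (C.gate i).Computes v (v i)) ∧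
    {i | C.gate i = .input ∧ v i}.ncard = k ∧ v C.out

/-- The number of nodes, the output node, and the gates in order. -/
def code (C : Circuit) : List ℕ :=
  C.n :: C.out :: (List.finRange C.n).flatMap fun i => (C.gate i).code

end Circuit

/-- Weighted Circuit Satisfiability for circuits of weft at most `t` and depth at most `d`,
parameterized by the weight `k`. -/
def WCS (t d : ℕ) : ParamProblem where
  Inst := { C : Circuit // C.WeftLE t ∧ C.DepthLE d } × ℕ
  code x := x.1.1.code
  param x := x.2
  yes x := x.1.1.WeightedSat x.2

/-- The class `W[t]`: the problems that reduce to Weighted Circuit Satisfiability for circuits of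
weft at most `t` and depth at most some constant. -/
def InW (t : ℕ) (P : ParamProblem) : Prop := ∃ d : ℕ, FPTReducible P (WCS t d)

/-- `W[t]`-hardness: every problem in `W[t]` has a parameterized reduction to `Q`. -/
def WHard (t : ℕ) (Q : ParamProblem) : Prop := ∀ P : ParamProblem, InW t P → FPTReducible P Q

/-! ## Labeled graphs and contractions -/

/-- A finite simple graph whose vertices are natural numbers (the labels). Equality of such graphs
is equality of the vertex sets and of the edge sets. -/
@[ext]
structure LGraph where
  verts : Finset ℕ
  Adj : ℕ → ℕ → Prop
  symm : ∀ u v, Adj u v → Adj v u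
  irrefl : ∀ u, ¬ Adj u u
  mem_of_adj : ∀ u v, Adj u v → u ∈ verts

namespace LGraph

/-- The labeled contraction `G / (u, v)` of the edge `uv`: make `u` adjacent to all neighbors of
`v` other than `u`, and remove `v`. -/
def contract (G : LGraph) (u v : ℕ) (huv : G.Adj u v) : LGraph where
  verts := G.verts.erase v
  Adj x y := x ≠ y ∧ x ≠ v ∧ y ≠ v ∧ (G.Adj x y ∨ (x = u ∧ G.Adj v y) ∨ (y = u ∧ G.Adj v x))
  symm := by
    rintro x y ⟨h1, h2, h3, h⟩
    refine ⟨h1.symm, h3, h2, ?_⟩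
    rcases h with h | h | h
    · exact Or.inl (G.symm _ _ h)
    · exact Or.inr (Or.inr h)
    · exact Or.inr (Or.inl h)
  irrefl := fun x h => h.1 rfl
  mem_of_adj := by
    rintro x y ⟨-, h2, -, h⟩
    refine Finset.mem_erase.2 ⟨h2, ?_⟩
    rcases h with h | ⟨rfl, -⟩ | ⟨-, h⟩
    · exact G.mem_of_adj _ _ h
    · exact G.mem_of_adj _ _ huv
    · exact G.mem_of_adj _ _ (G.symm _ _ h)

/-- `ContractsTo G S M`: the sequence `S` is a labeled contraction sequence on `G`, and `G / S` is
the graph `M`. -/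
inductive ContractsTo : LGraph → List (ℕ × ℕ) → LGraph → Prop
  | nil (G : LGraph) : ContractsTo G [] G
  | cons {G M : LGraph} {u v : ℕ} {S : List (ℕ × ℕ)} (huv : G.Adj u v) :
      ContractsTo (G.contract u v huv) S M → ContractsTo G ((u, v) :: S) M

/-- `K` is a subgraph of `G`. -/
def IsSubgraph (K G : LGraph) : Prop := K.verts ⊆ G.verts ∧ ∀ u v, K.Adj u v → G.Adj u v

/-- The degree of the vertex `v`. -/
noncomputable def degree (G : LGraph) (v : ℕ) : ℕ := {u | G.Adj v u}.ncard

/-- The degeneracy: the smallest `d` such that every (nonempty) subgraph has a vertex of degree at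
most `d`. -/
noncomputable def degeneracy (G : LGraph) : ℕ :=
  sInf {d | ∀ K : LGraph, K.IsSubgraph G → K.verts.Nonempty → ∃ v ∈ K.verts, K.degree v ≤ d}

open Classical in
/-- The number of vertices, the increasing list of the labels, and the adjacency matrix. -/
noncomputable def code (G : LGraph) : List ℕ :=
  G.verts.card :: (G.verts.sort (· ≤ ·) ++
    (G.verts.sort (· ≤ ·)).flatMap fun u =>
      (G.verts.sort (· ≤ ·)).map fun v => if G.Adj u v then 1 else 0)

end LGraph

/-- Maximum Common Labeled Contraction, parameterized by the total number `k` of contractions: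
given `(G, H, k)`, are there contraction sequences `S₁` on `G` and `S₂` on `H` with the same
resulting graph and with `|S₁| + |S₂| ≤ k`? -/
noncomputable def MCLC : ParamProblem where
  Inst := LGraph × LGraph × ℕ
  code x := x.1.code ++ x.2.1.code
  param x := x.2.2
  yes x := ∃ (S₁ S₂ : List (ℕ × ℕ)) (M : LGraph),
    x.1.ContractsTo S₁ M ∧ x.2.1.ContractsTo S₂ M ∧ S₁.length + S₂.length ≤ x.2.2

/-- The instances of Maximum Common Labeled Contraction in which both input graphs have degeneracy
`d`. -/
def DegeneracyEq (d : ℕ) : Set MCLC.Inst :=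
  {x : LGraph × LGraph × ℕ | x.1.degeneracy = d ∧ x.2.1.degeneracy = d}

end ParamComplexity

/-! By definition every problem in W[1] reduces to weighted satisfiability of circuits of weft at
most 1 and some constant depth `d`, and parameterized reductions compose (`FPTReducible.trans`). So
it suffices to reduce that problem to the restricted contraction problem (`fptReducible_restrict`);
the unrestricted claim follows by forgetting the restriction. The reduction has three stages.

Circuit to binary constraints. Write the true inputs as positions `0 = p 0 < p 1 < ... < p k < p (k
+ 1) = n + 1`, which cut the inputs into `k + 1` intervals. Put `q = 2 ^ (d + 1)`. A variable is a
`q`-tuple of intervals; a value states the ends of these intervals, together with `q` claims naming,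
for large gates, a wire that forces the value of the gate. Values of different variables must agree
on shared or adjacent intervals and on all claims, and a value is rejected if falsity of the output
can be derived from it. On each path there is at most one large gate and small gates have fan-in at
most 2. Hence at most `q` claims describe all large gates correctly (`Good.exists_cover`), and
correct claims never yield a wrong derivation (`Derives.sound`). Conversely, whatever is claimed,
the true value of the output is derivable from at most `q` intervals, hence within one variable
(`Good.exists_derives`). The number of variables depends on `k` and `d` only.

Binary constraints to selection (`Binary.solvable_iff`). Each ordered pair of variables becomes a
class of its own, whose items are pairs of values. An item for a pair is joined only to its two
coordinates, and only if the constraint holds, so every item has at most two predecessors. The value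
0 satisfies no constraint and supplies a blank, unjoined item in each class.

Selection to contraction. Both graphs contain the same items with the same labels and the relation
`A` as edges; each class has a selector vertex adjacent to its items, with different labels in the
two graphs; only the second graph has the edges `F` between selectors. With a budget of two
contractions per class, exactly the selectors must disappear, each ending up in an item of its
class. The edges `F` then become edges between chosen items, and these must already exist in the
first graph, that is, come from `A` (`Selection.solvable_of_contractions`). A separate clique on
five vertices makes the degeneracy exactly 4.

The running time is handled by a calculus of functions that are computable in time polynomial in the
unary size of the input. For circuit encodings this is affordable: all entries other than `k` are
bounded by the length, and `k` may enter the factor `f (k)`. -/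

namespace ParamComplexity

/-! ## Polynomially bounded register computations -/

/-- A context: a word together with the values of finitely many variables. -/
class Ctx (Γ : Type) where
  word : Γ → List ℕ
  arity : ℕ
  var : Γ → ℕ → ℕ

instance Ctx.base : Ctx (List ℕ) where
  word w := w
  arity := 0
  var _ _ := 0

instance Ctx.push {Γ : Type} [Ctx Γ] : Ctx (Γ × ℕ) where
  word p := Ctx.word p.1
  arity := Ctx.arity Γ + 1
  var p i := if i < Ctx.arity Γ then Ctx.var p.1 i else p.2

/-- The size of a context, all numbers being counted in unary. -/
def Ctx.size {Γ : Type} [Ctx Γ] (γ : Γ) : ℕ :=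
  (Ctx.word γ).sum + (Ctx.word γ).length + ∑ i ∈ Finset.range (Ctx.arity Γ), Ctx.var γ i

theorem Ctx.size_push {Γ : Type} [Ctx Γ] (p : Γ × ℕ) : Ctx.size p = Ctx.size p.1 + p.2 := by
  have h : ∑ i ∈ Finset.range (Ctx.arity Γ), Ctx.var p i
      = ∑ i ∈ Finset.range (Ctx.arity Γ), Ctx.var p.1 i :=
    Finset.sum_congr rfl fun i hi => if_pos (Finset.mem_range.1 hi)
  have h2 : Ctx.var p (Ctx.arity Γ) = p.2 := if_neg (lt_irrefl _)
  have h3 : Ctx.arity (Γ × ℕ) = Ctx.arity Γ + 1 := rfl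
  have h4 : Ctx.word p = Ctx.word p.1 := rfl
  unfold Ctx.size
  rw [h3, Finset.sum_range_succ, h, h2, h4]
  omega

section

variable {Γ : Type} [Ctx Γ]

/-- Polynomially bounded functions. -/
def PB (F : Γ → ℕ) : Prop := ∃ e, ∀ γ, F γ ≤ (Ctx.size γ + 2) ^ e

theorem PB.mono {F G : Γ → ℕ} (hG : PB G) (h : ∀ γ, F γ ≤ G γ) : PB F :=
  hG.imp fun _ he γ => (h γ).trans (he γ)

/-- The base of the bound is at least 2, so the exponent `c` alone absorbs the constant, by `c < 2 ^
c`. -/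
theorem PB.const (c : ℕ) : PB fun _ : Γ => c :=
  ⟨c, fun γ => (Nat.lt_two_pow_self).le.trans (Nat.pow_le_pow_left (by omega) c)⟩

theorem PB.size : PB fun γ : Γ => Ctx.size γ := ⟨1, fun γ => by simp⟩

theorem PB.mul {F G : Γ → ℕ} (hF : PB F) (hG : PB G) : PB fun γ => F γ * G γ := by
  obtain ⟨a, ha⟩ := hF
  obtain ⟨b, hb⟩ := hG
  exact ⟨a + b, fun γ => by rw [pow_add]; exact Nat.mul_le_mul (ha γ) (hb γ)⟩

theorem PB.add {F G : Γ → ℕ} (hF : PB F) (hG : PB G) : PB fun γ => F γ + G γ := by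
  obtain ⟨a, ha⟩ := hF
  obtain ⟨b, hb⟩ := hG
  refine ⟨a + b + 1, fun γ => ?_⟩
  have h1 : (Ctx.size γ + 2) ^ a ≤ (Ctx.size γ + 2) ^ (a + b) :=
    Nat.pow_le_pow_right (by omega) (by omega)
  have h2 : (Ctx.size γ + 2) ^ b ≤ (Ctx.size γ + 2) ^ (a + b) :=
    Nat.pow_le_pow_right (by omega) (by omega)
  have h3 : (Ctx.size γ + 2) ^ (a + b) * 2 ≤ (Ctx.size γ + 2) ^ (a + b) * (Ctx.size γ + 2) :=
    Nat.mul_le_mul_left _ (by omega)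
  have := ha γ
  have := hb γ
  change F γ + G γ ≤ _
  rw [pow_succ]
  omega

theorem PB.pow {F : Γ → ℕ} (hF : PB F) (e : ℕ) : PB fun γ => F γ ^ e := by
  obtain ⟨a, ha⟩ := hF
  exact ⟨a * e, fun γ => by rw [pow_mul]; exact Nat.pow_le_pow_left (ha γ) e⟩

/-- A polynomial bound survives the substitution of a polynomially bounded value. -/
theorem PB.subst {F : Γ × ℕ → ℕ} (hF : PB F) {b : Γ → ℕ} (hb : PB b) :
    ∃ B : Γ → ℕ, PB B ∧ ∀ γ, ∀ i ≤ b γ, F (γ, i) ≤ B γ := by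
  obtain ⟨e, he⟩ := hF
  refine ⟨_, ((PB.size.add hb).add (PB.const 2)).pow e, fun γ i hi => (he (γ, i)).trans ?_⟩
  rw [Ctx.size_push]
  exact Nat.pow_le_pow_left (by simpa using hi) e

theorem PB.fst {F : Γ → ℕ} (hF : PB F) : PB fun p : Γ × ℕ => F p.1 := by
  obtain ⟨e, he⟩ := hF
  refine ⟨e, fun p => (he p.1).trans (Nat.pow_le_pow_left ?_ e)⟩
  rw [Ctx.size_push]
  omega

end

/-- Register `a` is a countdown and `m` the number of completed rounds. Each round costs the body
and one test; the last summand 1 is the failing test. -/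
theorem Run.bounded_loop {w : List ℕ} {a : ℕ} {p : Prog} {N T : ℕ} (I : ℕ → State → Prop)
    (hreg : ∀ m s, I m s → s.reg a = N - m)
    (step : ∀ m < N, ∀ s, I m s → ∃ s' t, Run w p s s' t ∧ t ≤ T ∧ I (m + 1) s') :
    ∀ s, I 0 s → ∃ s' t, Run w (.whileNZ a p) s s' t ∧ t ≤ N * (T + 1) + 1 ∧ I N s' := by
  have key : ∀ j m, m + j = N → ∀ s, I m s →
      ∃ s' t, Run w (.whileNZ a p) s s' t ∧ t ≤ j * (T + 1) + 1 ∧ I N s' := by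
    intro j
    induction j with
    | zero =>
      rintro m rfl s hs
      exact ⟨s, 1, .whileDone (by rw [hreg _ _ hs]; simp), by simp, hs⟩
    | succ j ih =>
      intro m hm s hs
      obtain ⟨s₁, t₁, h1, h2, h3⟩ := step m (by omega) s hs
      obtain ⟨s₂, t₂, h4, h5, h6⟩ := ih (m + 1) (by omega) s₁ h3
      refine ⟨s₂, _, .whileStep (by rw [hreg _ _ hs]; omega) h1 h4, ?_, h6⟩
      rw [Nat.succ_mul]
      omega
  exact fun s hs => key N 0 (by simp) s hs

/-! ### Functions, predicates and output words computed in polynomial time -/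

section

variable {Γ : Type} [Ctx Γ]

/-- The registers `ρ i` hold the variables of the context `γ`. -/
def Holds (ρ : ℕ → ℕ) (γ : Γ) (s : State) : Prop :=
  ∀ i < Ctx.arity Γ, s.reg (ρ i) = Ctx.var γ i

theorem Holds.frame {ρ : ℕ → ℕ} {r : ℕ} (hρ : ∀ i < Ctx.arity Γ, ρ i < r) {γ : Γ} {s s' : State}
    (h : Holds ρ γ s) (hs : ∀ i < r, s'.reg i = s.reg i) : Holds ρ γ s' := fun i hi => by
  rw [hs _ (hρ i hi), h i hi]

/-- The layout `ρ` extended by one variable in register `a`. -/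
def extend (Γ : Type) [Ctx Γ] (ρ : ℕ → ℕ) (a : ℕ) : ℕ → ℕ :=
  fun i => if i < Ctx.arity Γ then ρ i else a

theorem extend_lt {ρ : ℕ → ℕ} {r r' a : ℕ} (hρ : ∀ i < Ctx.arity Γ, ρ i < r) (hr : r ≤ r')
    (ha : a < r') : ∀ i < Ctx.arity (Γ × ℕ), extend Γ ρ a i < r' := fun i _ => by
  unfold extend
  split_ifs with h
  · exact (hρ i h).trans_le hr
  · exact ha

theorem Holds.extend {ρ : ℕ → ℕ} {a x : ℕ} {γ : Γ} {s : State} (h : Holds ρ γ s)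
    (ha : s.reg a = x) : Holds (extend Γ ρ a) (γ, x) s := fun i _ => by
  change s.reg (if i < Ctx.arity Γ then ρ i else a) = if i < Ctx.arity Γ then Ctx.var γ i else x
  split_ifs with hi
  · exact h i hi
  · exact ha

/-- `F` is polynomially bounded, and for each layout of the variables below register `r` a program
computes `F` into register `r` in polynomial time, changing neither the registers below `r` nor
the output. -/
def Easy (F : Γ → ℕ) : Prop :=
  PB F ∧ ∀ (ρ : ℕ → ℕ) (r : ℕ), (∀ i < Ctx.arity Γ, ρ i < r) →
    ∃ (p : Prog) (T : Γ → ℕ), PB T ∧ ∀ γ s, Holds ρ γ s →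
      ∃ s' t, Run (Ctx.word γ) p s s' t ∧ t ≤ T γ ∧ s'.reg r = F γ ∧
        (∀ i < r, s'.reg i = s.reg i) ∧ s'.out = s.out

/-- The predicate `p` is decided by an easy function. -/
def EasyP (p : Γ → Prop) : Prop := ∃ f : Γ → ℕ, Easy f ∧ ∀ γ, p γ ↔ f γ ≠ 0

/-- For each layout of the variables below register `r` a program appends `L` to the output in
polynomial time, without changing the registers below `r`. -/
def Emits (L : Γ → List ℕ) : Prop :=
  ∀ (ρ : ℕ → ℕ) (r : ℕ), (∀ i < Ctx.arity Γ, ρ i < r) →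
    ∃ (p : Prog) (T : Γ → ℕ), PB T ∧ ∀ γ s, Holds ρ γ s →
      ∃ s' t, Run (Ctx.word γ) p s s' t ∧ t ≤ T γ ∧
        (∀ i < r, s'.reg i = s.reg i) ∧ s'.out = s.out ++ L γ

theorem Easy.congr {F G : Γ → ℕ} (h : Easy F) (e : ∀ γ, G γ = F γ) : Easy G := by
  rwa [show G = F from funext e]

theorem EasyP.congr {p q : Γ → Prop} (h : EasyP p) (e : ∀ γ, q γ ↔ p γ) : EasyP q := by
  rwa [show q = p from funext fun γ => propext (e γ)]

theorem Emits.congr {F G : Γ → List ℕ} (h : Emits F) (e : ∀ γ, G γ = F γ) : Emits G := by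
  rwa [show G = F from funext e]

theorem setReg_reg (s : State) (d x i : ℕ) :
    (s.setReg d x).reg i = if i = d then x else s.reg i := by
  simp [State.setReg, Function.update_apply]

theorem setReg_out (s : State) (d x : ℕ) : (s.setReg d x).out = s.out := rfl

theorem Easy.const (c : ℕ) : Easy fun _ : Γ => c := by
  refine ⟨PB.const c, fun ρ r _ => ⟨.const r c, fun _ => 1, PB.const 1, fun γ s _ =>
    ⟨_, _, .const r c s, le_rfl, by simp [setReg_reg], fun i hi => ?_, rfl⟩⟩⟩
  simp [setReg_reg, hi.ne]

theorem Easy.var : Easy fun p : Γ × ℕ => p.2 := by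
  refine ⟨⟨1, fun p => by rw [Ctx.size_push]; simp; omega⟩, fun ρ r hr => ⟨.seq (.const r 0)
    (.add r r (ρ (Ctx.arity Γ))), fun _ => 2, PB.const 2, fun γ s h =>
    ⟨_, _, .seq (.const r 0 s) (.add r r _ _), le_rfl, ?_, fun i hi => ?_, rfl⟩⟩⟩
  · have h1 := h (Ctx.arity Γ) (Nat.lt_succ_self _)
    have h2 : Ctx.var γ (Ctx.arity Γ) = γ.2 := if_neg (lt_irrefl _)
    have h3 := hr (Ctx.arity Γ) (Nat.lt_succ_self _)
    simp [setReg_reg, h1, h2, h3.ne]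
  · simp [setReg_reg, hi.ne]

theorem Easy.fst {F : Γ → ℕ} (h : Easy F) : Easy fun p : Γ × ℕ => F p.1 := by
  refine ⟨h.1.fst, fun ρ r hr => ?_⟩
  obtain ⟨p, T, hT, H⟩ := h.2 ρ r fun i hi => hr i (Nat.lt_succ_of_lt hi)
  refine ⟨p, _, hT.fst, fun γ s hs => H γ.1 s fun i hi => ?_⟩
  rw [hs i (Nat.lt_succ_of_lt hi)]
  exact if_pos hi

/-- The second operand is computed with base register `r + 1`, so the first result in register `r`
survives. This is what the quantification over `r` in `Easy` is for. -/
theorem Easy.binop {F G : Γ → ℕ} (op : ℕ → ℕ → ℕ) (mk : ℕ → ℕ → ℕ → Prog)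
    (hmk : ∀ w d a b s, Run w (mk d a b) s (s.setReg d (op (s.reg a) (s.reg b))) 1)
    (hop : PB fun γ => op (F γ) (G γ)) (hF : Easy F) (hG : Easy G) :
    Easy fun γ => op (F γ) (G γ) := by
  refine ⟨hop, fun ρ r hr => ?_⟩
  obtain ⟨p, T, hT, H⟩ := hF.2 ρ r hr
  obtain ⟨q, U, hU, K⟩ := hG.2 ρ (r + 1) fun i hi => (hr i hi).trans (Nat.lt_succ_self r)
  refine ⟨.seq p (.seq q (mk r r (r + 1))), _, hT.add (hU.add (PB.const 1)), fun γ s hs => ?_⟩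
  obtain ⟨s₁, t₁, a1, a2, a3, a4, a5⟩ := H γ s hs
  obtain ⟨s₂, t₂, b1, b2, b3, b4, b5⟩ := K γ s₁ (hs.frame hr a4)
  refine ⟨_, _, .seq a1 (.seq b1 (hmk _ r r (r + 1) s₂)), by omega, ?_, fun i hi => ?_, ?_⟩
  · simp [setReg_reg, b3, b4 r (Nat.lt_succ_self r), a3]
  · simp [setReg_reg, hi.ne, b4 i (by omega), a4 i hi]
  · simp [setReg_out, a5, b5]

theorem Easy.add {F G : Γ → ℕ} (hF : Easy F) (hG : Easy G) : Easy fun γ => F γ + G γ :=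
  Easy.binop (· + ·) Prog.add (fun _ d a b s => .add d a b s) (hF.1.add hG.1) hF hG

theorem Easy.sub {F G : Γ → ℕ} (hF : Easy F) (hG : Easy G) : Easy fun γ => F γ - G γ :=
  Easy.binop (· - ·) Prog.sub (fun _ d a b s => .sub d a b s)
    (hF.1.mono fun _ => Nat.sub_le _ _) hF hG

theorem getD_le_size (γ : Γ) (a : ℕ) : (Ctx.word γ).getD a 0 ≤ Ctx.size γ := by
  rw [List.getD_eq_getElem?_getD]
  by_cases h : a < (Ctx.word γ).length
  · rw [List.getElem?_eq_getElem h]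
    have := List.le_sum_of_mem (List.getElem_mem h)
    simp only [Option.getD_some, Ctx.size]
    omega
  · simp [List.getElem?_eq_none (not_lt.1 h)]

theorem Easy.input {F : Γ → ℕ} (hF : Easy F) : Easy fun γ => (Ctx.word γ).getD (F γ) 0 := by
  refine ⟨PB.size.mono fun γ => getD_le_size γ _, fun ρ r hr => ?_⟩
  obtain ⟨p, T, hT, H⟩ := hF.2 ρ r hr
  refine ⟨.seq p (.input r r), _, hT.add (PB.const 1), fun γ s hs => ?_⟩
  obtain ⟨s₁, t₁, a1, a2, a3, a4, a5⟩ := H γ s hs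
  refine ⟨_, _, .seq a1 (.input r r s₁), by omega, ?_, fun i hi => ?_, ?_⟩
  · simp [setReg_reg, a3]
  · simp [setReg_reg, hi.ne, a4 i hi]
  · simp [setReg_out, a5]

theorem Easy.ite {p : Γ → Prop} [DecidablePred p] {F G : Γ → ℕ} (hp : EasyP p) (hF : Easy F)
    (hG : Easy G) : Easy fun γ => if p γ then F γ else G γ := by
  obtain ⟨f, hf, hfp⟩ := hp
  refine ⟨(hF.1.add hG.1).mono fun γ => by split_ifs <;> omega, fun ρ r hr => ?_⟩
  obtain ⟨a, A, hA, Ha⟩ := hf.2 ρ r hr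
  obtain ⟨b, B, hB, Hb⟩ := hF.2 ρ r hr
  obtain ⟨c, C, hC, Hc⟩ := hG.2 ρ r hr
  refine ⟨.seq a (.ifNZ r b c), _, hA.add ((hB.add hC).add (PB.const 1)), fun γ s hs => ?_⟩
  obtain ⟨s₁, t₁, a1, a2, a3, a4, a5⟩ := Ha γ s hs
  by_cases h : p γ
  · obtain ⟨s₂, t₂, b1, b2, b3, b4, b5⟩ := Hb γ s₁ (hs.frame hr a4)
    refine ⟨_, _, .seq a1 (.ifTrue (by rw [a3]; exact (hfp γ).1 h) b1), by omega, ?_,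
      fun i hi => ?_, ?_⟩
    · simp [h, b3]
    · rw [b4 i hi, a4 i hi]
    · rw [b5, a5]
  · obtain ⟨s₂, t₂, b1, b2, b3, b4, b5⟩ := Hc γ s₁ (hs.frame hr a4)
    refine ⟨_, _, .seq a1 (.ifFalse (by rw [a3]; by_contra h'; exact h ((hfp γ).2 h')) b1),
      by omega, ?_, fun i hi => ?_, ?_⟩
    · simp [h, b3]
    · rw [b4 i hi, a4 i hi]
    · rw [b5, a5]

/-- Primitive recursion with polynomially bounded values. -/
theorem Easy.recursion {N x : Γ → ℕ} {g : Γ → ℕ → ℕ → ℕ} (hN : Easy N) (hx : Easy x)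
    (hg : Easy fun p : (Γ × ℕ) × ℕ => g p.1.1 p.1.2 p.2) (V : Γ → ℕ → ℕ)
    (V0 : ∀ γ, V γ 0 = x γ) (VS : ∀ γ m, V γ (m + 1) = g γ m (V γ m))
    {b : Γ → ℕ} (hb : PB b) (hVb : ∀ γ, ∀ m ≤ N γ, V γ m ≤ b γ) :
    Easy fun γ => V γ (N γ) := by
  refine ⟨hb.mono fun γ => hVb γ _ le_rfl, fun ρ r hr => ?_⟩
  obtain ⟨pN, TN, hTN, HN⟩ := hN.2 ρ (r + 2) fun i hi => (hr i hi).trans (by omega)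
  obtain ⟨px, Tx, hTx, Hx⟩ := hx.2 ρ r hr
  obtain ⟨pg, Tg, hTg, Hg⟩ := hg.2 (extend (Γ × ℕ) (extend Γ ρ (r + 1)) r) (r + 5)
    (extend_lt (extend_lt (r' := r + 5) hr (by omega) (by omega)) le_rfl (by omega))
  -- The time of the body depends on the accumulator and the round number; both are polynomially
  -- bounded and are eliminated one after the other.
  obtain ⟨B₁, hB₁, HB₁⟩ := hTg.subst hb.fst
  obtain ⟨B₂, hB₂, HB₂⟩ := hB₁.subst hN.1
  -- Register `r` is the accumulator, `r + 1` the round number, `r + 2` the countdown; `r + 3` and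
  -- `r + 4` hold the constants 1 and 0, and the value of `g` arrives in `r + 5`.
  refine ⟨.seq px (.seq (.const (r + 1) 0) (.seq pN (.seq (.const (r + 3) 1) (.seq (.const (r + 4) 0)
    (.whileNZ (r + 2) (.seq pg (.seq (.add r (r + 5) (r + 4)) (.seq (.add (r + 1) (r + 1) (r + 3))
      (.sub (r + 2) (r + 2) (r + 3)))))))))), _,
    hTx.add (hTN.add ((hN.1.mul (hB₂.add (PB.const 4))).add (PB.const 4))), fun γ s hs => ?_⟩
  obtain ⟨s₁, t₁, a1, a2, a3, a4, a5⟩ := Hx γ s hs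
  have hs1 : Holds ρ γ (s₁.setReg (r + 1) 0) := hs.frame hr fun i hi => by
    rw [setReg_reg, if_neg (by omega), a4 i hi]
  obtain ⟨s₂, t₂, b1, b2, b3, b4, b5⟩ := HN γ _ hs1
  refine Exists.elim (Run.bounded_loop (w := Ctx.word γ) (a := r + 2) (N := N γ)
    (p := .seq pg (.seq (.add r (r + 5) (r + 4)) (.seq (.add (r + 1) (r + 1) (r + 3))
      (.sub (r + 2) (r + 2) (r + 3))))) (T := B₂ γ + 3)
    (fun m s' => s'.reg r = V γ m ∧ s'.reg (r + 1) = m ∧ s'.reg (r + 2) = N γ - m ∧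
      s'.reg (r + 3) = 1 ∧ s'.reg (r + 4) = 0 ∧ (∀ i < r, s'.reg i = s.reg i) ∧ s'.out = s.out)
    (fun m s' h => h.2.2.1) ?_ ((s₂.setReg (r + 3) 1).setReg (r + 4) 0) ?_) ?_
  pick_goal 3
  · rintro s₃ ⟨t₃, c1, c2, c3⟩
    refine ⟨_, _, .seq a1 (.seq (.const _ _ _) (.seq b1 (.seq (.const _ _ _) (.seq (.const _ _ _)
      c1)))), ?_, c3.1, c3.2.2.2.2.2.1, c3.2.2.2.2.2.2⟩
    have : B₂ γ + 3 + 1 = B₂ γ + 4 := rfl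
    rw [this] at c2
    omega
  · rintro m hm s' ⟨d1, d2, d3, d4, d5, d6, d7⟩
    obtain ⟨s₄, t₄, e1, e2, e3, e4, e5⟩ := Hg ((γ, m), V γ m) s'
      (((hs.frame hr d6).extend d2).extend d1)
    refine ⟨_, _, .seq e1 (.seq (.add _ _ _ _) (.seq (.add _ _ _ _) (.sub _ _ _ _))), ?_, ?_⟩
    · have := HB₁ (γ, m) _ (hVb γ m hm.le)
      have := HB₂ γ m hm.le
      omega
    · refine ⟨?_, ?_, ?_, ?_, ?_, fun i hi => ?_, ?_⟩ <;>
        simp only [setReg_reg, setReg_out, Nat.add_left_cancel_iff, e3, e5, e4 r (by omega),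
          e4 (r + 1) (by omega), e4 (r + 2) (by omega), e4 (r + 3) (by omega),
          e4 (r + 4) (by omega), d2, d3, d4, d5, d7, VS] <;> simp
      · omega
      · rw [if_neg (by omega), if_neg (by omega), if_neg (by omega), e4 i (by omega), d6 i hi]
  · refine ⟨?_, ?_, ?_, ?_, ?_, fun i hi => ?_, ?_⟩ <;>
      simp only [setReg_reg, setReg_out, b3, b5, a5, b4 r (by omega), b4 (r + 1) (by omega), V0, a3,
        Nat.add_left_cancel_iff] <;> try simp
    rw [if_neg (by omega), if_neg (by omega), b4 i (by omega), setReg_reg, if_neg (by omega),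
      a4 i hi]

theorem Easy.sum {N : Γ → ℕ} {f : Γ → ℕ → ℕ} (hN : Easy N)
    (hf : Easy fun p : Γ × ℕ => f p.1 p.2) : Easy fun γ => ∑ i ∈ Finset.range (N γ), f γ i := by
  obtain ⟨B, hB, HB⟩ := hf.1.subst hN.1
  refine Easy.recursion (g := fun γ i a => a + f γ i) hN (Easy.const 0) (Easy.var.add hf.fst)
    (fun γ m => ∑ i ∈ Finset.range m, f γ i) (fun γ => rfl)
    (fun γ m => Finset.sum_range_succ _ _) (hN.1.mul hB) fun γ m hm => ?_
  calc ∑ i ∈ Finset.range m, f γ i ≤ ∑ _i ∈ Finset.range m, B γ :=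
        Finset.sum_le_sum fun i hi => HB γ i ((Finset.mem_range.1 hi).le.trans hm)
    _ = m * B γ := by simp
    _ ≤ N γ * B γ := Nat.mul_le_mul_right _ hm

/-- Repeated addition is fast enough because sizes are counted in unary. -/
theorem Easy.mul {F G : Γ → ℕ} (hF : Easy F) (hG : Easy G) : Easy fun γ => F γ * G γ :=
  (Easy.sum (f := fun γ _ => G γ) hF hG.fst).congr fun γ => by simp

theorem Easy.pow {F : Γ → ℕ} (hF : Easy F) (e : ℕ) : Easy fun γ => F γ ^ e := by
  induction e with
  | zero => exact (Easy.const 1).congr fun γ => pow_zero _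
  | succ e ih => exact (ih.mul hF).congr fun γ => pow_succ _ _

theorem EasyP.lt {F G : Γ → ℕ} (hF : Easy F) (hG : Easy G) : EasyP fun γ => F γ < G γ :=
  ⟨_, hG.sub hF, fun γ => by omega⟩

theorem EasyP.not {p : Γ → Prop} (hp : EasyP p) : EasyP fun γ => ¬ p γ := by
  obtain ⟨f, hf, h⟩ := hp
  exact ⟨_, (Easy.const 1).sub hf, fun γ => by
    have := h γ
    simp only [this]
    omega⟩

theorem EasyP.and {p q : Γ → Prop} (hp : EasyP p) (hq : EasyP q) : EasyP fun γ => p γ ∧ q γ := by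
  obtain ⟨f, hf, h⟩ := hp
  obtain ⟨g, hg, h'⟩ := hq
  exact ⟨_, hf.mul hg, fun γ => by simp only [h γ, h' γ, mul_ne_zero_iff]⟩

theorem EasyP.or {p q : Γ → Prop} (hp : EasyP p) (hq : EasyP q) : EasyP fun γ => p γ ∨ q γ :=
  ((hp.not.and hq.not).not).congr fun γ => by tauto

theorem EasyP.imp {p q : Γ → Prop} (hp : EasyP p) (hq : EasyP q) : EasyP fun γ => p γ → q γ :=
  (hp.not.or hq).congr fun γ => by tauto

theorem EasyP.le {F G : Γ → ℕ} (hF : Easy F) (hG : Easy G) : EasyP fun γ => F γ ≤ G γ :=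
  (EasyP.lt hG hF).not.congr fun γ => by omega

theorem EasyP.eq {F G : Γ → ℕ} (hF : Easy F) (hG : Easy G) : EasyP fun γ => F γ = G γ :=
  ((EasyP.le hF hG).and (EasyP.le hG hF)).congr fun γ => by omega

theorem EasyP.const (p : Prop) : EasyP fun _ : Γ => p := by
  classical
  exact ⟨_, Easy.const (if p then 1 else 0), fun γ => by split_ifs <;> simp_all⟩

theorem EasyP.exists_lt {N : Γ → ℕ} {p : Γ → ℕ → Prop} (hN : Easy N)
    (hp : EasyP fun q : Γ × ℕ => p q.1 q.2) : EasyP fun γ => ∃ i < N γ, p γ i := by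
  obtain ⟨f, hf, h⟩ := hp
  refine ⟨_, Easy.sum (f := fun γ i => f (γ, i)) hN hf, fun γ => ?_⟩
  rw [Ne, Finset.sum_eq_zero_iff]
  push Not
  simp only [Finset.mem_range]
  exact exists_congr fun i => and_congr_right fun _ => h (γ, i)

theorem EasyP.forall_lt {N : Γ → ℕ} {p : Γ → ℕ → Prop} (hN : Easy N)
    (hp : EasyP fun q : Γ × ℕ => p q.1 q.2) : EasyP fun γ => ∀ i < N γ, p γ i :=
  (EasyP.exists_lt (p := fun γ i => ¬ p γ i) hN hp.not).not.congr fun γ => by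
    push Not; rfl

/-- A quantifier with constant bound is unrolled into the program, so `p i` need not be decided
uniformly in `i`. -/
theorem EasyP.exists_lt_const {p : ℕ → Γ → Prop} (n : ℕ) (hp : ∀ i, EasyP (p i)) :
    EasyP fun γ => ∃ i < n, p i γ := by
  induction n with
  | zero => exact (EasyP.const False).congr fun γ => by simp
  | succ n ih => exact (ih.or (hp n)).congr fun γ => Nat.exists_lt_succ_right

theorem EasyP.forall_lt_const {p : ℕ → Γ → Prop} (n : ℕ) (hp : ∀ i, EasyP (p i)) :
    EasyP fun γ => ∀ i < n, p i γ :=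
  (EasyP.exists_lt_const n fun i => (hp i).not).not.congr fun γ => by push Not; rfl

/-- The quotient is the number of `i` with `(i + 1) * G ≤ F`, and all of these lie below `F`. -/
theorem Easy.div {F G : Γ → ℕ} (hF : Easy F) (hG : Easy G) : Easy fun γ => F γ / G γ := by
  classical
  refine (Easy.ite (EasyP.eq hG (Easy.const 0)) (Easy.const 0)
    (Easy.sum hF (f := fun γ i => if (i + 1) * G γ ≤ F γ then 1 else 0)
      (Easy.ite (EasyP.le ((Easy.var.add (Easy.const 1)).mul hG.fst) hF.fst) (Easy.const 1)
        (Easy.const 0)))).congr fun γ => ?_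
  split_ifs with h
  · simp [h]
  · rw [Finset.sum_ite]
    have : {i ∈ Finset.range (F γ) | (i + 1) * G γ ≤ F γ} = Finset.range (F γ / G γ) := by
      ext i
      have h1 : (i + 1) * G γ ≤ F γ ↔ i + 1 ≤ F γ / G γ :=
        (Nat.le_div_iff_mul_le (Nat.pos_of_ne_zero h)).symm
      have h2 := Nat.div_le_self (F γ) (G γ)
      simp only [Finset.mem_filter, Finset.mem_range, h1]
      omega
    simp [this]

theorem Easy.mod {F G : Γ → ℕ} (hF : Easy F) (hG : Easy G) : Easy fun γ => F γ % G γ :=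
  (hF.sub (hG.mul (hF.div hG))).congr fun γ => by
    have := Nat.div_add_mod (F γ) (G γ)
    omega

theorem Emits.single {F : Γ → ℕ} (hF : Easy F) : Emits fun γ => [F γ] := by
  intro ρ r hr
  obtain ⟨p, T, hT, H⟩ := hF.2 ρ r hr
  refine ⟨.seq p (.emit r), _, hT.add (PB.const 1), fun γ s hs => ?_⟩
  obtain ⟨s₁, t₁, a1, a2, a3, a4, a5⟩ := H γ s hs
  exact ⟨_, _, .seq a1 (.emit r s₁), by omega, a4, by simp [State.write, a3, a5]⟩

theorem Emits.append {L M : Γ → List ℕ} (hL : Emits L) (hM : Emits M) :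
    Emits fun γ => L γ ++ M γ := by
  intro ρ r hr
  obtain ⟨p, T, hT, H⟩ := hL ρ r hr
  obtain ⟨q, U, hU, K⟩ := hM ρ r hr
  refine ⟨.seq p q, _, hT.add hU, fun γ s hs => ?_⟩
  obtain ⟨s₁, t₁, a1, a2, a4, a5⟩ := H γ s hs
  obtain ⟨s₂, t₂, b1, b2, b4, b5⟩ := K γ s₁ (hs.frame hr a4)
  exact ⟨_, _, .seq a1 b1, by omega, fun i hi => by rw [b4 i hi, a4 i hi],
    by rw [b5, a5, List.append_assoc]⟩

theorem Emits.cons {F : Γ → ℕ} {L : Γ → List ℕ} (hF : Easy F) (hL : Emits L) :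
    Emits fun γ => F γ :: L γ :=
  (Emits.single hF).append hL

theorem Emits.flatMap {N : Γ → ℕ} {L : Γ → ℕ → List ℕ} (hN : Easy N)
    (hL : Emits fun p : Γ × ℕ => L p.1 p.2) :
    Emits fun γ => (List.range (N γ)).flatMap fun i => L γ i := by
  intro ρ r hr
  obtain ⟨pN, TN, hTN, HN⟩ := hN.2 ρ (r + 2) fun i hi => (hr i hi).trans (by omega)
  obtain ⟨pg, Tg, hTg, Hg⟩ := hL (extend Γ ρ (r + 1)) (r + 4)
    (extend_lt (r' := r + 4) hr (by omega) (by omega))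
  obtain ⟨B, hB, HB⟩ := hTg.subst hN.1
  refine ⟨.seq (.const (r + 1) 0) (.seq pN (.seq (.const (r + 3) 1)
    (.whileNZ (r + 2) (.seq pg (.seq (.add (r + 1) (r + 1) (r + 3))
      (.sub (r + 2) (r + 2) (r + 3))))))), _,
    hTN.add ((hN.1.mul (hB.add (PB.const 3))).add (PB.const 3)), fun γ s hs => ?_⟩
  have hs1 : Holds ρ γ (s.setReg (r + 1) 0) := hs.frame hr fun i hi => by
    rw [setReg_reg, if_neg (by omega)]
  obtain ⟨s₂, t₂, b1, b2, b3, b4, b5⟩ := HN γ _ hs1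
  refine Exists.elim (Run.bounded_loop (w := Ctx.word γ) (a := r + 2) (N := N γ)
    (p := .seq pg (.seq (.add (r + 1) (r + 1) (r + 3)) (.sub (r + 2) (r + 2) (r + 3))))
    (T := B γ + 2)
    (fun m s' => s'.reg (r + 1) = m ∧ s'.reg (r + 2) = N γ - m ∧
      s'.reg (r + 3) = 1 ∧ (∀ i < r, s'.reg i = s.reg i) ∧
      s'.out = s.out ++ (List.range m).flatMap fun i => L γ i)
    (fun m s' h => h.2.1) ?_ (s₂.setReg (r + 3) 1) ?_) ?_
  pick_goal 3
  · rintro s₃ ⟨t₃, c1, c2, c3⟩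
    refine ⟨_, _, .seq (.const _ _ _) (.seq b1 (.seq (.const _ _ _) c1)), ?_, c3.2.2.2.1,
      c3.2.2.2.2⟩
    have : B γ + 2 + 1 = B γ + 3 := rfl
    rw [this] at c2
    omega
  · rintro m hm s' ⟨d2, d3, d4, d6, d7⟩
    obtain ⟨s₄, t₄, e1, e2, e4, e5⟩ := Hg (γ, m) s' ((hs.frame hr d6).extend d2)
    refine ⟨_, _, .seq e1 (.seq (.add _ _ _ _) (.sub _ _ _ _)), ?_, ?_⟩
    · have := HB γ m hm.le
      omega
    · refine ⟨?_, ?_, ?_, fun i hi => ?_, ?_⟩ <;>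
        simp only [setReg_reg, setReg_out, Nat.add_left_cancel_iff, e5,
          e4 (r + 1) (by omega), e4 (r + 2) (by omega), e4 (r + 3) (by omega),
          d2, d3, d4, d7] <;> simp
      · omega
      · rw [if_neg (by omega), if_neg (by omega), e4 i (by omega), d6 i hi]
      · simp [List.range_succ]
  · refine ⟨?_, ?_, ?_, fun i hi => ?_, ?_⟩ <;>
      simp only [setReg_reg, setReg_out, b3, b5, b4 (r + 1) (by omega),
        Nat.add_left_cancel_iff] <;> try simp
    rw [if_neg (by omega), b4 i (by omega), setReg_reg, if_neg (by omega)]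

theorem Emits.map {N : Γ → ℕ} {F : Γ → ℕ → ℕ} (hN : Easy N)
    (hF : Easy fun p : Γ × ℕ => F p.1 p.2) :
    Emits fun γ => (List.range (N γ)).map fun i => F γ i :=
  (Emits.flatMap (L := fun γ i => [F γ i]) hN (Emits.single hF)).congr fun γ => by
    simp [← List.map_eq_flatMap]

end

/-! ## Composition of parameterized reductions -/

namespace Prog

/-- The first program of a composition: registers and memory cells are spread out, and the output
is written to the memory cells `3 i + 1`, its length to register `0`. -/
def stage₁ : Prog → Prog
  | const d c => const (2 * d + 2) c
  | add d a b => add (2 * d + 2) (2 * a + 2) (2 * b + 2)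
  | sub d a b => sub (2 * d + 2) (2 * a + 2) (2 * b + 2)
  | load d a => seq (add 1 (2 * a + 2) (2 * a + 2)) (seq (add 1 1 (2 * a + 2)) (load (2 * d + 2) 1))
  | store a b => seq (add 1 (2 * a + 2) (2 * a + 2))
      (seq (add 1 1 (2 * a + 2)) (store 1 (2 * b + 2)))
  | input d a => input (2 * d + 2) (2 * a + 2)
  | inputLen d => inputLen (2 * d + 2)
  | emit a => seq (const 1 1) (seq (add 1 1 0) (seq (add 1 1 0) (seq (add 1 1 0)
      (seq (store 1 (2 * a + 2)) (seq (const 1 1) (add 0 0 1))))))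
  | seq p q => seq p.stage₁ q.stage₁
  | ifNZ a p q => ifNZ (2 * a + 2) p.stage₁ q.stage₁
  | whileNZ a p => whileNZ (2 * a + 2) p.stage₁

/-- The second program of a composition: it reads its input from the memory cells `3 i + 1`. -/
def stage₂ : Prog → Prog
  | const d c => const (2 * d + 3) c
  | add d a b => add (2 * d + 3) (2 * a + 3) (2 * b + 3)
  | sub d a b => sub (2 * d + 3) (2 * a + 3) (2 * b + 3)
  | load d a => seq (const 1 2) (seq (add 1 1 (2 * a + 3)) (seq (add 1 1 (2 * a + 3))
      (seq (add 1 1 (2 * a + 3)) (load (2 * d + 3) 1))))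
  | store a b => seq (const 1 2) (seq (add 1 1 (2 * a + 3)) (seq (add 1 1 (2 * a + 3))
      (seq (add 1 1 (2 * a + 3)) (store 1 (2 * b + 3)))))
  | input d a => seq (const 1 1) (seq (add 1 1 (2 * a + 3)) (seq (add 1 1 (2 * a + 3))
      (seq (add 1 1 (2 * a + 3)) (load (2 * d + 3) 1))))
  | inputLen d => seq (const 1 0) (add (2 * d + 3) 0 1)
  | emit a => emit (2 * a + 3)
  | seq p q => seq p.stage₂ q.stage₂
  | ifNZ a p q => ifNZ (2 * a + 3) p.stage₂ q.stage₂
  | whileNZ a p => whileNZ (2 * a + 3) p.stage₂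

/-- The largest constant of a program. -/
def maxConst : Prog → ℕ
  | const _ c => c
  | seq p q => max p.maxConst q.maxConst
  | ifNZ _ p q => max p.maxConst q.maxConst
  | whileNZ _ p => p.maxConst
  | _ => 0

end Prog

theorem setReg_mem (s : State) (d x : ℕ) : (s.setReg d x).mem = s.mem := rfl
theorem setMem_out (s : State) (a x : ℕ) : (s.setMem a x).out = s.out := rfl
theorem setMem_mem (s : State) (a x i : ℕ) :
    (s.setMem a x).mem i = if i = a then x else s.mem i := by
  simp [State.setMem, Function.update_apply]
theorem write_out (s : State) (x : ℕ) : (s.write x).out = s.out ++ [x] := rfl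

/-- The configuration `s'` represents the configuration `s` of the first program. -/
structure Rep₁ (s s' : State) : Prop where
  reg : ∀ i, s'.reg (2 * i + 2) = s.reg i
  free : ∀ i, s'.reg (2 * i + 3) = 0
  len : s'.reg 0 = s.out.length
  mem : ∀ a, s'.mem (3 * a) = s.mem a
  out : ∀ i, s'.mem (3 * i + 1) = s.out.getD i 0
  fresh : ∀ i, s'.mem (3 * i + 2) = 0
  nil : s'.out = []

/-- The configuration `s'` represents the configuration `s` of the second program on input `y`. -/
structure Rep₂ (y : List ℕ) (s s' : State) : Prop where
  reg : ∀ i, s'.reg (2 * i + 3) = s.reg i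
  len : s'.reg 0 = y.length
  mem : ∀ a, s'.mem (3 * a + 2) = s.mem a
  inp : ∀ i, s'.mem (3 * i + 1) = y.getD i 0
  out : s'.out = s.out

theorem Rep₁.setReg {s s' : State} (h : Rep₁ s s') (d x : ℕ) :
    Rep₁ (s.setReg d x) (s'.setReg (2 * d + 2) x) where
  reg i := by
    by_cases hi : i = d
    · simp [setReg_reg, hi]
    · rw [setReg_reg, setReg_reg, if_neg (by omega), if_neg hi, h.reg]
  free i := by rw [setReg_reg, if_neg (by omega), h.free]
  len := by rw [setReg_reg, if_neg (by omega), h.len]; rfl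
  mem := h.mem
  out := h.out
  fresh := h.fresh
  nil := h.nil

theorem Rep₁.temp {s s' : State} (h : Rep₁ s s') (x : ℕ) : Rep₁ s (s'.setReg 1 x) where
  reg i := by rw [setReg_reg, if_neg (by omega), h.reg]
  free i := by rw [setReg_reg, if_neg (by omega), h.free]
  len := by rw [setReg_reg, if_neg (by omega), h.len]
  mem := h.mem
  out := h.out
  fresh := h.fresh
  nil := h.nil

theorem Rep₂.setReg {y : List ℕ} {s s' : State} (h : Rep₂ y s s') (d x : ℕ) :
    Rep₂ y (s.setReg d x) (s'.setReg (2 * d + 3) x) where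
  reg i := by
    by_cases hi : i = d
    · simp [setReg_reg, hi]
    · rw [setReg_reg, setReg_reg, if_neg (by omega), if_neg hi, h.reg]
  len := by rw [setReg_reg, if_neg (by omega), h.len]
  mem := h.mem
  inp := h.inp
  out := h.out

theorem Rep₂.temp {y : List ℕ} {s s' : State} (h : Rep₂ y s s') (x : ℕ) :
    Rep₂ y s (s'.setReg 1 x) where
  reg i := by rw [setReg_reg, if_neg (by omega), h.reg]
  len := by rw [setReg_reg, if_neg (by omega), h.len]
  mem := h.mem
  inp := h.inp
  out := h.out

theorem Rep₁.setMem {s s' : State} (h : Rep₁ s s') (a x : ℕ) :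
    Rep₁ (s.setMem a x) (s'.setMem (3 * a) x) where
  reg := h.reg
  free := h.free
  len := h.len
  mem i := by
    by_cases hi : i = a
    · simp [setMem_mem, hi]
    · rw [setMem_mem, setMem_mem, if_neg (by omega), if_neg hi, h.mem]
  out i := by rw [setMem_mem, if_neg (by omega), h.out]; rfl
  fresh i := by rw [setMem_mem, if_neg (by omega), h.fresh]
  nil := h.nil

theorem Rep₂.setMem {y : List ℕ} {s s' : State} (h : Rep₂ y s s') (a x : ℕ) :
    Rep₂ y (s.setMem a x) (s'.setMem (3 * a + 2) x) where
  reg := h.reg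
  len := h.len
  mem i := by
    by_cases hi : i = a
    · simp [setMem_mem, hi]
    · rw [setMem_mem, setMem_mem, if_neg (by omega), if_neg hi, h.mem]
  inp i := by rw [setMem_mem, if_neg (by omega), h.inp]
  out := h.out

theorem Rep₁.emit {s s' : State} (h : Rep₁ s s') (x : ℕ) :
    Rep₁ (s.write x) ((s'.setMem (3 * s.out.length + 1) x).setReg 0 (s.out.length + 1)) where
  reg i := by rw [setReg_reg, if_neg (by omega)]; exact h.reg i
  free i := by rw [setReg_reg, if_neg (by omega)]; exact h.free i
  len := by simp [setReg_reg, write_out]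
  mem i := by rw [setReg_mem, setMem_mem, if_neg (by omega), h.mem]; rfl
  out i := by
    rw [setReg_mem, setMem_mem, write_out, List.getD_eq_getElem?_getD, List.getElem?_append]
    split_ifs with h1 h2 h2
    · omega
    · have : i = s.out.length := by omega
      simp [this]
    · rw [h.out, List.getD_eq_getElem?_getD]
    · have h3 : i - s.out.length ≠ 0 := by omega
      rw [h.out, List.getD_eq_getElem?_getD, List.getElem?_eq_none (by omega),
        List.getElem?_eq_none (by simp; omega)]
  fresh i := by rw [setReg_mem, setMem_mem, if_neg (by omega), h.fresh]
  nil := h.nil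

theorem setReg_setReg (s : State) (d x y : ℕ) : (s.setReg d x).setReg d y = s.setReg d y := by
  simp [State.setReg]

/-- Step by step simulation; the costliest instruction is `emit` with seven steps, and the factor 8
also covers tests and loops. -/
theorem Run.stage₁ {w : List ℕ} {p : Prog} {s s' : State} {t : ℕ} (h : Run w p s s' t) :
    ∀ z, Rep₁ s z → ∃ z' t', Run w p.stage₁ z z' t' ∧ t' ≤ 8 * t ∧ Rep₁ s' z' := by
  induction h with
  | const d c s => exact fun z hz => ⟨_, _, .const _ _ _, by omega, hz.setReg d c⟩
  | add d a b s =>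
    exact fun z hz => ⟨_, _, .add _ _ _ _, by omega, by rw [hz.reg, hz.reg]; exact hz.setReg d _⟩
  | sub d a b s =>
    exact fun z hz => ⟨_, _, .sub _ _ _ _, by omega, by rw [hz.reg, hz.reg]; exact hz.setReg d _⟩
  | load d a s =>
    intro z hz
    refine ⟨_, _, .seq (.add _ _ _ _) (.seq (.add _ _ _ _) (.load _ _ _)), by omega, ?_⟩
    have e : s.reg a + s.reg a + s.reg a = 3 * s.reg a := by omega
    simpa [setReg_reg, hz.reg, setReg_mem, e, hz.mem] using
      (((hz.temp _).temp _).setReg d (s.mem (s.reg a)))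
  | store a b s =>
    intro z hz
    refine ⟨_, _, .seq (.add _ _ _ _) (.seq (.add _ _ _ _) (.store _ _ _)), by omega, ?_⟩
    have e : s.reg a + s.reg a + s.reg a = 3 * s.reg a := by omega
    simpa [setReg_reg, hz.reg, setReg_mem, e, hz.mem] using
      (((hz.temp _).temp _).setMem (s.reg a) (s.reg b))
  | input d a s =>
    exact fun z hz => ⟨_, _, .input _ _ _, by omega, by rw [hz.reg]; exact hz.setReg d _⟩
  | inputLen d s => exact fun z hz => ⟨_, _, .inputLen _ _, by omega, hz.setReg d _⟩
  | emit a s =>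
    intro z hz
    refine ⟨_, _, .seq (.const _ _ _) (.seq (.add _ _ _ _) (.seq (.add _ _ _ _)
      (.seq (.add _ _ _ _) (.seq (.store _ _ _) (.seq (.const _ _ _) (.add _ _ _ _)))))), by omega,
      ?_⟩
    have e : 1 + s.out.length + s.out.length + s.out.length = 3 * s.out.length + 1 := by omega
    simp only [setReg_setReg]
    have := ((hz.temp (3 * s.out.length + 1)).emit (s.reg a)).temp 1
    convert this using 1
    simp [State.setReg, State.setMem, hz.len, e, hz.reg]
    ext i
    simp only [Function.update_apply]
    split_ifs <;> simp_all
  | seq _ _ ih₁ ih₂ =>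
    intro z hz
    obtain ⟨z₁, t₁, a1, a2, a3⟩ := ih₁ z hz
    obtain ⟨z₂, t₂, b1, b2, b3⟩ := ih₂ z₁ a3
    exact ⟨_, _, .seq a1 b1, by omega, b3⟩
  | ifTrue ha _ ih =>
    intro z hz
    obtain ⟨z₁, t₁, a1, a2, a3⟩ := ih z hz
    exact ⟨_, _, .ifTrue (by rwa [hz.reg]) a1, by omega, a3⟩
  | ifFalse ha _ ih =>
    intro z hz
    obtain ⟨z₁, t₁, a1, a2, a3⟩ := ih z hz
    exact ⟨_, _, .ifFalse (by rwa [hz.reg]) a1, by omega, a3⟩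
  | whileDone ha => exact fun z hz => ⟨_, _, .whileDone (by rwa [hz.reg]), by omega, hz⟩
  | whileStep ha _ _ ih₁ ih₂ =>
    intro z hz
    obtain ⟨z₁, t₁, a1, a2, a3⟩ := ih₁ z hz
    obtain ⟨z₂, t₂, b1, b2, b3⟩ := ih₂ z₁ a3
    exact ⟨_, _, .whileStep (by rwa [hz.reg]) a1 b1, by omega, b3⟩

theorem Run.stage₂ {w y : List ℕ} {p : Prog} {s s' : State} {t : ℕ} (h : Run y p s s' t) :
    ∀ z, Rep₂ y s z → ∃ z' t', Run w p.stage₂ z z' t' ∧ t' ≤ 8 * t ∧ Rep₂ y s' z' := by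
  induction h with
  | const d c s => exact fun z hz => ⟨_, _, .const _ _ _, by omega, hz.setReg d c⟩
  | add d a b s =>
    exact fun z hz => ⟨_, _, .add _ _ _ _, by omega, by rw [hz.reg, hz.reg]; exact hz.setReg d _⟩
  | sub d a b s =>
    exact fun z hz => ⟨_, _, .sub _ _ _ _, by omega, by rw [hz.reg, hz.reg]; exact hz.setReg d _⟩
  | load d a s =>
    intro z hz
    refine ⟨_, _, .seq (.const _ _ _) (.seq (.add _ _ _ _) (.seq (.add _ _ _ _)
      (.seq (.add _ _ _ _) (.load _ _ _)))), by omega, ?_⟩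
    have e : 2 + s.reg a + s.reg a + s.reg a = 3 * s.reg a + 2 := by omega
    simpa [setReg_reg, hz.reg, setReg_mem, e, hz.mem, setReg_setReg] using
      ((hz.temp _).setReg d (s.mem (s.reg a)))
  | store a b s =>
    intro z hz
    refine ⟨_, _, .seq (.const _ _ _) (.seq (.add _ _ _ _) (.seq (.add _ _ _ _)
      (.seq (.add _ _ _ _) (.store _ _ _)))), by omega, ?_⟩
    have e : 2 + s.reg a + s.reg a + s.reg a = 3 * s.reg a + 2 := by omega
    simpa [setReg_reg, hz.reg, setReg_mem, e, hz.mem, setReg_setReg] using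
      ((hz.temp _).setMem (s.reg a) (s.reg b))
  | input d a s =>
    intro z hz
    refine ⟨_, _, .seq (.const _ _ _) (.seq (.add _ _ _ _) (.seq (.add _ _ _ _)
      (.seq (.add _ _ _ _) (.load _ _ _)))), by omega, ?_⟩
    have e : 1 + s.reg a + s.reg a + s.reg a = 3 * s.reg a + 1 := by omega
    simpa [setReg_reg, hz.reg, setReg_mem, e, hz.inp, setReg_setReg] using
      ((hz.temp _).setReg d (y.getD (s.reg a) 0))
  | inputLen d s =>
    intro z hz
    refine ⟨_, _, .seq (.const _ _ _) (.add _ _ _ _), by omega, ?_⟩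
    simpa [setReg_reg, hz.len] using ((hz.temp 0).setReg d y.length)
  | emit a s =>
    intro z hz
    refine ⟨_, _, .emit _ _, by omega, ?_⟩
    exact ⟨hz.reg, hz.len, hz.mem, hz.inp, by rw [write_out, write_out, hz.out, hz.reg]⟩
  | seq _ _ ih₁ ih₂ =>
    intro z hz
    obtain ⟨z₁, t₁, a1, a2, a3⟩ := ih₁ z hz
    obtain ⟨z₂, t₂, b1, b2, b3⟩ := ih₂ z₁ a3
    exact ⟨_, _, .seq a1 b1, by omega, b3⟩
  | ifTrue ha _ ih =>
    intro z hz
    obtain ⟨z₁, t₁, a1, a2, a3⟩ := ih z hz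
    exact ⟨_, _, .ifTrue (by rwa [hz.reg]) a1, by omega, a3⟩
  | ifFalse ha _ ih =>
    intro z hz
    obtain ⟨z₁, t₁, a1, a2, a3⟩ := ih z hz
    exact ⟨_, _, .ifFalse (by rwa [hz.reg]) a1, by omega, a3⟩
  | whileDone ha => exact fun z hz => ⟨_, _, .whileDone (by rwa [hz.reg]), by omega, hz⟩
  | whileStep ha _ _ ih₁ ih₂ =>
    intro z hz
    obtain ⟨z₁, t₁, a1, a2, a3⟩ := ih₁ z hz
    obtain ⟨z₂, t₂, b1, b2, b3⟩ := ih₂ z₁ a3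
    exact ⟨_, _, .whileStep (by rwa [hz.reg]) a1 b1, by omega, b3⟩

/-- The invariant of the first stage keeps the registers `2 i + 3` and the cells `3 i + 2` at zero,
so its final configuration represents an initial configuration of the second machine with the
intermediate word as input. -/
theorem Outputs.comp {w y z : List ℕ} {p q : Prog} {t u : ℕ} (hp : Outputs p w y t)
    (hq : Outputs q y z u) : ∃ v ≤ 8 * (t + u), Outputs (.seq p.stage₁ q.stage₂) w z v := by
  obtain ⟨s, h1, rfl⟩ := hp
  obtain ⟨s', h2, rfl⟩ := hq
  obtain ⟨a, t', a1, a2, a3⟩ := h1.stage₁ State.init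
    ⟨fun _ => rfl, fun _ => rfl, rfl, fun _ => rfl, fun _ => rfl, fun _ => rfl, rfl⟩
  obtain ⟨b, u', b1, b2, b3⟩ := h2.stage₂ (w := w) a ⟨a3.free, a3.len, a3.fresh, a3.out, a3.nil⟩
  exact ⟨_, by omega, _, .seq a1 b1, b3.out⟩

/-- All numbers of the configuration are below `2 ^ M`. -/
structure Below (M : ℕ) (s : State) : Prop where
  reg : ∀ i, s.reg i < 2 ^ M
  mem : ∀ i, s.mem i < 2 ^ M
  out : ∀ x ∈ s.out, x < 2 ^ M

theorem Below.setReg {M : ℕ} {s : State} (h : Below M s) {d x : ℕ} (hx : x < 2 ^ (M + 1)) :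
    Below (M + 1) (s.setReg d x) := by
  have h2 : 2 ^ M ≤ 2 ^ (M + 1) := Nat.pow_le_pow_right (by omega) (by omega)
  refine ⟨fun i => ?_, fun i => (h.mem i).trans_le h2, fun x hx => (h.out x hx).trans_le h2⟩
  rw [setReg_reg]
  split_ifs
  · exact hx
  · exact (h.reg i).trans_le h2

/-- A sum of two numbers is at most one bit longer than the larger one, and every other instruction
copies, decreases, or loads an input entry, the input length or a program constant. Hence one bit
and one output entry per step. -/
theorem Run.growth {w : List ℕ} {p : Prog} {s s' : State} {t : ℕ} (h : Run w p s s' t) :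
    ∀ M, p.maxConst < 2 ^ M → (∀ x ∈ w, x < 2 ^ M) → w.length < 2 ^ M → Below M s →
      Below (M + t) s' ∧ s'.out.length ≤ s.out.length + t := by
  have mono : ∀ M t : ℕ, 2 ^ M ≤ 2 ^ (M + t) := fun M t =>
    Nat.pow_le_pow_right (by omega) (by omega)
  induction h with
  | const d c s =>
    intro M hc _ _ hs
    exact ⟨hs.setReg (lt_of_lt_of_le hc (mono M 1)), by simp [setReg_out]⟩
  | add d a b s =>
    intro M hc _ _ hs
    refine ⟨hs.setReg ?_, by simp [setReg_out]⟩
    have := hs.reg a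
    have := hs.reg b
    rw [pow_succ]
    omega
  | sub d a b s =>
    intro M hc _ _ hs
    refine ⟨hs.setReg ?_, by simp [setReg_out]⟩
    have := hs.reg a
    have := mono M 1
    omega
  | load d a s =>
    intro M hc _ _ hs
    exact ⟨hs.setReg ((hs.mem _).trans_le (mono M 1)), by simp [setReg_out]⟩
  | store a b s =>
    intro M hc _ _ hs
    refine ⟨⟨fun i => (hs.reg i).trans_le (mono M 1), fun i => ?_,
      fun x hx => (hs.out x hx).trans_le (mono M 1)⟩, by simp [setMem_out]⟩
    rw [setMem_mem]
    split_ifs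
    · exact (hs.reg b).trans_le (mono M 1)
    · exact (hs.mem i).trans_le (mono M 1)
  | input d a s =>
    intro M hc hw _ hs
    refine ⟨hs.setReg ?_, by simp [setReg_out]⟩
    rw [List.getD_eq_getElem?_getD]
    by_cases h : s.reg a < w.length
    · rw [List.getElem?_eq_getElem h]
      exact (hw _ (List.getElem_mem h)).trans_le (mono M 1)
    · simp [List.getElem?_eq_none (not_lt.1 h)]
  | inputLen d s =>
    intro M hc _ hw hs
    exact ⟨hs.setReg (hw.trans_le (mono M 1)), by simp [setReg_out]⟩
  | emit a s =>
    intro M hc _ hw hs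
    refine ⟨⟨fun i => (hs.reg i).trans_le (mono M 1), fun i => (hs.mem i).trans_le (mono M 1),
      fun x hx => ?_⟩, by simp [write_out]⟩
    rw [write_out, List.mem_append, List.mem_singleton] at hx
    rcases hx with hx | rfl
    · exact (hs.out x hx).trans_le (mono M 1)
    · exact (hs.reg a).trans_le (mono M 1)
  | @seq p q s s' s'' t t' _ _ ih₁ ih₂ =>
    intro M hc hw hl hs
    have hm := mono M t
    obtain ⟨h1, h2⟩ := ih₁ M (lt_of_le_of_lt (le_max_left _ _) hc) hw hl hs
    obtain ⟨h3, h4⟩ := ih₂ (M + t) ((lt_of_le_of_lt (le_max_right _ _) hc).trans_le hm)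
      (fun x hx => (hw x hx).trans_le hm) (hl.trans_le hm) h1
    exact ⟨by rwa [← add_assoc], by omega⟩
  | ifTrue _ _ ih =>
    intro M hc hw hl hs
    obtain ⟨h1, h2⟩ := ih M (lt_of_le_of_lt (le_max_left _ _) hc) hw hl hs
    exact ⟨⟨fun i => (h1.reg i).trans_le (mono _ 1), fun i => (h1.mem i).trans_le (mono _ 1),
      fun i hi => (h1.out i hi).trans_le (mono _ 1)⟩, by omega⟩
  | ifFalse _ _ ih =>
    intro M hc hw hl hs
    obtain ⟨h1, h2⟩ := ih M (lt_of_le_of_lt (le_max_right _ _) hc) hw hl hs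
    exact ⟨⟨fun i => (h1.reg i).trans_le (mono _ 1), fun i => (h1.mem i).trans_le (mono _ 1),
      fun i hi => (h1.out i hi).trans_le (mono _ 1)⟩, by omega⟩
  | whileDone _ =>
    intro M hc hw hl hs
    exact ⟨⟨fun i => (hs.reg i).trans_le (mono _ 1), fun i => (hs.mem i).trans_le (mono _ 1),
      fun i hi => (hs.out i hi).trans_le (mono _ 1)⟩, by omega⟩
  | @whileStep a p s s' s'' t t' _ _ _ ih₁ ih₂ =>
    intro M hc hw hl hs
    have hm := mono M t
    obtain ⟨h1, h2⟩ := ih₁ M hc hw hl hs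
    obtain ⟨h3, h4⟩ := ih₂ (M + t) (hc.trans_le hm)
      (fun x hx => (hw x hx).trans_le hm) (hl.trans_le hm) h1
    have hm' := mono (M + t + t') 1
    exact ⟨by rw [← add_assoc, ← add_assoc]; exact ⟨fun i => (h3.reg i).trans_le hm',
      fun i => (h3.mem i).trans_le hm', fun i hi => (h3.out i hi).trans_le hm'⟩, by omega⟩

/-! ### Size of the intermediate word, computable bounds, transitivity of reductions -/

theorem size_le_wordSize {w : List ℕ} {x : ℕ} (hx : x ∈ w) : Nat.size x ≤ wordSize w := by
  have := List.le_sum_of_mem (List.mem_map_of_mem (f := fun a => Nat.size a + 1) hx)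
  unfold wordSize
  omega

theorem length_le_wordSize (w : List ℕ) : w.length ≤ wordSize w := by
  induction w with
  | nil => simp
  | cons a w ih => simp only [wordSize, List.map_cons, List.sum_cons, List.length_cons] at *; omega

theorem wordSize_le {M : ℕ} {y : List ℕ} (h : ∀ x ∈ y, x < 2 ^ M) :
    wordSize y ≤ y.length * (M + 1) := by
  induction y with
  | nil => simp [wordSize]
  | cons a y ih =>
    have h1 := ih fun x hx => h x (List.mem_cons_of_mem _ hx)
    have h2 : a.size ≤ M := Nat.size_le.2 (h a List.mem_cons_self)
    simp only [wordSize, List.map_cons, List.sum_cons, List.length_cons] at *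
    rw [Nat.succ_mul]
    omega

theorem Outputs.wordSize_le {w y : List ℕ} {p : Prog} {t : ℕ} (h : Outputs p w y t) :
    wordSize y ≤ t * (p.maxConst + wordSize w + t + 1) := by
  obtain ⟨s, h1, rfl⟩ := h
  have hp : ∀ a, a ≤ p.maxConst + wordSize w → a < 2 ^ (p.maxConst + wordSize w) := fun a ha =>
    ha.trans_lt Nat.lt_two_pow_self
  obtain ⟨h2, h3⟩ := h1.growth (p.maxConst + wordSize w) (hp _ (by omega))
    (fun x hx => (Nat.lt_size_self x).trans_le (Nat.pow_le_pow_right (by omega)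
      ((size_le_wordSize hx).trans (by omega))))
    (hp _ ((length_le_wordSize w).trans (by omega)))
    ⟨fun _ => by simp [State.init], fun _ => by simp [State.init], by simp [State.init]⟩
  refine (ParamComplexity.wordSize_le h2.out).trans (Nat.mul_le_mul_right _ ?_)
  simpa [State.init] using h3

theorem computable_add {f g : ℕ → ℕ} (hf : Computable f) (hg : Computable g) :
    Computable fun k => f k + g k := Primrec.nat_add.to_comp.comp hf hg

theorem computable_mul {f g : ℕ → ℕ} (hf : Computable f) (hg : Computable g) :
    Computable fun k => f k * g k := Primrec.nat_mul.to_comp.comp hf hg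

theorem computable_pow {f : ℕ → ℕ} (hf : Computable f) (c : ℕ) : Computable fun k => f k ^ c := by
  induction c with
  | zero => simpa using Computable.const 1
  | succ c ih => simpa [pow_succ] using computable_mul ih hf

theorem computable_sum {f : ℕ → ℕ} (hf : Computable f) :
    Computable fun k => ∑ i ∈ Finset.range k, f i := by
  have h : Computable fun k : ℕ =>
      (Nat.rec 0 (fun i a => a + f i) k : ℕ) :=
    Computable.nat_rec (f := fun k : ℕ => k) (g := fun _ => 0) (h := fun _ p => p.2 + f p.1)
      Computable.id (Computable.const 0)
      (Primrec.nat_add.to_comp.comp (Computable.snd.comp Computable.snd)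
        (hf.comp (Computable.fst.comp Computable.snd)))
  refine h.of_eq fun k => ?_
  induction k with
  | zero => rfl
  | succ k ih => rw [Finset.sum_range_succ, ← ih]

theorem FPTReducible.trans {P Q R : ParamProblem} (h₁ : FPTReducible P Q)
    (h₂ : FPTReducible Q R) : FPTReducible P R := by
  obtain ⟨g₁, y₁, ⟨k₁, ck₁, b₁⟩, p₁, f₁, c₁, cf₁, T₁⟩ := h₁
  obtain ⟨g₂, y₂, ⟨k₂, ck₂, b₂⟩, p₂, f₂, c₂, cf₂, T₂⟩ := h₂
  -- The intermediate parameter is only known to be at most `k₁ k`, and `k₂` and `f₂` need not be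
  -- monotone; partial sums are computable majorants that cover all smaller arguments.
  have bound : ∀ (f : ℕ → ℕ) (a b : ℕ), a ≤ b → f a ≤ ∑ i ∈ Finset.range (b + 1), f i :=
    fun f a b hab => Finset.single_le_sum (f := f) (fun _ _ => Nat.zero_le _)
      (Finset.mem_range.2 (by omega))
  have cs : ∀ f : ℕ → ℕ, Computable f →
      Computable fun k => ∑ i ∈ Finset.range (k₁ k + 1), f i := fun f hf =>
    (computable_sum hf).comp (Computable.succ.comp ck₁)
  -- The added 1 makes `A` positive, so that lower-order terms can be absorbed into products with
  -- it.
  let A : ℕ → ℕ := fun k => f₁ k + 1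
  let S : ℕ → ℕ := fun k => A k * (A k * (p₁.maxConst + 3))
  have cA : Computable A := Computable.succ.comp cf₁
  have cS : Computable S := computable_mul cA (computable_mul cA (Computable.const _))
  refine ⟨fun x => g₂ (g₁ x), fun x => (y₁ x).trans (y₂ _),
    ⟨_, cs k₂ ck₂, fun x => (b₂ _).trans (bound k₂ _ _ (b₁ x))⟩,
    .seq p₁.stage₁ p₂.stage₂,
    fun k => 8 * (A k + (∑ i ∈ Finset.range (k₁ k + 1), f₂ i) * S k ^ c₂),
    c₁ + (2 * c₁ + 1) * c₂,
    computable_mul (Computable.const 8)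
      (computable_add cA (computable_mul (cs f₂ cf₂) (computable_pow cS c₂))), fun x => ?_⟩
  obtain ⟨t₁, ht₁, o₁⟩ := T₁ x
  obtain ⟨t₂, ht₂, o₂⟩ := T₂ (g₁ x)
  obtain ⟨v, hv, o⟩ := o₁.comp o₂
  refine ⟨v, hv.trans ?_, o⟩
  have hw := o₁.wordSize_le
  set n := wordSize (P.word x) with hn
  set k := P.param x with hk
  have n1 : 1 ≤ n := le_trans (by simp [ParamProblem.word]) (length_le_wordSize (P.word x))
  have e1 : t₁ ≤ A k * n ^ c₁ := ht₁.trans (Nat.mul_le_mul_right _ (Nat.le_succ _))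
  have A1 : 1 ≤ A k := Nat.le_add_left _ _
  have N1 : 1 ≤ n ^ c₁ := Nat.one_le_pow _ _ n1
  have e2 : p₁.maxConst + n + t₁ + 1 ≤ A k * (p₁.maxConst + 3) * n ^ (c₁ + 1) := by
    have a1 : 1 ≤ A k * n ^ (c₁ + 1) := Nat.mul_pos A1 (Nat.pow_pos n1)
    have a2 : n ≤ A k * n ^ (c₁ + 1) := by
      rw [pow_succ]
      nlinarith [Nat.mul_pos A1 N1]
    have a3 : A k * n ^ c₁ ≤ A k * n ^ (c₁ + 1) :=
      Nat.mul_le_mul_left _ (Nat.pow_le_pow_right n1 (by omega))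
    nlinarith
  have e3 : wordSize (Q.word (g₁ x)) ≤ S k * n ^ (2 * c₁ + 1) := by
    refine hw.trans ((Nat.mul_le_mul e1 e2).trans (le_of_eq ?_))
    simp only [S]
    ring
  have e4 : t₂ ≤ (∑ i ∈ Finset.range (k₁ k + 1), f₂ i) * S k ^ c₂ * n ^ ((2 * c₁ + 1) * c₂) := by
    refine ht₂.trans ((Nat.mul_le_mul (bound f₂ _ _ (b₁ x)) (Nat.pow_le_pow_left e3 c₂)).trans
      (le_of_eq ?_))
    rw [mul_pow, ← pow_mul, mul_assoc]
  have e5 : n ^ c₁ ≤ n ^ (c₁ + (2 * c₁ + 1) * c₂) := Nat.pow_le_pow_right n1 (by omega)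
  have e6 : n ^ ((2 * c₁ + 1) * c₂) ≤ n ^ (c₁ + (2 * c₁ + 1) * c₂) :=
    Nat.pow_le_pow_right n1 (by omega)
  have e7 := e1.trans (Nat.mul_le_mul_left _ e5)
  have e8 := e4.trans (Nat.mul_le_mul_left _ e6)
  calc 8 * (t₁ + t₂) ≤ 8 * (A k * n ^ (c₁ + (2 * c₁ + 1) * c₂) +
        (∑ i ∈ Finset.range (k₁ k + 1), f₂ i) * S k ^ c₂ * n ^ (c₁ + (2 * c₁ + 1) * c₂)) := by omega
    _ = _ := by ring

/-! ## Quotients and contractions -/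

namespace LGraph

/-- The graph obtained by identifying vertices with the same image under `f`. -/
def quot (G : LGraph) (f : ℕ → ℕ) : LGraph where
  verts := G.verts.image f
  Adj x y := x ≠ y ∧ ∃ a b, G.Adj a b ∧ f a = x ∧ f b = y
  symm := by
    rintro x y ⟨h, a, b, hab, ha, hb⟩
    exact ⟨h.symm, b, a, G.symm _ _ hab, hb, ha⟩
  irrefl := fun x h => h.1 rfl
  mem_of_adj := by
    rintro x y ⟨-, a, b, hab, rfl, -⟩
    exact Finset.mem_image_of_mem _ (G.mem_of_adj _ _ hab)

theorem quot_quot (G : LGraph) (f g : ℕ → ℕ) : (G.quot f).quot g = G.quot (g ∘ f) := by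
  ext x y
  · simp [quot]
  · constructor
    · rintro ⟨h, -, -, ⟨-, a, b, hab, rfl, rfl⟩, ha, hb⟩
      exact ⟨h, a, b, hab, ha, hb⟩
    · rintro ⟨h, a, b, hab, ha, hb⟩
      exact ⟨h, f a, f b, ⟨fun e => h (by rw [← ha, ← hb]; simp [e]), a, b, hab, rfl, rfl⟩, ha, hb⟩

theorem quot_id (G : LGraph) : G.quot id = G := by
  ext x y
  · simp [quot]
  · constructor
    · rintro ⟨-, a, b, hab, rfl, rfl⟩
      exact hab
    · exact fun h => ⟨fun e => G.irrefl y (e ▸ h), x, y, h, rfl, rfl⟩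

/-- A contraction identifies `v` with `u`, so a sequence of contractions becomes a composition of
maps on labels. -/
theorem contract_eq_quot (G : LGraph) (u v : ℕ) (h : G.Adj u v) :
    G.contract u v h = G.quot (Function.update id v u) := by
  have huv : u ≠ v := fun e => G.irrefl v (e ▸ h)
  ext x y
  · simp only [contract, quot, Finset.mem_erase, Finset.mem_image, Function.update_apply, id]
    constructor
    · rintro ⟨h1, h2⟩
      exact ⟨x, h2, if_neg h1⟩
    · rintro ⟨a, ha, rfl⟩
      split_ifs with e
      · exact ⟨huv, G.mem_of_adj _ _ h⟩
      · exact ⟨e, ha⟩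
  · simp only [contract, quot, Function.update_apply, id]
    constructor
    · rintro ⟨h1, h2, h3, h4 | ⟨rfl, h4⟩ | ⟨rfl, h4⟩⟩
      · exact ⟨h1, x, y, h4, if_neg h2, if_neg h3⟩
      · exact ⟨h1, v, y, h4, if_pos rfl, if_neg h3⟩
      · exact ⟨h1, x, v, G.symm _ _ h4, if_neg h2, if_pos rfl⟩
    · rintro ⟨h1, a, b, hab, ha, hb⟩
      split_ifs at ha hb with e1 e2 e2
      · exact absurd (ha.symm.trans hb) h1
      · subst ha hb e1
        exact ⟨h1, huv, e2, .inr (.inl ⟨rfl, hab⟩)⟩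
      · subst ha hb e2
        exact ⟨h1, e1, huv, .inr (.inr ⟨rfl, G.symm _ _ hab⟩)⟩
      · subst ha hb
        exact ⟨h1, e1, e2, .inl hab⟩

/-- Composing the identifications gives a retraction `f` onto the surviving labels. Of the
connectedness of its fibers only one trace is kept: a moved vertex has a neighbor in `G` in its own
fiber. This and the count of lost vertices are all that the lower bound argument needs. -/
theorem ContractsTo.exists_quot {G M : LGraph} {S : List (ℕ × ℕ)} (h : ContractsTo G S M) :
    ∃ f : ℕ → ℕ, M = G.quot f ∧ (∀ x ∈ M.verts, f x = x) ∧ M.verts ⊆ G.verts ∧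
      (∀ x, f x ≠ x → ∃ y, G.Adj x y ∧ f y = f x) ∧ S.length + M.verts.card = G.verts.card := by
  induction h with
  | nil G => exact ⟨id, G.quot_id.symm, fun _ _ => rfl, subset_rfl, fun x hx => absurd rfl hx,
      by simp⟩
  | @cons G M u v S huv _ ih =>
    obtain ⟨f, h1, h2, h3, h4, h5⟩ := ih
    have hne : u ≠ v := fun e => G.irrefl v (e ▸ huv)
    have hvM : v ∉ M.verts := fun hv => (Finset.mem_erase.1 (h3 hv)).1 rfl
    refine ⟨f ∘ Function.update id v u, ?_, fun x hx => ?_,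
      h3.trans (Finset.erase_subset _ _), fun x hx => ?_, ?_⟩
    · rw [h1, contract_eq_quot, quot_quot]
    · have : x ≠ v := fun e => hvM (e ▸ hx)
      simp [this, h2 x hx]
    · by_cases hxv : x = v
      · exact ⟨u, hxv ▸ G.symm _ _ huv, by simp [hxv, hne]⟩
      · obtain ⟨y, ⟨a1, a2, a3, a4⟩, a5⟩ := h4 x (by simpa [hxv] using hx)
        rcases a4 with a4 | ⟨rfl, a4⟩ | ⟨rfl, a4⟩
        · exact ⟨y, a4, by simp [a3, hxv, a5]⟩
        · exact ⟨v, huv, by simp [hxv]⟩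
        · exact ⟨v, G.symm _ _ a4, by simp [hxv, a5]⟩
    · have hv : v ∈ G.verts := G.mem_of_adj _ _ (G.symm _ _ huv)
      have := Finset.card_erase_add_one hv
      change S.length + M.verts.card = (G.verts.erase v).card at h5
      simp only [List.length_cons]
      omega

/-- If no vertex is both kept and removed, earlier contractions do not destroy the later edges, so
the edges of the original graph can be contracted one by one. -/
theorem contractsTo_of_star {G : LGraph} {S : List (ℕ × ℕ)} {f : ℕ → ℕ}
    (hadj : ∀ p ∈ S, G.Adj p.1 p.2) (hnd : (S.map Prod.snd).Nodup)
    (hdis : ∀ p ∈ S, ∀ q ∈ S, p.1 ≠ q.2) (hf : ∀ p ∈ S, f p.2 = p.1)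
    (hid : ∀ x, x ∉ S.map Prod.snd → f x = x) : ContractsTo G S (G.quot f) := by
  induction S generalizing G f with
  | nil =>
    rw [show f = id from funext fun x => hid x (by simp), quot_id]
    exact .nil G
  | cons p S ih =>
    obtain ⟨u, v⟩ := p
    have huv : G.Adj u v := hadj (u, v) List.mem_cons_self
    rw [List.map_cons, List.nodup_cons] at hnd
    have hv : ∀ q ∈ S, q.2 ≠ v := fun q hq e => hnd.1 (List.mem_map.2 ⟨q, hq, e⟩)
    -- The first identification is split off; the remaining map must fix `v`, which is no longer a
    -- removed vertex of the rest. The equality at `v` uses that `u` is fixed by `f`, being nowhere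
    -- removed.
    have key : f = Function.update f v v ∘ Function.update id v u := by
      funext x
      by_cases hx : x = v
      · subst hx
        have h1 : u ≠ x := hdis _ List.mem_cons_self _ List.mem_cons_self
        have h2 : f u = u := hid u fun hu => by
          obtain ⟨q, hq, e⟩ := List.mem_map.1 hu
          exact hdis _ List.mem_cons_self q hq e.symm
        simp [h1, h2, hf _ List.mem_cons_self]
      · simp [hx]
    rw [key, ← quot_quot, ← contract_eq_quot G u v huv]
    refine .cons huv (ih (fun q hq => ?_) hnd.2 (fun q hq r hr => ?_) (fun q hq => ?_)
      fun x hx => ?_)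
    · exact ⟨hdis _ (List.mem_cons_of_mem _ hq) _ (List.mem_cons_of_mem _ hq),
        hdis _ (List.mem_cons_of_mem _ hq) _ List.mem_cons_self, hv q hq,
        .inl (hadj q (List.mem_cons_of_mem _ hq))⟩
    · exact hdis _ (List.mem_cons_of_mem _ hq) _ (List.mem_cons_of_mem _ hr)
    · rw [Function.update_of_ne (hv q hq), hf _ (List.mem_cons_of_mem _ hq)]
    · by_cases hxv : x = v
      · simp [hxv]
      · rw [Function.update_of_ne hxv]
        exact hid x (by simp only [List.map_cons, List.mem_cons]; tauto)

/-- Upper bound: in a subgraph, a vertex of maximal rank has all its neighbors among at most `d`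
predecessors. Lower bound: the clique on `d + 1` vertices is itself a subgraph. -/
theorem degeneracy_eq {G : LGraph} {d : ℕ} (rank : ℕ → ℕ)
    (hr : ∀ v ∈ G.verts, ∃ s : Finset ℕ, s.card ≤ d ∧ ∀ u, G.Adj v u → rank u ≤ rank v → u ∈ s)
    {c : Finset ℕ} (hc : c.card = d + 1) (hcv : c ⊆ G.verts)
    (hadj : ∀ u ∈ c, ∀ v ∈ c, u ≠ v → G.Adj u v) : G.degeneracy = d := by
  apply le_antisymm
  · refine Nat.sInf_le fun K hK hne => ?_
    obtain ⟨v, hv, hmax⟩ := K.verts.exists_max_image rank hne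
    obtain ⟨s, hs, hsub⟩ := hr v (hK.1 hv)
    refine ⟨v, hv, le_trans ?_ hs⟩
    rw [degree, ← Set.ncard_coe_finset]
    exact Set.ncard_le_ncard (fun u hu => hsub u (hK.2 _ _ hu)
      (hmax u (K.mem_of_adj _ _ (K.symm _ _ hu)))) s.finite_toSet
  · refine le_csInf ?_ fun e he => ?_
    · refine ⟨G.verts.card, fun K hK ⟨v, hv⟩ => ⟨v, hv, ?_⟩⟩
      rw [degree, ← Set.ncard_coe_finset]
      exact Set.ncard_le_ncard (fun u hu => hK.1 (K.mem_of_adj _ _ (K.symm _ _ hu)))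
        G.verts.finite_toSet
    · obtain ⟨v, hv, hd⟩ := he
        { verts := c
          Adj := fun x y => x ∈ c ∧ y ∈ c ∧ x ≠ y
          symm := fun x y h => ⟨h.2.1, h.1, h.2.2.symm⟩
          irrefl := fun x h => h.2.2 rfl
          mem_of_adj := fun x y h => h.1 } ⟨hcv, fun x y h => hadj x h.1 y h.2.1 h.2.2⟩
        (Finset.card_pos.1 (hc ▸ Nat.succ_pos d))
      have hset : {u | v ∈ c ∧ u ∈ c ∧ v ≠ u} = ((c.erase v : Finset ℕ) : Set ℕ) := by
        ext u
        have hv' : v ∈ c := hv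
        simp only [Set.mem_ofPred_eq, Finset.coe_erase, Set.mem_sdiff, SetLike.mem_coe,
          Set.mem_singleton_iff, hv', true_and]
        tauto
      have hcard := Finset.card_erase_add_one (show v ∈ c from hv)
      simp only [degree, hset, Set.ncard_coe_finset] at hd
      omega

end LGraph

/-! ## Selection problems as common contractions -/

/-- A selection problem: `m` items in `o` classes, a relation `A` on the items and a relation `F`
on the classes, each item and each class having at most two predecessors. -/
structure Selection where
  o : ℕ
  m : ℕ
  cl : ℕ → ℕ
  A : ℕ → ℕ → Prop
  F : ℕ → ℕ → Prop
  A_lt : ∀ i j, A i j → i < j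
  A_cl : ∀ i j, A i j → cl i < cl j
  F_lt : ∀ i j, F i j → i < j
  A_two : ∀ j, ∃ a b, ∀ i, A i j → i = a ∨ i = b
  F_two : ∀ j, ∃ a b, ∀ i, F i j → i = a ∨ i = b
  blank : ∀ c < o, ∃ z < m, cl z = c ∧ ∀ i, ¬ A i z ∧ ¬ A z i

namespace Selection

variable (X : Selection)

/-- One item can be selected from each class such that classes related by `F` have items related
by `A`. -/
def Solvable : Prop :=
  ∃ v : ℕ → ℕ, (∀ c < X.o, v c < X.m ∧ X.cl (v c) = c) ∧
    ∀ c c', c' < X.o → X.F c c' → X.A (v c) (v c')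

/-- The number of vertices: a selector for each class, the items, and a clique of size five. -/
def size : ℕ := X.o + X.m + 5

/-- The edges between vertex numbers `i < j`: first the selectors, then the items, then the
clique. The selectors are adjacent according to `F` if `b` holds. -/
def Edge (b : Bool) (i j : ℕ) : Prop :=
  i < j ∧ ((b = true ∧ j < X.o ∧ X.F i j) ∨
    (i < X.o ∧ X.o ≤ j ∧ j < X.o + X.m ∧ X.cl (j - X.o) = i) ∨
    (X.o ≤ i ∧ j < X.o + X.m ∧ X.A (i - X.o) (j - X.o)) ∨
    (X.o + X.m ≤ i ∧ j < X.o + X.m + 5))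

/-- The label of vertex number `i`; only the labels of the selectors depend on `b`. -/
def lab (b : Bool) (i : ℕ) : ℕ := if i < X.o then 2 * i + b.toNat else i + X.o

theorem lab_strictMono (b : Bool) : StrictMono (X.lab b) := by
  intro i j hij
  have := b.toNat_le
  unfold lab
  split_ifs <;> omega

def graph (b : Bool) : LGraph where
  verts := (Finset.range X.size).image (X.lab b)
  Adj x y := ∃ i < X.size, ∃ j < X.size, x = X.lab b i ∧ y = X.lab b j ∧
    (X.Edge b i j ∨ X.Edge b j i)
  symm := by
    rintro x y ⟨i, hi, j, hj, hx, hy, h⟩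
    exact ⟨j, hj, i, hi, hy, hx, h.symm⟩
  irrefl := by
    rintro x ⟨i, hi, j, hj, hx, hy, h⟩
    have := (X.lab_strictMono b).injective (hx.symm.trans hy)
    subst this
    rcases h with h | h <;> exact lt_irrefl _ h.1
  mem_of_adj := by
    rintro x y ⟨i, hi, j, hj, rfl, -, -⟩
    exact Finset.mem_image_of_mem _ (Finset.mem_range.2 hi)

theorem graph_adj {b : Bool} {i j : ℕ} (hi : i < X.size) (hj : j < X.size) :
    (X.graph b).Adj (X.lab b i) (X.lab b j) ↔ X.Edge b i j ∨ X.Edge b j i := by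
  constructor
  · rintro ⟨i', -, j', -, h1, h2, h⟩
    rwa [(X.lab_strictMono b).injective h1, (X.lab_strictMono b).injective h2]
  · exact fun h => ⟨i, hi, j, hj, rfl, rfl, h⟩

/-- In the order of vertex numbers a selector has at most two predecessors (from `F`), an item at
most three (its selector and two from `A`), and a clique vertex at most four; the clique attains 4.
-/
theorem graph_degeneracy (b : Bool) : (X.graph b).degeneracy = 4 := by
  have hm := X.lab_strictMono b
  refine LGraph.degeneracy_eq id (fun x hx => ?_)
    (c := (Finset.Ico (X.o + X.m) (X.o + X.m + 5)).image (X.lab b)) ?_ ?_ ?_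
  · obtain ⟨j, hj, rfl⟩ := Finset.mem_image.1 hx
    have hj' := Finset.mem_range.1 hj
    suffices h : ∃ s : Finset ℕ, s.card ≤ 4 ∧ ∀ i, X.Edge b i j → i ∈ s by
      obtain ⟨s, hs, h⟩ := h
      refine ⟨s.image (X.lab b), Finset.card_image_le.trans hs, ?_⟩
      rintro y ⟨j', -, i, hi, e1, rfl, hE⟩ hle
      rw [← hm.injective e1] at hE
      refine Finset.mem_image_of_mem _ (h i (hE.resolve_left fun h' => ?_))
      exact absurd (hm h'.1) (not_lt.2 hle)
    obtain ⟨a₁, a₂, ha⟩ := X.A_two (j - X.o)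
    obtain ⟨f₁, f₂, hf⟩ := X.F_two j
    by_cases h1 : j < X.o
    · refine ⟨{f₁, f₂}, Finset.card_le_two.trans (by omega), ?_⟩
      rintro i ⟨hij, h | h | h | h⟩
      · simpa using hf i h.2.2
      all_goals omega
    by_cases h2 : j < X.o + X.m
    · refine ⟨{X.cl (j - X.o), a₁ + X.o, a₂ + X.o}, Finset.card_le_three.trans (by omega), ?_⟩
      rintro i ⟨hij, h | h | h | h⟩
      · omega
      · simp [h.2.2.2]
      · have := ha _ h.2.2
        simp only [Finset.mem_insert, Finset.mem_singleton]
        omega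
      · omega
    · refine ⟨Finset.Ico (X.o + X.m) (X.o + X.m + 4), by simp, ?_⟩
      rintro i ⟨hij, h⟩
      rw [Finset.mem_Ico]
      omega
  · rw [Finset.card_image_of_injective _ hm.injective]
    simp
  · refine Finset.image_subset_image fun i hi => ?_
    rw [Finset.mem_Ico] at hi
    exact Finset.mem_range.2 hi.2
  · intro x hx y hy hxy
    obtain ⟨i, hi, rfl⟩ := Finset.mem_image.1 hx
    obtain ⟨j, hj, rfl⟩ := Finset.mem_image.1 hy
    rw [Finset.mem_Ico] at hi hj
    refine (X.graph_adj hi.2 hj.2).2 ?_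
    rcases lt_trichotomy i j with h | rfl | h
    · exact .inl ⟨h, .inr (.inr (.inr ⟨hi.1, hj.2⟩))⟩
    · exact absurd rfl hxy
    · exact .inr ⟨h, .inr (.inr (.inr ⟨hj.1, hi.2⟩))⟩

-- Labels increase with the vertex numbers, so the sorted label list and the adjacency matrix are
-- indexed by plain ranges, as the program for the output requires.
open Classical in
theorem graph_code (b : Bool) : (X.graph b).code =
    X.size :: ((List.range X.size).map (X.lab b) ++ (List.range X.size).flatMap fun i =>
      (List.range X.size).map fun j => if X.Edge b i j ∨ X.Edge b j i then 1 else 0) := by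
  have hm := X.lab_strictMono b
  have hs : (X.graph b).verts.sort (· ≤ ·) = (List.range X.size).map (X.lab b) := by
    have h1 : (X.graph b).verts = ((List.range X.size).map (X.lab b)).toFinset := by
      ext x
      simp [graph]
    rw [h1, List.toFinset_sort]
    · exact List.Pairwise.map _ (fun _ _ h => (hm h).le) List.pairwise_lt_range
    · exact List.nodup_range.map hm.injective
  have hc : (X.graph b).verts.card = X.size := by
    rw [graph, Finset.card_image_of_injective _ hm.injective, Finset.card_range]
  rw [LGraph.code, hs, hc, List.flatMap_map]
  congr 2
  refine List.flatMap_congr fun i hi => ?_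
  rw [List.map_map]
  refine List.map_congr_left fun j hj => ?_
  simp only [Function.comp, X.graph_adj (List.mem_range.1 hi) (List.mem_range.1 hj)]

/-- In the first graph selectors are not adjacent to each other, so every edge at a selector leads
to an item of its class. -/
theorem Edge.item_selector {X : Selection} {i j : ℕ} (h : X.Edge false i j ∨ X.Edge false j i)
    (hi : i < X.o) : ∃ y, j = X.o + y ∧ y < X.m ∧ X.cl y = i := by
  rcases h with ⟨h1, h | h | h | h⟩ | ⟨h1, h | h | h | h⟩
  · exact absurd h.1 (by simp)
  · exact ⟨j - X.o, by omega, by omega, h.2.2.2⟩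
  · exact absurd h.1 (by omega)
  · exact absurd h.1 (by omega)
  · exact absurd h.1 (by simp)
  · exact absurd h.2.1 (by omega)
  · exact absurd h.1 (by omega)
  · exact absurd h.1 (by omega)

theorem lab_of_ge {b : Bool} {i : ℕ} : X.lab b (X.o + i) = 2 * X.o + i := by
  unfold lab
  rw [if_neg (by omega)]
  omega

/-- Contract every selector into the chosen item of its class, in both graphs. The edges `F`, the
only difference between the graphs, then fall on edges from `A`. -/
theorem contractions_of_solvable (h : X.Solvable) : ∃ S₁ S₂ M,
    (X.graph false).ContractsTo S₁ M ∧ (X.graph true).ContractsTo S₂ M ∧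
      S₁.length + S₂.length ≤ 2 * X.o := by
  obtain ⟨v, hv, hF⟩ := h
  let f : Bool → ℕ → ℕ := fun b x =>
    if x < 2 * X.o ∧ x % 2 = b.toNat then 2 * X.o + v (x / 2) else x
  -- The final label of vertex number `i` is the same in both graphs, so the two quotients can be
  -- compared edge by edge through vertex numbers.
  let τ : ℕ → ℕ := fun i => if i < X.o then 2 * X.o + v i else i + X.o
  have hτ : ∀ b i, f b (X.lab b i) = τ i := by
    intro b i
    have hb := b.toNat_le
    simp only [f, τ, lab]
    split_ifs with h1 h2 h2
    · rw [show (2 * i + b.toNat) / 2 = i by omega]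
    · omega
    · omega
    · rfl
  let S : Bool → List (ℕ × ℕ) := fun b =>
    (List.range X.o).map fun c => (2 * X.o + v c, 2 * c + b.toNat)
  have hS : ∀ b, (X.graph b).ContractsTo (S b) ((X.graph b).quot (f b)) := by
    intro b
    have hb := b.toNat_le
    apply LGraph.contractsTo_of_star
    · intro p hp
      obtain ⟨c, hc, rfl⟩ := List.mem_map.1 hp
      have hc' := List.mem_range.1 hc
      obtain ⟨h1, h2⟩ := hv c hc'
      have e1 : 2 * c + b.toNat = X.lab b c := (if_pos hc').symm
      have hs : X.size = X.o + X.m + 5 := rfl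
      simp only [e1, ← X.lab_of_ge (b := b)]
      refine (X.graph_adj (by omega) (by omega)).2
        (.inr ⟨by omega, .inr (.inl ⟨hc', by omega, by omega, ?_⟩)⟩)
      rwa [Nat.add_sub_cancel_left]
    · rw [List.map_map]
      refine List.nodup_range.map fun a b h => ?_
      simp only [Function.comp] at h
      omega
    · intro p hp q hq
      obtain ⟨c, hc, rfl⟩ := List.mem_map.1 hp
      obtain ⟨c', hc', rfl⟩ := List.mem_map.1 hq
      have := List.mem_range.1 hc'
      simp only
      omega
    · intro p hp
      obtain ⟨c, hc, rfl⟩ := List.mem_map.1 hp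
      have := List.mem_range.1 hc
      simp only [f]
      rw [if_pos (by omega), show (2 * c + b.toNat) / 2 = c by omega]
    · intro x hx
      simp only [f]
      refine if_neg fun ⟨h1, h2⟩ => hx (List.mem_map.2 ⟨(2 * X.o + v (x / 2), x),
        List.mem_map.2 ⟨x / 2, List.mem_range.2 (by omega), ?_⟩, rfl⟩)
      rw [Prod.mk.injEq]
      exact ⟨rfl, by omega⟩
  have hquot : (X.graph false).quot (f false) = (X.graph true).quot (f true) := by
    have hadj : ∀ b x y, ((X.graph b).quot (f b)).Adj x y ↔ x ≠ y ∧ ∃ i < X.size, ∃ j < X.size,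
        τ i = x ∧ τ j = y ∧ (X.Edge b i j ∨ X.Edge b j i) := by
      intro b x y
      refine and_congr_right fun _ => ⟨?_, ?_⟩
      · rintro ⟨_, _, ⟨i, hi, j, hj, rfl, rfl, hE⟩, rfl, rfl⟩
        exact ⟨i, hi, j, hj, (hτ b i).symm, (hτ b j).symm, hE⟩
      · rintro ⟨i, hi, j, hj, rfl, rfl, hE⟩
        exact ⟨_, _, (X.graph_adj hi hj).2 hE, hτ b i, hτ b j⟩
    have hsub : ∀ i j, X.Edge false i j → X.Edge true i j := fun i j h =>
      ⟨h.1, h.2.imp (fun h' => absurd h'.1 (by simp)) id⟩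
    have hsup : ∀ i j, X.Edge true i j → ∃ i' < X.size, ∃ j' < X.size,
        τ i' = τ i ∧ τ j' = τ j ∧ X.Edge false i' j' := by
      rintro i j ⟨hij, h⟩
      have hs : X.size = X.o + X.m + 5 := rfl
      by_cases h' : j < X.o ∧ X.F i j
      · obtain ⟨h1, -⟩ := hv i (hij.trans h'.1)
        obtain ⟨h2, -⟩ := hv j h'.1
        have hA := hF i j h'.1 h'.2
        have := X.A_lt _ _ hA
        refine ⟨X.o + v i, by omega, X.o + v j, by omega, ?_, ?_, by omega,
          .inr (.inr (.inl ⟨by omega, by omega, by simpa using hA⟩))⟩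
        · simp only [τ]
          rw [if_neg (by omega), if_pos (by omega)]
          omega
        · simp only [τ]
          rw [if_neg (by omega), if_pos (by omega)]
          omega
      · exact ⟨i, by omega, j, by omega, rfl, rfl, hij, h.imp (fun h => absurd h.2 h') id⟩
    ext x y
    · simp only [LGraph.quot, graph, Finset.image_image, Function.comp_def, hτ]
    · rw [hadj, hadj]
      refine and_congr_right fun _ => ⟨?_, ?_⟩
      · rintro ⟨i, hi, j, hj, hx, hy, h⟩
        exact ⟨i, hi, j, hj, hx, hy, h.imp (hsub _ _) (hsub _ _)⟩
      · rintro ⟨i, hi, j, hj, hx, hy, h | h⟩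
        · obtain ⟨i', hi', j', hj', e1, e2, h'⟩ := hsup _ _ h
          exact ⟨i', hi', j', hj', e1.trans hx, e2.trans hy, .inl h'⟩
        · obtain ⟨j', hj', i', hi', e1, e2, h'⟩ := hsup _ _ h
          exact ⟨i', hi', j', hj', e2.trans hx, e1.trans hy, .inr h'⟩
  refine ⟨S false, S true, _, hS false, hquot ▸ hS true, ?_⟩
  simp [S]
  omega

/-- The budget determines the vertex set of the common graph, and the two quotient maps are then
compared: `f` on the first graph limits which edges can occur, and `g` on the second graph yields
the selection. -/
theorem solvable_of_contractions {S₁ S₂ : List (ℕ × ℕ)} {M : LGraph}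
    (h₁ : (X.graph false).ContractsTo S₁ M) (h₂ : (X.graph true).ContractsTo S₂ M)
    (hle : S₁.length + S₂.length ≤ 2 * X.o) : X.Solvable := by
  obtain ⟨f, f1, f2, f3, f4, f5⟩ := h₁.exists_quot
  obtain ⟨g, g1, g2, g3, g4, g5⟩ := h₂.exists_quot
  have hs : X.size = X.o + X.m + 5 := rfl
  have hcard : ∀ b, (X.graph b).verts.card = X.size := fun b => by
    rw [graph, Finset.card_image_of_injective _ (X.lab_strictMono b).injective, Finset.card_range]
  have hsel : ∀ {b c}, c < X.o → X.lab b c = 2 * c + b.toNat := fun hc => if_pos hc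
  -- Selector labels differ in parity between the graphs, so only labels of items and of the clique
  -- can be common. Counting lost vertices against the budget leaves at least `m + 5` labels, hence
  -- all of these.
  have hM : M.verts = Finset.Ico (2 * X.o) (2 * X.o + X.m + 5) := by
    rw [hcard] at f5 g5
    refine Finset.eq_of_subset_of_card_le (fun x hx => ?_) (by simp; omega)
    obtain ⟨i, hi, rfl⟩ := Finset.mem_image.1 (f3 hx)
    obtain ⟨j, hj, e⟩ := Finset.mem_image.1 (g3 hx)
    rw [Finset.mem_range] at hi hj
    rw [Finset.mem_Ico]
    by_cases h : i < X.o
    · simp only [lab, h, if_true, Bool.toNat_false, Bool.toNat_true] at e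
      split_ifs at e <;> omega
    · obtain ⟨y, rfl⟩ := Nat.exists_eq_add_of_le (not_lt.1 h)
      rw [lab_of_ge]
      omega
  have hmem : ∀ y < X.m, 2 * X.o + y ∈ M.verts := fun y hy => by
    rw [hM, Finset.mem_Ico]
    omega
  -- A selector of the first graph has to move and shares its fiber with a neighbor, which is an
  -- item of its class and is fixed.
  have hf : ∀ c < X.o, ∃ y < X.m, X.cl y = c ∧ f (X.lab false c) = 2 * X.o + y := by
    intro c hc
    have h1 : f (X.lab false c) ∈ M.verts := by
      rw [f1]
      exact Finset.mem_image_of_mem _ (Finset.mem_image_of_mem _ (Finset.mem_range.2 (by omega)))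
    obtain ⟨y, ⟨i, hi, j, hj, e1, rfl, h⟩, hy⟩ := f4 (X.lab false c) (fun e => by
      rw [e, hM, Finset.mem_Ico, hsel hc] at h1
      simp at h1
      omega)
    have := (X.lab_strictMono false).injective e1
    subst this
    obtain ⟨z, rfl, hz, hcl⟩ := Edge.item_selector h hc
    refine ⟨z, hz, hcl, ?_⟩
    rw [← hy, lab_of_ge, f2 _ (hmem z hz)]
  choose! v v1 v2 v3 using hf
  have key : ∀ x y, M.Adj x y → ∃ i < X.size, ∃ j < X.size,
      f (X.lab false i) = x ∧ f (X.lab false j) = y ∧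
        (X.Edge false i j ∨ X.Edge false j i) := by
    intro x y h
    rw [f1] at h
    obtain ⟨-, _, _, ⟨i, hi, j, hj, rfl, rfl, hE⟩, rfl, rfl⟩ := h
    exact ⟨i, hi, j, hj, rfl, rfl, hE⟩
  have inv : ∀ i < X.size, ∀ y < X.m, f (X.lab false i) = 2 * X.o + y →
      i = X.o + y ∨ (i < X.o ∧ i = X.cl y ∧ y = v i) := by
    intro i hi y hy e
    by_cases h : i < X.o
    · rw [v3 i h] at e
      have : v i = y := by omega
      exact .inr ⟨h, by rw [← this, v2 i h], this.symm⟩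
    · obtain ⟨z, rfl⟩ := Nat.exists_eq_add_of_le (not_lt.1 h)
      rw [lab_of_ge, f2 _ (by rw [hM, Finset.mem_Ico]; omega)] at e
      exact .inl (by omega)
  -- In the second graph selectors may merge with each other first, so the class of the image needs
  -- the blank item `z`. The image of selector `c` is `z` or adjacent to `z` in the common graph. In
  -- the first graph the fiber of `z` is `z`, possibly with selector `c`, and all its neighbors are
  -- selector `c` and items of class `c`, which `f` sends into class `c`.
  have hg : ∀ c < X.o, ∃ y < X.m, X.cl y = c ∧ g (X.lab true c) = 2 * X.o + y := by
    intro c hc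
    obtain ⟨z, z1, z2, z3⟩ := X.blank c hc
    by_cases hz : g (X.lab true c) = 2 * X.o + z
    · exact ⟨z, z1, z2, hz⟩
    have hadj : M.Adj (g (X.lab true c)) (2 * X.o + z) := by
      rw [g1]
      refine ⟨hz, _, _, (X.graph_adj (i := c) (j := X.o + z) (by omega) (by omega)).2
        (.inl ⟨by omega, .inr (.inl ⟨hc, by omega, by omega, by simpa using z2⟩)⟩), rfl, ?_⟩
      rw [lab_of_ge, g2 _ (hmem z z1)]
    obtain ⟨i, hi, j, hj, e1, e2, hE⟩ := key _ _ hadj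
    rw [← e1]
    rcases inv j hj z z1 e2 with rfl | ⟨h1, h2, h3⟩
    · suffices h : i = c by
        subst h
        exact ⟨v i, v1 i hc, v2 i hc, v3 i hc⟩
      rcases hE with ⟨h0, h | h | h | h⟩ | ⟨h0, h | h | h | h⟩
      · exact absurd h.1 (by simp)
      · rw [← z2, ← h.2.2.2, Nat.add_sub_cancel_left]
      · exact absurd h.2.2 (by rw [Nat.add_sub_cancel_left]; exact (z3 _).1)
      · omega
      · exact absurd h.1 (by simp)
      · omega
      · exact absurd h.2.2 (by rw [Nat.add_sub_cancel_left]; exact (z3 _).2)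
      · omega
    · obtain ⟨y, rfl, hy, hcl⟩ := Edge.item_selector hE.symm h1
      refine ⟨y, hy, by rw [hcl, h2, z2], ?_⟩
      rw [lab_of_ge, f2 _ (hmem y hy)]
  choose! u u1 u2 u3 using hg
  refine ⟨u, fun c hc => ⟨u1 c hc, u2 c hc⟩, fun c c' hc' hF => ?_⟩
  have hlt := X.F_lt _ _ hF
  have hc := hlt.trans hc'
  have hadj : M.Adj (2 * X.o + u c) (2 * X.o + u c') := by
    rw [g1]
    refine ⟨fun e => ?_, _, _, (X.graph_adj (i := c) (j := c') (by omega) (by omega)).2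
      (.inl ⟨hlt, .inl ⟨rfl, hc', hF⟩⟩), u3 c hc, u3 c' hc'⟩
    have : u c = u c' := by omega
    rw [← u2 c hc, ← u2 c' hc', this] at hlt
    exact lt_irrefl _ hlt
  obtain ⟨i, hi, j, hj, e1, e2, hE⟩ := key _ _ hadj
  have hn : u c ≠ u c' := fun h => by
    rw [← u2 c hc, ← u2 c' hc', h] at hlt
    exact lt_irrefl _ hlt
  -- An edge of the first graph with a selector as an end joins fibers of one and the same class.
  -- Since `c ≠ c'`, only an edge between two items is possible.
  rcases inv i hi _ (u1 c hc) e1 with rfl | ⟨h1, h2, h3⟩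
  · rcases inv j hj _ (u1 c' hc') e2 with rfl | ⟨h1, h2, h3⟩
    · have hA : X.A (u c) (u c') ∨ X.A (u c') (u c) := by
        have a1 := u1 c hc
        have a2 := u1 c' hc'
        rcases hE with ⟨h0, h | h | h | h⟩ | ⟨h0, h | h | h | h⟩
        · exact absurd h.1 (by simp)
        · omega
        · exact .inl (by simpa using h.2.2)
        · omega
        · exact absurd h.1 (by simp)
        · omega
        · exact .inr (by simpa using h.2.2)
        · omega
      -- `A` increases the class, so the reverse orientation would give `c' < c`.
      refine hA.resolve_right fun h => ?_
      have := X.A_cl _ _ h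
      rw [u2 c hc, u2 c' hc'] at this
      omega
    · obtain ⟨y, e, hy, hcl⟩ := Edge.item_selector hE.symm h1
      have : u c = y := by omega
      rw [← this, u2 c hc, h2, u2 c' hc'] at hcl
      omega
  · obtain ⟨y, e, hy, hcl⟩ := Edge.item_selector hE h1
    rw [u2 c hc] at h2
    rcases inv j hj _ (u1 c' hc') e2 with h | ⟨h4, h5, h6⟩
    · have : u c' = y := by omega
      rw [← this, h2, u2 c' hc'] at hcl
      omega
    · omega

/-- The instance of Maximum Common Labeled Contraction for a selection problem. -/
def instance₄ : (MCLC.restrict (DegeneracyEq 4)).Inst :=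
  ⟨(X.graph false, X.graph true, 2 * X.o), X.graph_degeneracy false, X.graph_degeneracy true⟩

theorem yes_instance₄ : (MCLC.restrict (DegeneracyEq 4)).yes X.instance₄ ↔ X.Solvable :=
  ⟨fun ⟨_, _, _, h1, h2, h3⟩ => X.solvable_of_contractions h1 h2 h3,
    X.contractions_of_solvable⟩

end Selection

/-! ## Nets: circuits with a weight, as relations on numbers -/

/-- A circuit with nodes `0, …, n - 1` and a weight `k`; the kind of a node is `0` (input),
`1` (negation), `2` (conjunction) or `3` (disjunction). -/
structure Net where
  n : ℕ
  k : ℕ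
  out : ℕ
  kind : ℕ → ℕ
  Wire : ℕ → ℕ → Prop
  Large : ℕ → Prop

namespace Net

variable (N : Net)

/-- `Derives kn L e b j`: the value `b` of node `j` follows in `e` rounds from the known values
`kn` of inputs and from the claims `L`, where a large gate with a claimed witness `w` takes the
value forced by `w`, and each other large gate takes the opposite value. -/
def Derives (kn : Bool → ℕ → Prop) (L : ℕ → ℕ → Prop) : ℕ → Bool → ℕ → Prop
  | 0, _, _ => False
  | e + 1, b, j =>
    (N.kind j = 0 ∧ kn b j) ∨
    (N.kind j = 1 ∧ ∃ i < N.n, N.Wire i j ∧ Derives kn L e (!b) i) ∨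
    (N.kind j = cond b 3 2 ∧ ((N.Large j ∧ ∃ w < N.n, N.Wire w j ∧ L j w) ∨
      ∃ i < N.n, N.Wire i j ∧ Derives kn L e b i)) ∨
    (N.kind j = cond b 2 3 ∧ ((¬ N.Large j ∧ ∀ i < N.n, N.Wire i j → Derives kn L e b i) ∨
      (N.Large j ∧ ((¬ ∃ w < N.n, N.Wire w j ∧ L j w) ∨
        ∃ w < N.n, (N.Wire w j ∧ L j w) ∧ Derives kn L e b w))))

/-- The part of the net from which `j` is reachable has at most `e` levels, and at most `t` large
gates on each path to `j`. -/
def Shape : ℕ → ℕ → ℕ → Prop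
  | 0, _, _ => False
  | e + 1, t, j => N.kind j ≤ 3 ∧ (N.Large j → 1 ≤ t) ∧
      (∀ i, N.Wire i j → N.Large j → Shape e (t - 1) i) ∧
      ∀ i, N.Wire i j → ¬ N.Large j → Shape e t i

/-- `val` are values of the nodes in agreement with the gates. -/
structure Values (val : ℕ → Prop) : Prop where
  not : ∀ j, N.kind j = 1 → ∃ i, N.Wire i j ∧ (∀ i', N.Wire i' j → i' = i) ∧ (val j ↔ ¬ val i)
  and : ∀ j, N.kind j = 2 → (val j ↔ ∀ i, N.Wire i j → val i)
  or : ∀ j, N.kind j = 3 → (val j ↔ ∃ i, N.Wire i j ∧ val i)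

/-- The properties of nets from circuits of weft at most one and depth at most `d`. -/
structure Good (d : ℕ) : Prop where
  wire_lt : ∀ i j, N.Wire i j → i < j
  wire_n : ∀ i j, N.Wire i j → j < N.n
  kind_n : ∀ j, N.kind j ≤ 3 → j < N.n
  small : ∀ j, ¬ N.Large j → ∃ l : List ℕ, l.length ≤ 2 ∧ ∀ i, N.Wire i j ↔ i ∈ l
  shape : N.Shape (d + 1) 1 N.out
  eval : ∀ ι : ℕ → Prop, ∃ val, N.Values val ∧ ∀ y, N.kind y = 0 → (val y ↔ ι y)

/-- The gate `j` has the value that is forced by the value of a single wire. -/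
def Forced (val : ℕ → Prop) (j : ℕ) : Prop := (N.kind j = 2 ∧ ¬ val j) ∨ (N.kind j = 3 ∧ val j)

/-- The wire from `w` forces the value of gate `j`. -/
def Forces (val : ℕ → Prop) (j w : ℕ) : Prop := (N.kind j = 2 ∧ ¬ val w) ∨ (N.kind j = 3 ∧ val w)

/-- All large gates in the top `e` levels above `j` with a forced value have a claimed witness. -/
def Covered (val : ℕ → Prop) (L : ℕ → ℕ → Prop) : ℕ → ℕ → Prop
  | 0, _ => True
  | e + 1, j => (N.Large j → N.Forced val j → ∃ w, N.Wire w j ∧ L j w) ∧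
      ∀ i, N.Wire i j → Covered val L e i

variable {N}

theorem Derives.mono {kn kn' : Bool → ℕ → Prop} {L : ℕ → ℕ → Prop}
    (h : ∀ b j, kn b j → kn' b j) {e : ℕ} {b : Bool} {j : ℕ} (hd : N.Derives kn L e b j) :
    N.Derives kn' L e b j := by
  induction e generalizing b j with
  | zero => exact hd
  | succ e ih =>
    rcases hd with ⟨h1, h2⟩ | ⟨h1, i, hi, h2, h3⟩ | ⟨h1, h2⟩ | ⟨h1, h2⟩
    · exact .inl ⟨h1, h _ _ h2⟩
    · exact .inr (.inl ⟨h1, i, hi, h2, ih h3⟩)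
    · refine .inr (.inr (.inl ⟨h1, h2.imp id ?_⟩))
      rintro ⟨i, hi, h3, h4⟩
      exact ⟨i, hi, h3, ih h4⟩
    · refine .inr (.inr (.inr ⟨h1, h2.imp ?_ ?_⟩))
      · rintro ⟨h3, h4⟩
        exact ⟨h3, fun i hi hw => ih (h4 i hi hw)⟩
      · rintro ⟨h3, h4⟩
        refine ⟨h3, h4.imp id ?_⟩
        rintro ⟨w, hw, h5, h6⟩
        exact ⟨w, hw, h5, ih h6⟩

theorem Values.forced {val : ℕ → Prop} (hv : N.Values val) {j w : ℕ} (hw : N.Wire w j)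
    (h : N.Forces val j w) : N.Forced val j := by
  rcases h with ⟨h1, h2⟩ | ⟨h1, h2⟩
  · exact .inl ⟨h1, fun h => h2 ((hv.and j h1).1 h w hw)⟩
  · exact .inr ⟨h1, (hv.or j h1).2 ⟨w, hw, h2⟩⟩

theorem Values.exists_forces {val : ℕ → Prop} (hv : N.Values val) {j : ℕ}
    (h : N.Forced val j) : ∃ w, N.Wire w j ∧ N.Forces val j w := by
  rcases h with ⟨h1, h2⟩ | ⟨h1, h2⟩
  · rw [hv.and j h1] at h2
    push Not at h2
    obtain ⟨w, hw, h⟩ := h2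
    exact ⟨w, hw, .inl ⟨h1, h⟩⟩
  · obtain ⟨w, hw, h⟩ := (hv.or j h1).1 h2
    exact ⟨w, hw, .inr ⟨h1, h⟩⟩

/-- `cond b 3 2` is the kind of gate that takes the value `b` as soon as one wire has it; for the
kind `cond b 2 3` all wires are needed. This treats conjunctions and disjunctions dually. -/
theorem forced_iff {val : ℕ → Prop} {j : ℕ} {b : Bool} (h : N.kind j = cond b 3 2) :
    N.Forced val j ↔ (val j ↔ b = true) := by
  cases b <;> simp [Forced, (show N.kind j = _ from h)]

theorem not_forced_iff {val : ℕ → Prop} {j : ℕ} {b : Bool} (h : N.kind j = cond b 2 3) :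
    ¬ N.Forced val j ↔ (val j ↔ b = true) := by
  cases b <;> simp [Forced, (show N.kind j = _ from h)]

theorem forces_iff {val : ℕ → Prop} {j w : ℕ} {b : Bool} (h : N.kind j = cond b 3 2) :
    N.Forces val j w ↔ (val w ↔ b = true) := by
  cases b <;> simp [Forces, (show N.kind j = _ from h)]

theorem not_forces_iff {val : ℕ → Prop} {j w : ℕ} {b : Bool} (h : N.kind j = cond b 2 3) :
    ¬ N.Forces val j w ↔ (val w ↔ b = true) := by
  cases b <;> simp [Forces, (show N.kind j = _ from h)]

/-- Correct claims can be trusted. Where no witness is claimed at a large gate, `Covered` excludes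
the forced value, so the default of taking the opposite value is right. -/
theorem Derives.sound {val : ℕ → Prop} (hv : N.Values val) {kn : Bool → ℕ → Prop}
    {L : ℕ → ℕ → Prop} (hkn : ∀ b j, N.kind j = 0 → kn b j → (val j ↔ b = true))
    (hn : ∀ i j, N.Wire i j → i < N.n) (hL : ∀ g w, L g w → N.Wire w g → N.Forces val g w)
    {e : ℕ} {b : Bool} {j : ℕ}
    (hc : N.Covered val L e j) (hd : N.Derives kn L e b j) : val j ↔ b = true := by
  induction e generalizing b j with
  | zero => exact hd.elim
  | succ e ih =>
    rcases hd with ⟨h1, h2⟩ | ⟨h1, i, -, h2, h3⟩ | ⟨h1, h2⟩ | ⟨h1, h2⟩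
    · exact hkn b j h1 h2
    · obtain ⟨i', -, h4, h5⟩ := hv.not j h1
      have := ih (hc.2 i h2) h3
      rw [h5, ← h4 i h2, this]
      cases b <;> simp
    · rw [← forced_iff h1]
      rcases h2 with ⟨-, w, -, h3, h4⟩ | ⟨i, -, h3, h4⟩
      · exact hv.forced h3 (hL _ _ h4 h3)
      · exact hv.forced h3 ((forces_iff h1).2 (ih (hc.2 i h3) h4))
    · rw [← not_forced_iff h1]
      rcases h2 with ⟨-, h2⟩ | ⟨h2, h3 | ⟨w, -, ⟨h3, h4⟩, h5⟩⟩
      · intro hf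
        obtain ⟨w, hw, hf'⟩ := hv.exists_forces hf
        exact (not_forces_iff h1).2 (ih (hc.2 w hw) (h2 w (hn w j hw) hw)) hf'
      · intro hf
        obtain ⟨w, hw, hl⟩ := hc.1 h2 hf
        exact h3 ⟨w, hn w j hw, hw, hl⟩
      · exact fun _ => (not_forces_iff h1).2 (ih (hc.2 w h3) h5) (hL _ _ h4 h3)

/-- One true forcing wire for each large gate with forced value. Small gates at most double the
number per level, and below a large gate nothing is needed because the path has used up its only
large gate (`t = 0`). -/
theorem Good.exists_cover {d : ℕ} (hN : N.Good d) {val : ℕ → Prop} (hv : N.Values val)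
    {e t j : ℕ} (ht : t ≤ 1) (hs : N.Shape e t j) :
    ∃ l : List (ℕ × ℕ), l.length ≤ t * 2 ^ e ∧
      (∀ p ∈ l, N.Wire p.2 p.1 ∧ N.Forces val p.1 p.2) ∧
      ∀ L : ℕ → ℕ → Prop, (∀ p ∈ l, L p.1 p.2) → N.Covered val L e j := by
  induction e generalizing t j with
  | zero => exact hs.elim
  | succ e ih =>
    obtain ⟨-, h2, h3, h4⟩ := hs
    by_cases hl : N.Large j
    · obtain rfl : t = 1 := le_antisymm ht (h2 hl)
      have hsub : ∀ L i, N.Wire i j → N.Covered val L e i := by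
        intro L i hi
        obtain ⟨l, l1, -, l3⟩ := ih (by omega) (h3 i hi hl)
        obtain rfl : l = [] := List.eq_nil_of_length_eq_zero (by simpa using l1)
        exact l3 L (by simp)
      by_cases hf : N.Forced val j
      · obtain ⟨w, hw, hf'⟩ := hv.exists_forces hf
        exact ⟨[(j, w)], by simpa using Nat.one_le_two_pow, by simpa using ⟨hw, hf'⟩,
          fun L hL => ⟨fun _ _ => ⟨w, hw, hL _ (List.mem_singleton_self _)⟩, hsub L⟩⟩
      · exact ⟨[], by simp, by simp, fun L _ => ⟨fun _ h => absurd h hf, hsub L⟩⟩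
    · obtain ⟨c, hc, hw⟩ := hN.small j hl
      have : ∀ i, ∃ l : List (ℕ × ℕ), i ∈ c → l.length ≤ t * 2 ^ e ∧
          (∀ p ∈ l, N.Wire p.2 p.1 ∧ N.Forces val p.1 p.2) ∧
          ∀ L : ℕ → ℕ → Prop, (∀ p ∈ l, L p.1 p.2) → N.Covered val L e i := by
        intro i
        by_cases hi : i ∈ c
        · obtain ⟨l, h⟩ := ih ht (h4 i ((hw i).2 hi) hl)
          exact ⟨l, fun _ => h⟩
        · exact ⟨[], fun h => absurd h hi⟩
      choose f hf using this
      refine ⟨c.flatMap f, ?_, fun p hp => ?_, fun L hL => ⟨fun h => absurd h hl, fun i hi => ?_⟩⟩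
      · rw [List.length_flatMap]
        calc (c.map fun i => (f i).length).sum ≤ (c.map fun i => (f i).length).length • (t * 2 ^ e) :=
              List.sum_le_card_nsmul _ _ fun x hx => by
                obtain ⟨i, hi, rfl⟩ := List.mem_map.1 hx
                exact (hf i hi).1
          _ = c.length * (t * 2 ^ e) := by simp
          _ ≤ 2 * (t * 2 ^ e) := Nat.mul_le_mul_right _ hc
          _ = t * 2 ^ (e + 1) := by ring
      · obtain ⟨i, hi, hp⟩ := List.mem_flatMap.1 hp
        exact (hf i hi).2.1 p hp
      · have hi' := (hw i).1 hi
        exact (hf i hi').2.2 L fun p hp => hL p (List.mem_flatMap.2 ⟨i, hi', hp⟩)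

/-- True values are derivable under arbitrary claims `L`, even false ones: a forced value follows
from one genuinely forcing wire. An unforced value of a large gate follows by default, or from the
true value of a claimed witness, which does not force. Only small gates branch, at most twofold,
whence at most `2 ^ e` leaves, each using one index of `KN`. -/
theorem Good.exists_derives {d : ℕ} (hN : N.Good d) {val : ℕ → Prop} (hv : N.Values val)
    {KN : ℕ → Bool → ℕ → Prop}
    (hkn : ∀ j b, N.kind j = 0 → (val j ↔ b = true) → ∃ t ≤ N.k, KN t b j) (L : ℕ → ℕ → Prop)
    {e t j : ℕ} {b : Bool} (hs : N.Shape e t j) (hb : val j ↔ b = true) :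
    ∃ T : List ℕ, T.length ≤ 2 ^ e ∧ (∀ t ∈ T, t ≤ N.k) ∧
      N.Derives (fun b j => ∃ t ∈ T, KN t b j) L e b j := by
  have hwn : ∀ {i j}, N.Wire i j → i < N.n := fun h => (hN.wire_lt _ _ h).trans (hN.wire_n _ _ h)
  have hpow : ∀ e, 2 ^ e ≤ 2 ^ (e + 1) := fun e => Nat.pow_le_pow_right (by omega) (by omega)
  induction e generalizing t j b with
  | zero => exact hs.elim
  | succ e ih =>
    obtain ⟨h1, -, h3, h4⟩ := hs
    have hsub : ∀ i, N.Wire i j → ∃ t, N.Shape e t i := fun i hi => by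
      by_cases hl : N.Large j
      · exact ⟨_, h3 i hi hl⟩
      · exact ⟨_, h4 i hi hl⟩
    have hcases : N.kind j = 0 ∨ N.kind j = 1 ∨ N.kind j = cond b 3 2 ∨ N.kind j = cond b 2 3 := by
      cases b <;> simp <;> omega
    rcases hcases with h | h | h | h
    · obtain ⟨s, hs, hk⟩ := hkn j b h hb
      exact ⟨[s], by simpa using Nat.one_le_two_pow, by simpa using hs,
        .inl ⟨h, s, List.mem_singleton_self _, hk⟩⟩
    · obtain ⟨i, hi, -, hn⟩ := hv.not j h
      obtain ⟨t', ht'⟩ := hsub i hi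
      obtain ⟨T, T1, T2, T3⟩ := ih (b := !b) ht' (by
        rw [hb] at hn
        cases b <;> simp_all)
      exact ⟨T, T1.trans (hpow e), T2, .inr (.inl ⟨h, i, hwn hi, hi, T3⟩)⟩
    · obtain ⟨i, hi, hf⟩ := hv.exists_forces ((forced_iff h).2 hb)
      obtain ⟨t', ht'⟩ := hsub i hi
      obtain ⟨T, T1, T2, T3⟩ := ih (b := b) ht' ((forces_iff h).1 hf)
      exact ⟨T, T1.trans (hpow e), T2, .inr (.inr (.inl ⟨h, .inr ⟨i, hwn hi, hi, T3⟩⟩))⟩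
    · have hall : ∀ i, N.Wire i j → (val i ↔ b = true) := fun i hi =>
        (not_forces_iff h).1 fun hf => (not_forced_iff h).2 hb (hv.forced hi hf)
      by_cases hl : N.Large j
      · by_cases hex : ∃ w < N.n, N.Wire w j ∧ L j w
        · obtain ⟨w, hw, h5, h6⟩ := hex
          obtain ⟨T, T1, T2, T3⟩ := ih (b := b) (h3 w h5 hl) (hall w h5)
          exact ⟨T, T1.trans (hpow e), T2,
            .inr (.inr (.inr ⟨h, .inr ⟨hl, .inr ⟨w, hw, ⟨h5, h6⟩, T3⟩⟩⟩))⟩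
        · exact ⟨[], by simp, by simp, .inr (.inr (.inr ⟨h, .inr ⟨hl, .inl hex⟩⟩))⟩
      · obtain ⟨c, hc, hw⟩ := hN.small j hl
        have : ∀ i, ∃ T : List ℕ, i ∈ c → T.length ≤ 2 ^ e ∧ (∀ t ∈ T, t ≤ N.k) ∧
            N.Derives (fun b j => ∃ t ∈ T, KN t b j) L e b i := by
          intro i
          by_cases hi : i ∈ c
          · obtain ⟨l, h⟩ := ih (b := b) (h4 i ((hw i).2 hi) hl) (hall i ((hw i).2 hi))
            exact ⟨l, fun _ => h⟩
          · exact ⟨[], fun h => absurd h hi⟩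
        choose f hf using this
        refine ⟨c.flatMap f, ?_, fun p hp => ?_, .inr (.inr (.inr ⟨h, .inl ⟨hl, fun i _ hi => ?_⟩⟩))⟩
        · rw [List.length_flatMap]
          calc (c.map fun i => (f i).length).sum ≤ (c.map fun i => (f i).length).length • 2 ^ e :=
                List.sum_le_card_nsmul _ _ fun x hx => by
                  obtain ⟨i, hi, rfl⟩ := List.mem_map.1 hx
                  exact (hf i hi).1
            _ = c.length * 2 ^ e := by simp
            _ ≤ 2 * 2 ^ e := Nat.mul_le_mul_right _ hc
            _ = 2 ^ (e + 1) := by ring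
        · obtain ⟨i, hi, hp⟩ := List.mem_flatMap.1 hp
          exact (hf i hi).2.1 p hp
        · have hi' := (hw i).1 hi
          refine (hf i hi').2.2.mono ?_
          rintro b j ⟨t, ht, hk⟩
          exact ⟨t, List.mem_flatMap.2 ⟨i, hi', ht⟩, hk⟩

end Net

/-! ## From weighted satisfiability to a binary constraint problem -/

/-- The digit number `i` of `x` in base `b`. -/
def digit (b x i : ℕ) : ℕ := x / b ^ i % b

theorem digit_lt {b : ℕ} (hb : 0 < b) (x i : ℕ) : digit b x i < b := Nat.mod_lt _ hb

theorem digit_zero (b i : ℕ) : digit b 0 i = 0 := by simp [digit]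

theorem mul_add_div_mod {D x : ℕ} (c : ℕ) (h : x < D) :
    (c * D + x) / D = c ∧ (c * D + x) % D = x := by
  constructor
  · rw [mul_comm, Nat.mul_add_div (by omega), Nat.div_eq_of_lt h, add_zero]
  · rw [mul_comm, Nat.mul_add_mod, Nat.mod_eq_of_lt h]

theorem mul_add_lt_mul {K D c x : ℕ} (hc : c < K) (hx : x < D) : c * D + x < K * D :=
  calc c * D + x < c * D + D := by omega
    _ = (c + 1) * D := by ring
    _ ≤ K * D := Nat.mul_le_mul_right _ hc

theorem exists_digits {b : ℕ} (r : ℕ) (φ : ℕ → ℕ) (h : ∀ i < r, φ i < b) :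
    ∃ x < b ^ r, ∀ i < r, digit b x i = φ i := by
  induction r generalizing φ with
  | zero => exact ⟨0, by simp, by simp⟩
  | succ r ih =>
    obtain ⟨x, hx, hd⟩ := ih (fun i => φ (i + 1)) fun i hi => h (i + 1) (by omega)
    have h0 := h 0 (by omega)
    refine ⟨x * b + φ 0, ?_, fun i hi => ?_⟩
    · rw [pow_succ]
      exact mul_add_lt_mul hx h0
    · cases i with
      | zero => simp [digit, Nat.mod_eq_of_lt h0]
      | succ i =>
        have : (x * b + φ 0) / b ^ (i + 1) = x / b ^ i := by
          rw [pow_succ', ← Nat.div_div_eq_div_mul, (mul_add_div_mod x h0).1]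
        rw [digit, this, ← hd i (by omega), digit]

namespace Net

variable (N : Net)

/-- The net has a satisfying assignment of weight `k`: the true inputs are `p 1 - 1, …, p k - 1`. -/
def Sat : Prop :=
  ∃ val, N.Values val ∧ val N.out ∧ ∃ p : ℕ → ℕ, p 0 = 0 ∧ p (N.k + 1) = N.n + 1 ∧
    (∀ t ≤ N.k, p t < p (t + 1)) ∧
    (∀ t, 1 ≤ t → t ≤ N.k → ∃ y < N.n, p t = y + 1 ∧ N.kind y = 0) ∧
    ∀ y, N.kind y = 0 → (val y ↔ ∃ t, 1 ≤ t ∧ t ≤ N.k ∧ p t = y + 1)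

section

variable (q : ℕ)

/-- The slot number `i` of the class `c`. -/
def slot (c i : ℕ) : ℕ := digit (N.k + 1) c i

/-- The beginning of the interval which the item `x` puts into its slot number `i`. -/
def lo (x i : ℕ) : ℕ := digit (N.n + 2) x (2 * i)

/-- The end of the interval which the item `x` puts into its slot number `i`. -/
def hi (x i : ℕ) : ℕ := digit (N.n + 2) x (2 * i + 1)

/-- The values of inputs known from the intervals of the item `x`. -/
def Known (x : ℕ) (b : Bool) (j : ℕ) : Prop :=
  ∃ i < q, cond b (N.lo x i = j + 1) (N.lo x i < j + 1 ∧ j + 1 < N.hi x i)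

/-- The item `x` claims that the wire from `w` forces the value of gate `g`. -/
def Claims (x g w : ℕ) : Prop :=
  ∃ s < q, digit (N.n + 2) x (2 * q + 2 * s) = g ∧ digit (N.n + 2) x (2 * q + (2 * s + 1)) = w

/-- The item `x` of class `c` is possible and does not refute that the circuit is satisfied. -/
def Valid (e c x : ℕ) : Prop :=
  (∀ i < q, N.lo x i < N.hi x i ∧ (N.slot c i = 0 → N.lo x i = 0) ∧
    (N.slot c i = N.k → N.hi x i = N.n + 1) ∧
    (N.slot c i ≠ 0 → ∃ y < N.n, N.lo x i = y + 1 ∧ N.kind y = 0)) ∧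
  ¬ N.Derives (N.Known q x) (N.Claims q x) e false N.out

/-- The items `x` of class `c` and `x'` of class `c'` are consistent. -/
def Agree (c x c' x' : ℕ) : Prop :=
  (∀ i < q, ∀ i' < q, (N.slot c i = N.slot c' i' → N.lo x i = N.lo x' i' ∧ N.hi x i = N.hi x' i') ∧
    (N.slot c i + 1 = N.slot c' i' → N.hi x i = N.lo x' i')) ∧
  (∀ s < 2 * q, digit (N.n + 2) x (2 * q + s) = digit (N.n + 2) x' (2 * q + s)) ∧
  (c = c' → x = x')

/-- The constraint for an item `x` of class `c` and an item `x'` of class `c'`. -/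
def Constraint (e c x c' x' : ℕ) : Prop :=
  N.Valid q e c x ∧ N.Valid q e c' x' ∧ N.Agree q c x c' x'

/-- The number of classes. -/
def classes : ℕ := (N.k + 1) ^ q

/-- The number of items of each class. -/
def items : ℕ := (N.n + 2) ^ (4 * q)

/-- The binary constraint problem is solvable. -/
def Consistent (e : ℕ) : Prop :=
  ∃ x : ℕ → ℕ, (∀ c < N.classes q, x c < N.items q) ∧
    ∀ c < N.classes q, ∀ c' < N.classes q, N.Constraint q e c (x c) c' (x c')

end

variable {N}

/-! ### Weighted satisfiability is equivalent to the binary constraint problem -/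

theorem slot_le (c i : ℕ) : N.slot c i ≤ N.k := Nat.lt_succ_iff.1 (digit_lt (Nat.succ_pos _) c i)

theorem positions_lt {p : ℕ → ℕ} {k : ℕ} (hp : ∀ t ≤ k, p t < p (t + 1)) {s t : ℕ} (hst : s < t)
    (ht : t ≤ k + 1) : p s < p t := by
  induction t with
  | zero => omega
  | succ t ih =>
    rcases Nat.lt_succ_iff_lt_or_eq.1 hst with h | rfl
    · exact (ih h (by omega)).trans (hp t (by omega))
    · exact hp s (by omega)

theorem positions_between {p : ℕ → ℕ} {k : ℕ} (h0 : p 0 = 0) {y : ℕ} (hy : y < p (k + 1)) :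
    ∃ t ≤ k, p t ≤ y ∧ y < p (t + 1) := by
  induction k with
  | zero => exact ⟨0, le_rfl, by omega, hy⟩
  | succ k ih =>
    by_cases h : y < p (k + 1)
    · obtain ⟨t, ht, h'⟩ := ih h
      exact ⟨t, by omega, h'⟩
    · exact ⟨k + 1, le_rfl, by omega, hy⟩

/-- All variables take the intervals of the true positions and one common list of correct, covering
claims; by soundness no value can refute the output. -/
theorem Good.consistent_of_sat {d : ℕ} (hN : N.Good d) (h : N.Sat) :
    N.Consistent (2 ^ (d + 1)) (d + 1) := by
  set q := 2 ^ (d + 1) with hq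
  obtain ⟨val, hv, hout, p, p0, pk, hp, hinp, hval⟩ := h
  obtain ⟨l, l1, l2, l3⟩ := hN.exists_cover hv le_rfl hN.shape
  rw [one_mul, ← hq] at l1
  have hpn : ∀ t ≤ N.k + 1, p t ≤ N.n + 1 := fun t ht => by
    rcases ht.lt_or_eq with h | rfl
    · rw [← pk]
      exact (positions_lt hp h le_rfl).le
    · exact pk.le
  have hln : ∀ s, (l.getD s (0, 0)).1 ≤ N.n + 1 ∧ (l.getD s (0, 0)).2 ≤ N.n + 1 := by
    intro s
    rw [List.getD_eq_getElem?_getD]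
    by_cases h : s < l.length
    · rw [List.getElem?_eq_getElem h]
      have hw := (l2 _ (List.getElem_mem h)).1
      have := hN.wire_lt _ _ hw
      have := hN.wire_n _ _ hw
      simp only [Option.getD_some]
      omega
    · simp [List.getElem?_eq_none (not_lt.1 h)]
  -- The first `2 * q` digits are the ends of the `q` intervals, the last `2 * q` the claims as gate
  -- and witness. Positions reach `n + 1`, hence base `n + 2`. Unused claims are padded with `(0,
  -- 0)`.
  let φ : ℕ → ℕ → ℕ := fun c i =>
    if i < 2 * q then (if i % 2 = 0 then p (N.slot c (i / 2)) else p (N.slot c (i / 2) + 1))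
    else if i % 2 = 0 then (l.getD ((i - 2 * q) / 2) (0, 0)).1
    else (l.getD ((i - 2 * q) / 2) (0, 0)).2
  have hφ : ∀ c, ∀ i < 4 * q, φ c i < N.n + 2 := by
    intro c i _
    have h1 := slot_le (N := N) c (i / 2)
    have h2 := hpn (N.slot c (i / 2)) (by omega)
    have h3 := hpn (N.slot c (i / 2) + 1) (by omega)
    have h4 := hln ((i - 2 * q) / 2)
    simp only [φ]
    split_ifs <;> omega
  choose x hx hd using fun c => exists_digits (4 * q) (φ c) (hφ c)
  have hlo : ∀ c, ∀ i < q, N.lo (x c) i = p (N.slot c i) := by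
    intro c i hi
    rw [lo, hd c _ (by omega)]
    simp only [φ]
    rw [if_pos (by omega), if_pos (by omega), show 2 * i / 2 = i by omega]
  have hhi : ∀ c, ∀ i < q, N.hi (x c) i = p (N.slot c i + 1) := by
    intro c i hi
    rw [Net.hi, hd c _ (by omega)]
    simp only [φ]
    rw [if_pos (by omega), if_neg (by omega), show (2 * i + 1) / 2 = i by omega]
  have hadv : ∀ c g w, N.Claims q (x c) g w ↔ ∃ s < q, l.getD s (0, 0) = (g, w) := by
    intro c g w
    refine exists_congr fun s => and_congr_right fun hs => ?_
    rw [hd c _ (by omega), hd c _ (by omega)]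
    simp only [φ]
    rw [if_neg (by omega), if_pos (by omega), if_neg (by omega), if_neg (by omega),
      show (2 * q + 2 * s - 2 * q) / 2 = s by omega,
      show (2 * q + (2 * s + 1) - 2 * q) / 2 = s by omega, Prod.ext_iff]
  have hvalid : ∀ c, N.Valid q (d + 1) c (x c) := by
    intro c
    refine ⟨fun i hi => ?_, fun hder => ?_⟩
    · rw [hlo c i hi, hhi c i hi]
      have h1 := slot_le (N := N) c i
      refine ⟨hp _ h1, fun h => by rw [h, p0], fun h => by rw [h, pk], fun h => ?_⟩
      exact hinp _ (by omega) h1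
    · have := Derives.sound hv (fun b j hj hk => ?_)
        (fun i j hij => (hN.wire_lt _ _ hij).trans (hN.wire_n _ _ hij)) (fun g w hgw hw => ?_)
        (l3 (N.Claims q (x c)) fun r hr => ?_) hder
      · simp [hout] at this
      · obtain ⟨i, hi, hk⟩ := hk
        rw [hlo c i hi, hhi c i hi] at hk
        have h1 := slot_le (N := N) c i
        rw [hval j hj]
        cases b with
        | true =>
          have hk : p (N.slot c i) = j + 1 := hk
          simp only [iff_true]
          refine ⟨_, Nat.pos_of_ne_zero fun h => ?_, h1, hk⟩
          rw [h, p0] at hk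
          omega
        | false =>
          have hk : p (N.slot c i) < j + 1 ∧ j + 1 < p (N.slot c i + 1) := hk
          simp only [Bool.false_eq_true, iff_false]
          rintro ⟨t, -, ht, e⟩
          rw [← e] at hk
          rcases lt_or_ge t (N.slot c i + 1) with h | h
          · rcases Nat.lt_succ_iff_lt_or_eq.1 h with h | h
            · have := positions_lt hp h (by omega)
              omega
            · rw [h] at hk
              omega
          · rcases h.lt_or_eq with h | h
            · have := positions_lt hp h (by omega)
              omega
            · rw [← h] at hk
              omega
      · obtain ⟨s, -, hs⟩ := (hadv c g w).1 hgw
        rw [List.getD_eq_getElem?_getD] at hs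
        by_cases h : s < l.length
        · rw [List.getElem?_eq_getElem h, Option.getD_some] at hs
          have := (l2 _ (List.getElem_mem h)).2
          rwa [hs] at this
        -- A padding claim names node 0 as its own predecessor, which contradicts acyclicity.
        · rw [List.getElem?_eq_none (not_lt.1 h), Option.getD_none, Prod.mk.injEq] at hs
          have := hN.wire_lt _ _ hw
          omega
      · obtain ⟨s, hs, rfl⟩ := List.getElem_of_mem hr
        exact (hadv c _ _).2 ⟨s, hs.trans_le l1, by simp [hs]⟩
  refine ⟨x, fun c _ => hx c, fun c _ c' _ => ⟨hvalid c, hvalid c', fun i hi i' hi' => ?_,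
    fun s hs => ?_, fun h => by rw [h]⟩⟩
  · rw [hlo c i hi, hlo c' i' hi', hhi c i hi, hhi c' i' hi']
    exact ⟨fun h => by simp [h], fun h => by rw [h]⟩
  · rw [hd c _ (by omega), hd c' _ (by omega)]
    have hs' : ¬ 2 * q + s < 2 * q := by omega
    simp only [φ, if_neg hs']

/-- Agreement glues the local intervals to one sequence of positions, hence one assignment. Were its
output false, a derivation of this would use at most `q` intervals, and the variable made of just
these would have an invalid value. -/
theorem Good.sat_of_consistent {d : ℕ} (hN : N.Good d)
    (h : N.Consistent (2 ^ (d + 1)) (d + 1)) : N.Sat := by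
  have hq0 : 0 < 2 ^ (d + 1) := by positivity
  set q := 2 ^ (d + 1) with hq
  obtain ⟨x, -, hR⟩ := h
  have hcls : ∀ T : ℕ → ℕ, (∀ i, T i ≤ N.k) → ∃ c < N.classes q, ∀ i < q, N.slot c i = T i :=
    fun T hT => exists_digits q T fun i _ => Nat.lt_succ_of_le (hT i)
  -- `C t` is the constant tuple with all slots equal to `t`; it serves to read off position `t`.
  choose! C hC hCs using fun t (ht : t ≤ N.k) => hcls (fun _ => t) fun _ => ht
  let p : ℕ → ℕ := fun t => if t ≤ N.k then N.lo (x (C t)) 0 else N.n + 1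
  have hlo : ∀ c < N.classes q, ∀ i < q, N.lo (x c) i = p (N.slot c i) := by
    intro c hc i hi
    have h1 := slot_le (N := N) c i
    simp only [p]
    rw [if_pos h1]
    exact (((hR c hc _ (hC _ h1)).2.2.1 i hi 0 hq0).1 (hCs _ h1 0 hq0).symm).1
  have hhi : ∀ c < N.classes q, ∀ i < q, N.hi (x c) i = p (N.slot c i + 1) := by
    intro c hc i hi
    have h1 := slot_le (N := N) c i
    simp only [p]
    split_ifs with h
    · exact (((hR c hc _ (hC _ h)).2.2.1 i hi 0 hq0).2 (hCs _ h 0 hq0).symm)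
    · exact ((hR c hc c hc).1.1 i hi).2.2.1 (by omega)
  have hslot : ∀ t ≤ N.k, (N.lo (x (C t)) 0 = p t ∧ N.hi (x (C t)) 0 = p (t + 1)) ∧
      N.slot (C t) 0 = t := by
    intro t ht
    rw [hlo _ (hC t ht) 0 hq0, hhi _ (hC t ht) 0 hq0, hCs t ht 0 hq0]
    exact ⟨⟨rfl, rfl⟩, rfl⟩
  have hval : ∀ t ≤ N.k, p t < p (t + 1) ∧ (t = 0 → p t = 0) ∧ (t = N.k → p (t + 1) = N.n + 1) ∧
      (t ≠ 0 → ∃ y < N.n, p t = y + 1 ∧ N.kind y = 0) := by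
    intro t ht
    have := (hR _ (hC t ht) _ (hC t ht)).1.1 0 hq0
    rwa [(hslot t ht).1.1, (hslot t ht).1.2, (hslot t ht).2] at this
  obtain ⟨val, hv, hinp⟩ := hN.eval fun y => ∃ t, 1 ≤ t ∧ t ≤ N.k ∧ p t = y + 1
  have p0 : p 0 = 0 := (hval 0 (by omega)).2.1 rfl
  have pk : p (N.k + 1) = N.n + 1 := (hval N.k le_rfl).2.2.1 rfl
  refine ⟨val, hv, ?_, p, p0, pk, fun t ht => (hval t ht).1,
    fun t h1 ht => (hval t ht).2.2.2 (by omega), hinp⟩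
  by_contra hout
  obtain ⟨T, T1, T2, T3⟩ := hN.exists_derives hv (b := false)
    (KN := fun t b j => cond b (p t = j + 1) (p t < j + 1 ∧ j + 1 < p (t + 1)))
    (fun j b hj hb => by
      have hjn := hN.kind_n j (by omega)
      obtain ⟨t, ht, h1, h2⟩ := positions_between (p := p) (k := N.k) p0 (y := j + 1) (by omega)
      refine ⟨t, ht, ?_⟩
      rw [hinp j hj] at hb
      rcases h1.lt_or_eq with h | h
      · cases b with
        | false => exact ⟨h, h2⟩
        | true =>
          obtain ⟨s, -, hs, e⟩ := hb.2 rfl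
          rcases lt_trichotomy s t with h' | rfl | h'
          · have := positions_lt (fun t ht => (hval t ht).1) h' (by omega)
            omega
          · exact e
          · rcases (Nat.succ_le_of_lt h').lt_or_eq with h' | rfl
            · have := positions_lt (fun t ht => (hval t ht).1) h' (by omega)
              simp only [Nat.succ_eq_add_one] at this
              omega
            · simp only [Nat.succ_eq_add_one] at e
              omega
      · cases b with
        | true => exact h
        | false =>
          refine absurd (hb.1 ⟨t, Nat.pos_of_ne_zero fun h0 => ?_, ht, h⟩) (by simp)
          rw [h0, p0] at h
          omega)
    (N.Claims q (x (C 0))) hN.shape (by simp [hout])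
  rw [← hq] at T1
  -- The list of intervals used is padded to a full tuple with slot 0.
  obtain ⟨c, hc, hcT⟩ := hcls (fun i => T.getD i 0) fun i => by
    rw [List.getD_eq_getElem?_getD]
    by_cases h : i < T.length
    · rw [List.getElem?_eq_getElem h]
      exact T2 _ (List.getElem_mem h)
    · simp [List.getElem?_eq_none (not_lt.1 h)]
  have hL : N.Claims q (x (C 0)) = N.Claims q (x c) := by
    have hA := (hR _ (hC 0 (by omega)) c hc).2.2.2.1
    funext g w
    simp only [Claims]
    refine propext (exists_congr fun s => and_congr_right fun hs => ?_)
    rw [hA _ (by omega), hA _ (by omega)]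
  refine (hR c hc c hc).1.2 (hL ▸ T3.mono ?_)
  rintro b j ⟨t, ht, hk⟩
  obtain ⟨i, hi, rfl⟩ := List.getElem_of_mem ht
  have hi' := hi.trans_le T1
  refine ⟨i, hi', ?_⟩
  rw [hlo c hc i hi', hhi c hc i hi', hcT i hi']
  simpa [hi] using hk

/-- The value 0 puts the empty interval from 0 to 0 into its first slot; being never valid, it is
available as a blank value. -/
theorem Constraint.ne_zero {q e c x c' x' : ℕ} (hq : 0 < q) (h : N.Constraint q e c x c' x') :
    x ≠ 0 ∧ x' ≠ 0 := by
  constructor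
  · rintro rfl
    have := (h.1.1 0 hq).1
    simp [lo, hi, digit_zero] at this
  · rintro rfl
    have := (h.2.1.1 0 hq).1
    simp [lo, hi, digit_zero] at this

end Net

/-! ## From binary constraints to a selection problem -/

/-- A binary constraint problem with `K` variables and values below `D`. -/
structure Binary where
  K : ℕ
  D : ℕ
  R : ℕ → ℕ → ℕ → ℕ → Prop
  pos : 0 < D
  diag : ∀ c x x', R c x c x' → x = x'
  left : ∀ c c' x', ¬ R c 0 c' x'
  right : ∀ c x c', ¬ R c x c' 0

namespace Binary

variable (Y : Binary)

/-- The class of an item: the item `c * D + x` stands for the value `x` of the variable `c`, the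
item `K * D + (((c * K + c') * D + x) * D + x')` for values of both `c` and `c'`. -/
def cl (i : ℕ) : ℕ :=
  if i < Y.K * Y.D then i / Y.D else Y.K + (i - Y.K * Y.D) / Y.D / Y.D

/-- A value of one variable is joined with the admissible pairs of values that extend it. -/
def Incident (i j : ℕ) : Prop :=
  i < Y.K * Y.D ∧ Y.K * Y.D ≤ j ∧
    Y.R ((j - Y.K * Y.D) / Y.D / Y.D / Y.K) ((j - Y.K * Y.D) / Y.D % Y.D)
      ((j - Y.K * Y.D) / Y.D / Y.D % Y.K) ((j - Y.K * Y.D) % Y.D) ∧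
    (i = (j - Y.K * Y.D) / Y.D / Y.D / Y.K * Y.D + (j - Y.K * Y.D) / Y.D % Y.D ∨
      i = (j - Y.K * Y.D) / Y.D / Y.D % Y.K * Y.D + (j - Y.K * Y.D) % Y.D)

/-- A variable is joined with the pairs in which it occurs. -/
def Occurs (c r : ℕ) : Prop :=
  c < Y.K ∧ Y.K ≤ r ∧ (c = (r - Y.K) / Y.K ∨ c = (r - Y.K) % Y.K)

theorem cl_of_lt {i : ℕ} (h : i < Y.K * Y.D) : Y.cl i = i / Y.D ∧ Y.cl i < Y.K := by
  rw [cl, if_pos h]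
  exact ⟨rfl, Nat.div_lt_of_lt_mul (by rwa [mul_comm])⟩

theorem cl_of_ge {i : ℕ} (h : Y.K * Y.D ≤ i) :
    Y.cl i = Y.K + (i - Y.K * Y.D) / Y.D / Y.D ∧ Y.K ≤ Y.cl i := by
  rw [cl, if_neg (by omega)]
  exact ⟨rfl, Nat.le_add_right _ _⟩

def selection : Selection where
  o := Y.K + Y.K * Y.K
  m := Y.K * Y.D + Y.K * Y.K * Y.D * Y.D
  cl := Y.cl
  A := Y.Incident
  F := Y.Occurs
  A_lt i j h := h.1.trans_le h.2.1
  A_cl i j h := (Y.cl_of_lt h.1).2.trans_le (Y.cl_of_ge h.2.1).2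
  F_lt i j h := h.1.trans_le h.2.1
  A_two j := ⟨_, _, fun i h => h.2.2.2⟩
  F_two j := ⟨_, _, fun i h => h.2.2⟩
  -- The blank item is the value 0, or the pair of values `(0, 0)`. It has no incidences since no
  -- constraint holds at 0.
  blank c hc := by
    have hD := Y.pos
    by_cases h : c < Y.K
    · have h1 : c * Y.D < Y.K * Y.D := Nat.mul_lt_mul_of_pos_right h hD
      refine ⟨c * Y.D, by omega, ?_, fun i => ⟨fun h => ?_, fun h => ?_⟩⟩
      · rw [(Y.cl_of_lt h1).1, Nat.mul_div_cancel _ hD]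
      · have := h.2.1
        omega
      · obtain ⟨-, -, hR, hx⟩ := h
        rcases hx with hx | hx
        · have := (mul_add_div_mod ((i - Y.K * Y.D) / Y.D / Y.D / Y.K)
            (Nat.mod_lt ((i - Y.K * Y.D) / Y.D) hD)).2
          rw [← hx, Nat.mul_mod_left] at this
          rw [← this] at hR
          exact Y.left _ _ _ hR
        · have := (mul_add_div_mod ((i - Y.K * Y.D) / Y.D / Y.D % Y.K)
            (Nat.mod_lt (i - Y.K * Y.D) hD)).2
          rw [← hx, Nat.mul_mod_left] at this
          rw [← this] at hR
          exact Y.right _ _ _ hR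
    · obtain ⟨r, rfl⟩ := Nat.exists_eq_add_of_le (not_lt.1 h)
      refine ⟨Y.K * Y.D + r * Y.D * Y.D, ?_, ?_, fun i => ⟨fun h => ?_, fun h => ?_⟩⟩
      · have : r * Y.D * Y.D < Y.K * Y.K * Y.D * Y.D :=
          Nat.mul_lt_mul_of_pos_right (Nat.mul_lt_mul_of_pos_right (by omega) hD) hD
        omega
      · rw [(Y.cl_of_ge (by omega)).1, Nat.add_sub_cancel_left, Nat.mul_div_cancel _ hD,
          Nat.mul_div_cancel _ hD]
      · have hR := h.2.2.1
        rw [Nat.add_sub_cancel_left, Nat.mul_mod_left] at hR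
        exact Y.right _ _ _ hR
      · have := h.1
        omega

/-- The item chosen for a pair class is joined to the items chosen for both variables only if it
consists of exactly these two values, and then the constraint holds. -/
theorem solvable_iff : Y.selection.Solvable ↔ ∃ x : ℕ → ℕ, (∀ c < Y.K, x c < Y.D) ∧
    ∀ c < Y.K, ∀ c' < Y.K, Y.R c (x c) c' (x c') := by
  have hD := Y.pos
  constructor
  · rintro ⟨v, hv, hF⟩
    replace hv : ∀ c < Y.K + Y.K * Y.K, v c < Y.K * Y.D + Y.K * Y.K * Y.D * Y.D ∧ Y.cl (v c) = c := hv
    refine ⟨fun c => v c % Y.D, fun c _ => Nat.mod_lt _ hD, fun c hc c' hc' => ?_⟩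
    have hs : ∀ c < Y.K, v c / Y.D = c := by
      intro c hc
      have h1 := (hv c (by omega)).2
      by_cases h : v c < Y.K * Y.D
      · rwa [← (Y.cl_of_lt h).1]
      · have := (Y.cl_of_ge (not_lt.1 h)).2
        omega
    have hr : c * Y.K + c' < Y.K * Y.K := mul_add_lt_mul hc hc'
    obtain ⟨e1, e2⟩ := mul_add_div_mod c hc'
    have hP := (hv (Y.K + (c * Y.K + c')) (by omega)).2
    have a1 : Y.Incident (v c) (v (Y.K + (c * Y.K + c'))) :=
      hF c (Y.K + (c * Y.K + c')) (show _ < Y.K + Y.K * Y.K by omega)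
        ⟨hc, by omega, .inl (by rw [Nat.add_sub_cancel_left, e1])⟩
    have a2 : Y.Incident (v c') (v (Y.K + (c * Y.K + c'))) :=
      hF c' (Y.K + (c * Y.K + c')) (show _ < Y.K + Y.K * Y.K by omega)
        ⟨hc', by omega, .inr (by rw [Nat.add_sub_cancel_left, e2])⟩
    generalize v (Y.K + (c * Y.K + c')) = w at *
    have hw := a1.2.1
    rw [(Y.cl_of_ge hw).1, Nat.add_left_cancel_iff] at hP
    simp only [Incident, hP, e1, e2] at a1 a2
    obtain ⟨-, -, hR, a1⟩ := a1
    obtain ⟨-, -, -, a2⟩ := a2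
    have b1 : (w - Y.K * Y.D) / Y.D % Y.D < Y.D := Nat.mod_lt _ hD
    have b2 : (w - Y.K * Y.D) % Y.D < Y.D := Nat.mod_lt _ hD
    generalize (w - Y.K * Y.D) / Y.D % Y.D = x₁ at *
    generalize (w - Y.K * Y.D) % Y.D = x₂ at *
    change Y.R c (v c % Y.D) c' (v c' % Y.D)
    -- For distinct variables the class of a value tells which coordinate it matches; for equal ones
    -- `diag` makes both coordinates the same.
    by_cases hcc : c = c'
    · subst hcc
      obtain rfl := Y.diag _ _ _ hR
      rw [or_self] at a1
      rwa [a1, (mul_add_div_mod c b1).2]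
    · have h1 : v c = c * Y.D + x₁ := a1.resolve_right fun h => hcc (by
        rw [← hs c hc, h, (mul_add_div_mod c' b2).1])
      have h2 : v c' = c' * Y.D + x₂ := a2.resolve_left fun h => hcc (by
        rw [← hs c' hc', h, (mul_add_div_mod c b1).1])
      rwa [h1, h2, (mul_add_div_mod c b1).2, (mul_add_div_mod c' b2).2]
  · rintro ⟨x, hx, hR⟩
    have hpair : ∀ r < Y.K * Y.K, r / Y.K < Y.K ∧ r % Y.K < Y.K := fun r hr =>
      ⟨Nat.div_lt_of_lt_mul hr, Nat.mod_lt _ (Nat.pos_of_ne_zero fun h => by simp [h] at hr)⟩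
    let v : ℕ → ℕ := fun c => if c < Y.K then c * Y.D + x c else
      Y.K * Y.D + (((c - Y.K) * Y.D + x ((c - Y.K) / Y.K)) * Y.D + x ((c - Y.K) % Y.K))
    have hv1 : ∀ c < Y.K, v c = c * Y.D + x c := fun c hc => if_pos hc
    have hv2 : ∀ r, v (Y.K + r) = Y.K * Y.D + ((r * Y.D + x (r / Y.K)) * Y.D + x (r % Y.K)) := by
      intro r
      simp only [v]
      rw [if_neg (by omega), Nat.add_sub_cancel_left]
    refine ⟨v, fun c hc => ?_, fun c c' hc' hF => ?_⟩
    · change v c < Y.K * Y.D + Y.K * Y.K * Y.D * Y.D ∧ Y.cl (v c) = c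
      replace hc : c < Y.K + Y.K * Y.K := hc
      by_cases h : c < Y.K
      · have h1 := mul_add_lt_mul h (hx c h)
        rw [hv1 c h]
        exact ⟨by omega, by rw [(Y.cl_of_lt h1).1, (mul_add_div_mod c (hx c h)).1]⟩
      · obtain ⟨r, rfl⟩ := Nat.exists_eq_add_of_le (not_lt.1 h)
        have hr : r < Y.K * Y.K := by omega
        obtain ⟨h1, h2⟩ := hpair r hr
        rw [hv2]
        refine ⟨Nat.add_lt_add_left (mul_add_lt_mul (mul_add_lt_mul hr (hx _ h1)) (hx _ h2)) _, ?_⟩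
        rw [(Y.cl_of_ge (Nat.le_add_right _ _)).1, Nat.add_sub_cancel_left,
          (mul_add_div_mod _ (hx _ h2)).1, (mul_add_div_mod _ (hx _ h1)).1]
    · obtain ⟨hc, hge, h⟩ := hF
      replace hc' : c' < Y.K + Y.K * Y.K := hc'
      obtain ⟨r, rfl⟩ := Nat.exists_eq_add_of_le hge
      rw [Nat.add_sub_cancel_left] at h
      have hr : r < Y.K * Y.K := by omega
      obtain ⟨h1, h2⟩ := hpair r hr
      change Y.Incident (v c) (v (Y.K + r))
      rw [hv1 c hc, hv2]
      refine ⟨mul_add_lt_mul hc (hx c hc), Nat.le_add_right _ _, ?_, ?_⟩ <;>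
        rw [Nat.add_sub_cancel_left, (mul_add_div_mod _ (hx _ h2)).1,
          (mul_add_div_mod _ (hx _ h2)).2, (mul_add_div_mod _ (hx _ h1)).1,
          (mul_add_div_mod _ (hx _ h1)).2]
      · exact hR _ h1 _ h2
      · rcases h with h | h
        · exact .inl (by rw [← h])
        · exact .inr (by rw [← h])

end Binary

/-! ## The net encoded by a word -/

/-- The number of entries that encode a gate, from the first two of them. -/
def gateLength (a b : ℕ) : ℕ := if a = 0 then 1 else if a = 1 then 2 else b + 2

/-- The index at which the encoding of gate number `j` begins. -/
def gatePos (w : List ℕ) : ℕ → ℕ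
  | 0 => 3
  | j + 1 => gatePos w j + gateLength (w.getD (gatePos w j) 0) (w.getD (gatePos w j + 1) 0)

/-- The net encoded by a word: the weight, the number of nodes, the output node and the gates. -/
def wordNet (w : List ℕ) : Net where
  n := w.getD 1 0
  k := w.getD 0 0
  out := w.getD 2 0
  kind j := if j < w.getD 1 0 then w.getD (gatePos w j) 0 else 4
  Wire i j := i < w.getD 1 0 ∧ j < w.getD 1 0 ∧
    ((w.getD (gatePos w j) 0 = 1 ∧ w.getD (gatePos w j + 1) 0 = i) ∨
      (2 ≤ w.getD (gatePos w j) 0 ∧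
        ∃ s < w.getD (gatePos w j + 1) 0, w.getD (gatePos w j + (2 + s)) 0 = i))
  Large j := j < w.getD 1 0 ∧ 2 ≤ w.getD (gatePos w j) 0 ∧ 2 < w.getD (gatePos w j + 1) 0

/-- The kind of a gate as a number. -/
def Gate.kind {n : ℕ} : Gate n → ℕ
  | input => 0
  | not _ => 1
  | and _ => 2
  | or _ => 3

namespace Circuit

variable (C : Circuit) (k : ℕ)

/-! ### Reading a circuit back from its word -/

theorem gateLength_code {n : ℕ} (g : Gate n) (rest : List ℕ) :
    gateLength ((g.code ++ rest).getD 0 0) ((g.code ++ rest).getD 1 0) = g.code.length := by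
  cases g <;> simp [Gate.code, gateLength]

/-- Gate codes are self-delimiting, so from `gatePos` onward the word consists of the codes of the
gates `j`, `j + 1`, and so on. The start 3 skips weight, number of nodes and output. -/
theorem drop_gatePos {j : ℕ} (hj : j ≤ C.n) : (k :: C.code).drop (gatePos (k :: C.code) j) =
    ((List.finRange C.n).drop j).flatMap fun i => (C.gate i).code := by
  induction j with
  | zero => simp [gatePos, code]
  | succ j ih =>
    have h := ih (by omega)
    rw [List.drop_eq_getElem_cons (show j < (List.finRange C.n).length by simpa using hj),
      List.flatMap_cons] at h
    have hget : ∀ s, (k :: C.code).getD (gatePos (k :: C.code) j + s) 0 =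
        ((k :: C.code).drop (gatePos (k :: C.code) j)).getD s 0 := fun s => by
      simp [List.getD_eq_getElem?_getD, List.getElem?_drop]
    have h0 := hget 0
    rw [add_zero] at h0
    rw [gatePos, h0, hget 1, h, gateLength_code, ← List.drop_drop, h, List.drop_left]

theorem getD_gatePos (j : Fin C.n) : ∃ rest, ∀ s,
    (k :: C.code).getD (gatePos (k :: C.code) j + s) 0 = ((C.gate j).code ++ rest).getD s 0 := by
  have h := C.drop_gatePos k j.2.le
  rw [List.drop_eq_getElem_cons (show (j : ℕ) < (List.finRange C.n).length by simp),
    List.flatMap_cons] at h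
  refine ⟨((List.finRange C.n).drop (j + 1)).flatMap fun i => (C.gate i).code, fun s => ?_⟩
  have : (List.finRange C.n)[(j : ℕ)]'(by simp) = j := by simp
  rw [this] at h
  rw [← h]
  simp [List.getD_eq_getElem?_getD, List.getElem?_drop]

theorem wordNet_k : (wordNet (k :: C.code)).k = k := rfl

theorem wordNet_kind (j : Fin C.n) : (wordNet (k :: C.code)).kind j = (C.gate j).kind := by
  obtain ⟨rest, h⟩ := C.getD_gatePos k j
  have h0 := h 0
  rw [add_zero] at h0
  change (if (j : ℕ) < C.n then _ else _) = _
  rw [if_pos j.2, h0]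
  cases C.gate j <;> simp [Gate.code, Gate.kind]

theorem exists_getD_iff (l : List ℕ) (rest : List ℕ) (i : ℕ) :
    (∃ s < l.length, (l ++ rest).getD s 0 = i) ↔ i ∈ l := by
  rw [List.mem_iff_getElem]
  constructor
  · rintro ⟨s, hs, h⟩
    refine ⟨s, hs, ?_⟩
    rw [← h, List.getD_eq_getElem?_getD, List.getElem?_append_left hs, List.getElem?_eq_getElem hs]
    rfl
  · rintro ⟨s, hs, h⟩
    refine ⟨s, hs, ?_⟩
    rw [← h, List.getD_eq_getElem?_getD, List.getElem?_append_left hs, List.getElem?_eq_getElem hs]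
    rfl

theorem wordNet_wire (i : ℕ) (j : Fin C.n) : (wordNet (k :: C.code)).Wire i j ↔
    ∃ h : i < C.n, (⟨i, h⟩ : Fin C.n) ∈ (C.gate j).preds := by
  obtain ⟨rest, h⟩ := C.getD_gatePos k j
  have h0 := h 0
  rw [add_zero] at h0
  have key : ∀ l : Finset (Fin C.n), (∃ s < l.card,
      ((l.sort (· ≤ ·)).map Fin.val ++ rest).getD s 0 = i) ↔ ∃ h : i < C.n, (⟨i, h⟩ : Fin C.n) ∈ l := by
    intro l
    have := exists_getD_iff ((l.sort (· ≤ ·)).map Fin.val) rest i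
    rw [List.length_map, Finset.length_sort] at this
    rw [this]
    simp only [List.mem_map, Finset.mem_sort]
    constructor
    · rintro ⟨a, ha, rfl⟩
      exact ⟨a.2, ha⟩
    · rintro ⟨h, ha⟩
      exact ⟨_, ha, rfl⟩
  change i < C.n ∧ (j : ℕ) < C.n ∧ _ ↔ _
  rw [h0, h 1]
  simp only [h]
  cases hg : C.gate j with
  | input => simp [Gate.code, Gate.preds]
  | not a =>
    simp only [Gate.code, Gate.preds, Finset.mem_singleton]
    constructor
    · rintro ⟨hi, -, h | h⟩
      · exact ⟨hi, Fin.ext h.2.symm⟩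
      · simp at h
    · rintro ⟨hi, h⟩
      exact ⟨hi, j.2, .inl ⟨rfl, by simp [← h]⟩⟩
  | and l =>
    rw [Gate.preds, ← key]
    have e : ∀ s, ((Gate.and l).code ++ rest).getD (2 + s) 0
        = ((l.sort (· ≤ ·)).map Fin.val ++ rest).getD s 0 := fun s => by
      rw [add_comm]
      simp [Gate.code]
    simp only [e]
    constructor
    · rintro ⟨hi, -, h | h⟩
      · simp [Gate.code] at h
      · simpa [Gate.code] using h
    · intro h
      exact ⟨((key l).1 h).1, j.2, .inr (by simpa [Gate.code] using h)⟩
  | or l =>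
    rw [Gate.preds, ← key]
    have e : ∀ s, ((Gate.or l).code ++ rest).getD (2 + s) 0
        = ((l.sort (· ≤ ·)).map Fin.val ++ rest).getD s 0 := fun s => by
      rw [add_comm]
      simp [Gate.code]
    simp only [e]
    constructor
    · rintro ⟨hi, -, h | h⟩
      · simp [Gate.code] at h
      · simpa [Gate.code] using h
    · intro h
      exact ⟨((key l).1 h).1, j.2, .inr (by simpa [Gate.code] using h)⟩

theorem wordNet_wire_lt {i j : ℕ} (h : (wordNet (k :: C.code)).Wire i j) : i < C.n ∧ j < C.n :=
  ⟨h.1, h.2.1⟩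

theorem wordNet_large (j : Fin C.n) :
    (wordNet (k :: C.code)).Large j ↔ (C.gate j).IsLarge := by
  obtain ⟨rest, h⟩ := C.getD_gatePos k j
  have h0 := h 0
  rw [add_zero] at h0
  change (j : ℕ) < C.n ∧ _ ↔ _
  rw [h0, h 1]
  cases hg : C.gate j <;> simp [Gate.code, Gate.IsLarge, Gate.preds]

theorem kind_eq_zero {n : ℕ} {g : Gate n} : g.kind = 0 ↔ g = .input := by
  cases g <;> simp [Gate.kind]

/-- The values of the nodes computed in `r` rounds from values of the inputs. -/
def rounds (ι : ℕ → Prop) : ℕ → Fin C.n → Prop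
  | 0, _ => False
  | r + 1, i => match C.gate i with
    | .input => ι i
    | .not a => ¬ rounds ι r a
    | .and l => ∀ a ∈ l, rounds ι r a
    | .or l => ∃ a ∈ l, rounds ι r a

/-- Nodes are numbered topologically, so the value of node `i` is settled after `i + 1` rounds. -/
theorem rounds_stable (ι : ℕ → Prop) : ∀ r, ∀ i : Fin C.n, (i : ℕ) < r →
    (C.rounds ι (r + 1) i ↔ C.rounds ι r i) := by
  intro r
  induction r with
  | zero => simp
  | succ r ih =>
    intro i hi
    have hlt : ∀ a ∈ (C.gate i).preds, (a : ℕ) < r := fun a ha =>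
      (Fin.lt_def.1 (C.acyclic i a ha)).trans_le (Nat.lt_succ_iff.1 hi)
    rw [rounds, rounds]
    cases hg : C.gate i with
    | input => rfl
    | not a => exact not_congr (ih a (hlt a (by simp [hg, Gate.preds])))
    | and l => exact forall₂_congr fun a ha => ih a (hlt a (by simpa [hg, Gate.preds]))
    | or l =>
      exact exists_congr fun a => and_congr_right fun ha =>
        ih a (hlt a (by simpa [hg, Gate.preds]))

theorem exists_values (ι : ℕ → Prop) : ∃ v : Fin C.n → Prop,
    (∀ i, (C.gate i).Computes v (v i)) ∧ ∀ i, C.gate i = .input → (v i ↔ ι i) := by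
  refine ⟨C.rounds ι C.n, fun i => ?_, fun i hi => ?_⟩
  · have h := C.rounds_stable ι C.n i i.2
    rw [rounds] at h
    cases hg : C.gate i with
    | input => trivial
    | not a => rw [hg] at h; exact h.symm
    | and l => rw [hg] at h; exact h.symm
    | or l => rw [hg] at h; exact h.symm
  · rw [← C.rounds_stable ι C.n i i.2, rounds, hi]

theorem values_wordNet {v : Fin C.n → Prop} (hv : ∀ i, (C.gate i).Computes v (v i)) :
    (wordNet (k :: C.code)).Values fun j => ∃ h : j < C.n, v ⟨j, h⟩ := by
  have hlt : ∀ j, (wordNet (k :: C.code)).kind j ≤ 3 → j < C.n := fun j hj => by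
    by_contra h
    have : (wordNet (k :: C.code)).kind j = 4 := if_neg h
    omega
  refine ⟨fun j hj => ?_, fun j hj => ?_, fun j hj => ?_⟩
  all_goals
    have hjn := hlt j (by omega)
    obtain ⟨j, rfl⟩ : ∃ j' : Fin C.n, (j' : ℕ) = j := ⟨⟨j, hjn⟩, rfl⟩
    rw [wordNet_kind] at hj
    have h := hv j
    simp only [wordNet_wire, Fin.eta, j.2, exists_true_left]
    cases hg : C.gate j <;> rw [hg] at hj h <;> simp only [Gate.kind] at hj <;> try omega
  · rename_i a
    refine ⟨a, ⟨a.2, by simp [Gate.preds]⟩, ?_, ?_⟩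
    · rintro i ⟨hi, h⟩
      simp only [Gate.preds, Finset.mem_singleton] at h
      exact congrArg Fin.val h
    · simpa [Gate.Computes] using h
  · simp only [Gate.Computes] at h
    rw [h]
    exact ⟨fun h i ⟨hi, hm⟩ => ⟨hi, h _ hm⟩, fun h i hi => (h i ⟨i.2, hi⟩).2⟩
  · simp only [Gate.Computes] at h
    rw [h]
    exact ⟨fun ⟨i, hi, hvi⟩ => ⟨i, ⟨i.2, hi⟩, i.2, hvi⟩,
      fun ⟨i, ⟨_, hi⟩, _, hvi⟩ => ⟨_, hi, hvi⟩⟩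

theorem computes_of_values {val : ℕ → Prop} (hv : (wordNet (k :: C.code)).Values val)
    (j : Fin C.n) : (C.gate j).Computes (fun i => val i) (val j) := by
  have hk := C.wordNet_kind k j
  have hw := fun i => C.wordNet_wire k i j
  cases hg : C.gate j with
  | input => trivial
  | not a =>
    rw [hg] at hk hw
    obtain ⟨i, h1, -, h3⟩ := hv.not j hk
    obtain ⟨hi, h⟩ := (hw i).1 h1
    simp only [Gate.preds, Finset.mem_singleton] at h
    subst h
    exact h3
  | and l =>
    rw [hg] at hk hw
    refine (hv.and j hk).trans ⟨fun h i hi => h i ((hw i).2 ⟨i.2, hi⟩), fun h i hi => ?_⟩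
    obtain ⟨hi, hm⟩ := (hw i).1 hi
    exact h _ hm
  | or l =>
    rw [hg] at hk hw
    refine (hv.or j hk).trans ⟨?_, ?_⟩
    · rintro ⟨i, hi, h⟩
      obtain ⟨hi, hm⟩ := (hw i).1 hi
      exact ⟨_, hm, h⟩
    · rintro ⟨i, hi, h⟩
      exact ⟨i, (hw i).2 ⟨i.2, hi⟩, h⟩

-- Induction from the output downwards along a path `p`: the remaining levels `e` and remaining
-- large gates `t` are what depth and weft leave after `p`. Running out of levels would mean a path
-- longer than the depth allows.
open Classical in
theorem shape_wordNet {d : ℕ} (hw : C.WeftLE 1) (hd : C.DepthLE d) :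
    (wordNet (k :: C.code)).Shape (d + 1) 1 C.out := by
  have key : ∀ e t p (j : Fin C.n), C.IsPath (j :: p) → d + 1 ≤ p.length + e →
      1 ≤ t + p.countP (fun i => decide (C.gate i).IsLarge) →
      (wordNet (k :: C.code)).Shape e t j := by
    intro e
    induction e with
    | zero =>
      intro t p j hp hl _
      have := hd _ hp
      simp only [List.length_cons] at this
      omega
    | succ e ih =>
      intro t p j hp hl ht
      have hc := hw _ hp
      rw [List.countP_cons] at hc
      have hext : ∀ i, (wordNet (k :: C.code)).Wire i j →
          ∃ i' : Fin C.n, (i' : ℕ) = i ∧ C.IsPath (i' :: j :: p) := by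
        intro i hi
        obtain ⟨h, hm⟩ := (C.wordNet_wire k i j).1 hi
        refine ⟨⟨i, h⟩, rfl, ?_, ?_⟩
        · exact List.isChain_cons_cons.2 ⟨hm, hp.1⟩
        · rw [List.getLast?_cons_cons]
          exact hp.2
      refine ⟨?_, fun hl' => ?_, fun i hi hl' => ?_, fun i hi hl' => ?_⟩
      · rw [wordNet_kind]
        cases C.gate j <;> simp [Gate.kind]
      · rw [wordNet_large] at hl'
        simp only [hl', decide_true, if_true] at hc
        omega
      · rw [wordNet_large] at hl'
        obtain ⟨i', rfl, hp'⟩ := hext i hi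
        refine ih (t - 1) _ i' hp' (by simp only [List.length_cons]; omega) ?_
        rw [List.countP_cons]
        simp only [hl', decide_true, if_true]
        omega
      · rw [wordNet_large] at hl'
        obtain ⟨i', rfl, hp'⟩ := hext i hi
        refine ih t _ i' hp' (by simp only [List.length_cons]; omega) ?_
        rw [List.countP_cons]
        omega
  exact key (d + 1) 1 [] C.out ⟨List.isChain_singleton _, rfl⟩ (by simp) (by simp)

theorem good_wordNet {d : ℕ} (hw : C.WeftLE 1) (hd : C.DepthLE d) :
    (wordNet (k :: C.code)).Good d where
  wire_lt i j h := by
    obtain ⟨-, hj⟩ := C.wordNet_wire_lt k h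
    obtain ⟨hi, hm⟩ := (C.wordNet_wire k i ⟨j, hj⟩).1 h
    exact Fin.lt_def.1 (C.acyclic ⟨j, hj⟩ _ hm)
  wire_n i j h := (C.wordNet_wire_lt k h).2
  kind_n j hj := by
    by_contra h
    have : (wordNet (k :: C.code)).kind j = 4 := if_neg h
    omega
  small j hl := by
    by_cases hj : j < C.n
    · have h := mt (C.wordNet_large k ⟨j, hj⟩).2 hl
      refine ⟨(C.gate ⟨j, hj⟩).preds.toList.map Fin.val, ?_, fun i => ?_⟩
      · rw [List.length_map, Finset.length_toList]
        exact not_lt.1 h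
      · refine (C.wordNet_wire k i ⟨j, hj⟩).trans ?_
        simp only [List.mem_map, Finset.mem_toList]
        exact ⟨fun ⟨hi, hm⟩ => ⟨_, hm, rfl⟩, fun ⟨a, ha, e⟩ => ⟨e ▸ a.2, by subst e; exact ha⟩⟩
    · exact ⟨[], by simp, fun i => by simpa using fun h => hj (C.wordNet_wire_lt k h).2⟩
  shape := C.shape_wordNet k hw hd
  eval ι := by
    obtain ⟨v, h1, h2⟩ := C.exists_values ι
    refine ⟨_, C.values_wordNet k h1, fun y hy => ?_⟩
    have hyn : y < C.n := by
      by_contra h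
      have : (wordNet (k :: C.code)).kind y = 4 := if_neg h
      omega
    rw [C.wordNet_kind k ⟨y, hyn⟩, kind_eq_zero] at hy
    rw [← h2 _ hy]
    exact ⟨fun ⟨_, h⟩ => h, fun h => ⟨hyn, h⟩⟩

theorem sat_of_weightedSat (h : C.WeightedSat k) : (wordNet (k :: C.code)).Sat := by
  classical
  obtain ⟨v, hv, hk, hout⟩ := h
  set S : Set (Fin C.n) := {i | C.gate i = .input ∧ v i} with hS
  -- The true inputs shifted by one, between the sentinels 0 and `n + 1`; the increasing enumeration
  -- of these `k + 2` numbers is `p`.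
  let s : Finset ℕ := insert 0 (insert (C.n + 1) (S.toFinset.image fun i : Fin C.n => (i : ℕ) + 1))
  have hn : C.n + 1 ∉ S.toFinset.image fun i : Fin C.n => (i : ℕ) + 1 := by
    simp only [Finset.mem_image, not_exists, not_and]
    intro i _ h
    have := i.2
    omega
  have hcard : s.card = k + 2 := by
    rw [Finset.card_insert_of_notMem (by simp), Finset.card_insert_of_notMem hn,
      Finset.card_image_of_injective _ (fun a b h => Fin.ext (by simpa using h)),
      ← Set.ncard_eq_toFinset_card', hk]
  have hmax : ∀ y ∈ s, y ≤ C.n + 1 := by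
    intro y hy
    simp only [s, Finset.mem_insert, Finset.mem_image] at hy
    rcases hy with rfl | rfl | ⟨i, -, rfl⟩
    · omega
    · omega
    · have := i.2
      omega
  let E := s.orderEmbOfFin hcard
  have hE : ∀ t, E t ∈ s := fun t => Finset.orderEmbOfFin_mem s hcard t
  have hE' : ∀ y ∈ s, ∃ t, E t = y := fun y hy => by
    have : y ∈ Set.range (s.orderEmbOfFin hcard) := by
      rw [Finset.range_orderEmbOfFin]
      exact hy
    exact this
  have E0 : E 0 = 0 := by
    obtain ⟨t, ht⟩ := hE' 0 (by simp [s])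
    have : E 0 ≤ E t := E.monotone (Fin.zero_le t)
    omega
  have El : E (Fin.last (k + 1)) = C.n + 1 := by
    obtain ⟨t, ht⟩ := hE' (C.n + 1) (by simp [s])
    have h1 : E t ≤ E (Fin.last (k + 1)) := E.monotone (Fin.le_last t)
    have h2 := hmax _ (hE (Fin.last (k + 1)))
    omega
  let p : ℕ → ℕ := fun t => if h : t < k + 2 then E ⟨t, h⟩ else 0
  have hp : ∀ t (h : t < k + 2), p t = E ⟨t, h⟩ := fun t h => dif_pos h
  have hpS : ∀ t, 1 ≤ t → t ≤ k → ∃ i ∈ S, p t = (i : ℕ) + 1 := by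
    intro t h1 h2
    have hm := hE ⟨t, by omega⟩
    rw [← hp t (by omega)] at hm
    simp only [s, Finset.mem_insert, Finset.mem_image, Set.mem_toFinset] at hm
    rcases hm with h | h | ⟨i, hi, h⟩
    · have : E 0 < E ⟨t, by omega⟩ := E.strictMono (Fin.lt_def.2 h1)
      rw [hp t (by omega)] at h
      omega
    · have : E ⟨t, by omega⟩ < E (Fin.last (k + 1)) := E.strictMono (Fin.lt_def.2 (by simp; omega))
      rw [hp t (by omega)] at h
      omega
    · exact ⟨i, hi, h.symm⟩
  refine ⟨_, C.values_wordNet k hv, ⟨C.out.2, hout⟩, p, ?_, ?_, ?_, ?_, ?_⟩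
  · rw [hp 0 (by omega)]
    exact E0
  · rw [wordNet_k, hp (k + 1) (by omega)]
    exact El
  · intro t ht
    rw [wordNet_k] at ht
    rw [hp t (by omega), hp (t + 1) (by omega)]
    exact E.strictMono (Fin.lt_def.2 (Nat.lt_succ_self t))
  · intro t h1 h2
    obtain ⟨i, hi, h⟩ := hpS t h1 h2
    exact ⟨i, i.2, h, by rw [wordNet_kind, kind_eq_zero]; exact hi.1⟩
  · intro y hy
    have hyn : y < C.n := by
      by_contra h
      have : (wordNet (k :: C.code)).kind y = 4 := if_neg h
      omega
    rw [C.wordNet_kind k ⟨y, hyn⟩, kind_eq_zero] at hy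
    constructor
    · rintro ⟨_, h⟩
      obtain ⟨t, ht⟩ := hE' (y + 1) (by
        simp only [s, Finset.mem_insert, Finset.mem_image, Set.mem_toFinset]
        exact .inr (.inr ⟨⟨y, hyn⟩, ⟨hy, h⟩, rfl⟩))
      refine ⟨t, Nat.pos_of_ne_zero fun h0 => ?_, ?_, by rw [hp t t.2]; exact ht⟩
      · have : t = 0 := Fin.ext h0
        rw [this, E0] at ht
        omega
      · rw [wordNet_k]
        by_contra h0
        have : t = Fin.last (k + 1) := Fin.ext (by have := t.2; simp; omega)
        rw [this, El] at ht
        omega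
    · rintro ⟨t, h1, h2, h3⟩
      obtain ⟨i, hi, h⟩ := hpS t h1 h2
      have : i = ⟨y, hyn⟩ := Fin.ext (by simp; omega)
      exact ⟨hyn, this ▸ hi.2⟩

theorem weightedSat_of_sat (h : (wordNet (k :: C.code)).Sat) : C.WeightedSat k := by
  obtain ⟨val, hv, hout, p, p0, pk, hp, hin, hval⟩ := h
  rw [wordNet_k] at *
  refine ⟨fun i => val i, C.computes_of_values k hv, ?_, hout⟩
  have himg : Fin.val '' {i : Fin C.n | C.gate i = .input ∧ val i} =
      (((Finset.Icc 1 k).image fun t => p t - 1 : Finset ℕ) : Set ℕ) := by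
    ext y
    simp only [Set.mem_image, Finset.coe_image, Finset.coe_Icc, Set.mem_Icc]
    constructor
    · rintro ⟨i, ⟨hi, hvi⟩, rfl⟩
      obtain ⟨t, h1, h2, h3⟩ := (hval i (by rw [wordNet_kind, kind_eq_zero, hi])).1 hvi
      exact ⟨t, ⟨h1, h2⟩, by omega⟩
    · rintro ⟨t, ⟨h1, h2⟩, rfl⟩
      obtain ⟨y, hy, h3, h4⟩ := hin t h1 h2
      refine ⟨⟨y, hy⟩, ⟨?_, (hval y h4).2 ⟨t, h1, h2, h3⟩⟩, by simp [h3]⟩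
      rwa [C.wordNet_kind k ⟨y, hy⟩, kind_eq_zero] at h4
  rw [← Set.ncard_image_of_injective _ Fin.val_injective, himg, Set.ncard_coe_finset,
    Finset.card_image_of_injOn, Nat.card_Icc, Nat.add_sub_cancel]
  intro s hs t ht hst
  simp only [Finset.coe_Icc, Set.mem_Icc] at hs ht
  have hs0 := Net.positions_lt hp (show 0 < s by omega) (by omega)
  have ht0 := Net.positions_lt hp (show 0 < t by omega) (by omega)
  simp only at hst
  rcases lt_trichotomy s t with h | h | h
  · have := Net.positions_lt hp h (by omega)
    omega
  · exact h
  · have := Net.positions_lt hp h (by omega)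
    omega

end Circuit

/-! ## The reduction is computed in polynomial time -/

/-- The binary constraint problem for the net encoded by a word. -/
def wordBinary (d : ℕ) (w : List ℕ) : Binary where
  K := (wordNet w).classes (2 ^ (d + 1))
  D := (wordNet w).items (2 ^ (d + 1))
  R := (wordNet w).Constraint (2 ^ (d + 1)) (d + 1)
  pos := Nat.pow_pos (Nat.succ_pos _)
  diag c x x' h := h.2.2.2.2 rfl
  left c c' x' h := (h.ne_zero (Nat.pow_pos (by omega))).1 rfl
  right c x c' h := (h.ne_zero (Nat.pow_pos (by omega))).2 rfl

section

variable {Γ : Type} [Ctx Γ] {x x' c c' g i j : Γ → ℕ}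

theorem Easy.entry (i : ℕ) : Easy fun γ : Γ => (Ctx.word γ).getD i 0 := (Easy.const i).input

theorem Easy.gateLength (hi : Easy i) (hj : Easy j) :
    Easy fun γ => ParamComplexity.gateLength (i γ) (j γ) :=
  Easy.ite (EasyP.eq hi (Easy.const 0)) (Easy.const 1)
    (Easy.ite (EasyP.eq hi (Easy.const 1)) (Easy.const 2) (hj.add (Easy.const 2)))

/-- Positions are accumulated by recursion; every gate advances by at most an entry of the word plus
2, which bounds them polynomially even on words that encode no circuit. -/
theorem Easy.gatePos (hj : Easy j) : Easy fun γ => gatePos (Ctx.word γ) (j γ) := by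
  refine Easy.recursion (x := fun _ => 3) (b := fun γ => 3 + j γ * (Ctx.size γ + 2))
    (g := fun γ _ a => a + ParamComplexity.gateLength ((Ctx.word γ).getD a 0)
      ((Ctx.word γ).getD (a + 1) 0)) hj (Easy.const 3)
    (Easy.var.add (Easy.gateLength Easy.var.input (Easy.var.add (Easy.const 1)).input))
    (fun γ m => ParamComplexity.gatePos (Ctx.word γ) m) (fun _ => rfl) (fun _ _ => rfl)
    ((PB.const 3).add (hj.1.mul (PB.size.add (PB.const 2)))) fun γ m hm => ?_
  refine le_trans ?_ (Nat.add_le_add_left (Nat.mul_le_mul_right _ hm) 3)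
  clear hm
  induction m with
  | zero => simp [ParamComplexity.gatePos]
  | succ m ih =>
    have h := getD_le_size γ (ParamComplexity.gatePos (Ctx.word γ) m + 1)
    rw [ParamComplexity.gatePos, Nat.succ_mul, ParamComplexity.gateLength]
    split_ifs <;> omega

theorem Easy.kind (hj : Easy j) : Easy fun γ => (wordNet (Ctx.word γ)).kind (j γ) :=
  Easy.ite (EasyP.lt hj (Easy.entry 1)) hj.gatePos.input (Easy.const 4)

theorem EasyP.large (hj : Easy j) : EasyP fun γ => (wordNet (Ctx.word γ)).Large (j γ) :=
  (EasyP.lt hj (Easy.entry 1)).and ((EasyP.le (Easy.const 2) hj.gatePos.input).and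
    (EasyP.lt (Easy.const 2) (hj.gatePos.add (Easy.const 1)).input))

theorem EasyP.wire (hi : Easy i) (hj : Easy j) :
    EasyP fun γ => (wordNet (Ctx.word γ)).Wire (i γ) (j γ) :=
  (EasyP.lt hi (Easy.entry 1)).and ((EasyP.lt hj (Easy.entry 1)).and
    (((EasyP.eq hj.gatePos.input (Easy.const 1)).and
      (EasyP.eq (hj.gatePos.add (Easy.const 1)).input hi)).or
    ((EasyP.le (Easy.const 2) hj.gatePos.input).and
      (EasyP.exists_lt (p := fun γ s =>
        (Ctx.word γ).getD (ParamComplexity.gatePos (Ctx.word γ) (j γ) + (2 + s)) 0 = i γ)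
        (hj.gatePos.add (Easy.const 1)).input
        (EasyP.eq (hj.gatePos.fst.add ((Easy.const 2).add Easy.var)).input hi.fst)))))

theorem Easy.digit (hg : Easy g) (hx : Easy x) (s : ℕ) :
    Easy fun γ => digit (g γ) (x γ) s := (hx.div (hg.pow s)).mod hg

theorem Easy.netDigit (hx : Easy x) (s : ℕ) :
    Easy fun γ => ParamComplexity.digit ((wordNet (Ctx.word γ)).n + 2) (x γ) s :=
  Easy.digit ((Easy.entry 1).add (Easy.const 2)) hx s

theorem Easy.lo (hx : Easy x) (s : ℕ) : Easy fun γ => (wordNet (Ctx.word γ)).lo (x γ) s :=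
  hx.netDigit _

theorem Easy.hi (hx : Easy x) (s : ℕ) : Easy fun γ => (wordNet (Ctx.word γ)).hi (x γ) s :=
  hx.netDigit _

theorem Easy.slot (hc : Easy c) (s : ℕ) : Easy fun γ => (wordNet (Ctx.word γ)).slot (c γ) s :=
  Easy.digit ((Easy.entry 0).add (Easy.const 1)) hc s

theorem EasyP.known (q : ℕ) (b : Bool) (hx : Easy x) (hj : Easy j) :
    EasyP fun γ => (wordNet (Ctx.word γ)).Known q (x γ) b (j γ) := by
  refine EasyP.exists_lt_const q fun s => ?_
  have h := hj.add (Easy.const 1)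
  cases b with
  | true => exact EasyP.eq (hx.lo s) h
  | false => exact (EasyP.lt (hx.lo s) h).and (EasyP.lt h (hx.hi s))

theorem EasyP.claims (q : ℕ) (hx : Easy x) (hg : Easy g) (hj : Easy j) :
    EasyP fun γ => (wordNet (Ctx.word γ)).Claims q (x γ) (g γ) (j γ) :=
  EasyP.exists_lt_const q fun _ => (EasyP.eq (hx.netDigit _) hg).and (EasyP.eq (hx.netDigit _) hj)

end

/-- The depth `e` is a constant, so the recursion is unrolled into nested quantifiers over nodes.
Each level binds a new variable, hence the induction over all contexts. -/
theorem EasyP.derives (q e : ℕ) : ∀ (Γ : Type) [Ctx Γ] (b : Bool) (x j : Γ → ℕ), Easy x → Easy j →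
    EasyP fun γ => (wordNet (Ctx.word γ)).Derives ((wordNet (Ctx.word γ)).Known q (x γ))
      ((wordNet (Ctx.word γ)).Claims q (x γ)) e b (j γ) := by
  induction e with
  | zero => exact fun Γ _ b x j _ _ => EasyP.const False
  | succ e ih =>
    intro Γ _ b x j hx hj
    have hn : Easy fun γ : Γ => (wordNet (Ctx.word γ)).n := Easy.entry 1
    have hw : EasyP fun p : Γ × ℕ => (wordNet (Ctx.word p.1)).Wire p.2 (j p.1) :=
      EasyP.wire Easy.var hj.fst
    have hc : EasyP fun p : Γ × ℕ => (wordNet (Ctx.word p.1)).Claims q (x p.1) (j p.1) p.2 :=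
      EasyP.claims q hx.fst hj.fst Easy.var
    have hd := fun b => ih (Γ × ℕ) b (fun p => x p.1) (fun p => p.2) hx.fst Easy.var
    have hex : EasyP fun γ : Γ => ∃ w < (wordNet (Ctx.word γ)).n,
        (wordNet (Ctx.word γ)).Wire w (j γ) ∧ (wordNet (Ctx.word γ)).Claims q (x γ) (j γ) w :=
      EasyP.exists_lt hn (hw.and hc)
    refine ((EasyP.eq hj.kind (Easy.const 0)).and (EasyP.known q b hx hj)).or
      (((EasyP.eq hj.kind (Easy.const 1)).and (EasyP.exists_lt (p := fun γ i =>
        (wordNet (Ctx.word γ)).Wire i (j γ) ∧ (wordNet (Ctx.word γ)).Derives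
          ((wordNet (Ctx.word γ)).Known q (x γ)) ((wordNet (Ctx.word γ)).Claims q (x γ)) e (!b) i)
        hn (hw.and (hd (!b))))).or
      (((EasyP.eq hj.kind (Easy.const (cond b 3 2))).and (((EasyP.large hj).and hex).or
        (EasyP.exists_lt (p := fun γ i =>
          (wordNet (Ctx.word γ)).Wire i (j γ) ∧ (wordNet (Ctx.word γ)).Derives
          ((wordNet (Ctx.word γ)).Known q (x γ)) ((wordNet (Ctx.word γ)).Claims q (x γ)) e b i)
          hn (hw.and (hd b))))).or
      ((EasyP.eq hj.kind (Easy.const (cond b 2 3))).and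
        (((EasyP.large hj).not.and (EasyP.forall_lt (p := fun γ i =>
          (wordNet (Ctx.word γ)).Wire i (j γ) → (wordNet (Ctx.word γ)).Derives
          ((wordNet (Ctx.word γ)).Known q (x γ)) ((wordNet (Ctx.word γ)).Claims q (x γ)) e b i)
          hn (hw.imp (hd b)))).or
        ((EasyP.large hj).and (hex.not.or (EasyP.exists_lt (p := fun γ w =>
          ((wordNet (Ctx.word γ)).Wire w (j γ) ∧
            (wordNet (Ctx.word γ)).Claims q (x γ) (j γ) w) ∧
          (wordNet (Ctx.word γ)).Derives
          ((wordNet (Ctx.word γ)).Known q (x γ)) ((wordNet (Ctx.word γ)).Claims q (x γ)) e b w)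
          hn ((hw.and hc).and (hd b)))))))))

section

variable {Γ : Type} [Ctx Γ] {x x' c c' g i j : Γ → ℕ}

theorem EasyP.valid (q e : ℕ) (hc : Easy c) (hx : Easy x) :
    EasyP fun γ => (wordNet (Ctx.word γ)).Valid q e (c γ) (x γ) := by
  have hn : Easy fun γ : Γ => (wordNet (Ctx.word γ)).n := Easy.entry 1
  refine (EasyP.forall_lt_const q fun s => ?_).and
    (EasyP.derives q e Γ false x _ hx (Easy.entry 2)).not
  refine (EasyP.lt (hx.lo s) (hx.hi s)).and
    (((EasyP.eq (hc.slot s) (Easy.const 0)).imp (EasyP.eq (hx.lo s) (Easy.const 0))).and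
    (((EasyP.eq (hc.slot s) (Easy.entry 0)).imp (EasyP.eq (hx.hi s) (hn.add (Easy.const 1)))).and
    ((EasyP.eq (hc.slot s) (Easy.const 0)).not.imp (EasyP.exists_lt (p := fun γ y =>
      (wordNet (Ctx.word γ)).lo (x γ) s = y + 1 ∧ (wordNet (Ctx.word γ)).kind y = 0) hn
      ((EasyP.eq (hx.lo s).fst (Easy.var.add (Easy.const 1))).and
        (EasyP.eq Easy.var.kind (Easy.const 0)))))))

theorem EasyP.agree (q : ℕ) (hc : Easy c) (hx : Easy x) (hc' : Easy c') (hx' : Easy x') :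
    EasyP fun γ => (wordNet (Ctx.word γ)).Agree q (c γ) (x γ) (c' γ) (x' γ) := by
  refine (EasyP.forall_lt_const q fun s => EasyP.forall_lt_const q fun s' => ?_).and
    ((EasyP.forall_lt_const (2 * q) fun s => EasyP.eq (hx.netDigit _) (hx'.netDigit _)).and
      ((EasyP.eq hc hc').imp (EasyP.eq hx hx')))
  exact ((EasyP.eq (hc.slot s) (hc'.slot s')).imp ((EasyP.eq (hx.lo s) (hx'.lo s')).and
    (EasyP.eq (hx.hi s) (hx'.hi s')))).and
    ((EasyP.eq ((hc.slot s).add (Easy.const 1)) (hc'.slot s')).imp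
      (EasyP.eq (hx.hi s) (hx'.lo s')))

variable (d : ℕ)

theorem EasyP.constraint (hc : Easy c) (hx : Easy x) (hc' : Easy c') (hx' : Easy x') :
    EasyP fun γ => (wordBinary d (Ctx.word γ)).R (c γ) (x γ) (c' γ) (x' γ) :=
  (EasyP.valid _ _ hc hx).and ((EasyP.valid _ _ hc' hx').and (EasyP.agree _ hc hx hc' hx'))

theorem Easy.classes : Easy fun γ : Γ => (wordBinary d (Ctx.word γ)).K :=
  ((Easy.entry 0).add (Easy.const 1)).pow _

theorem Easy.items : Easy fun γ : Γ => (wordBinary d (Ctx.word γ)).D :=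
  ((Easy.entry 1).add (Easy.const 2)).pow _

theorem Easy.cl (hi : Easy i) : Easy fun γ => (wordBinary d (Ctx.word γ)).cl (i γ) := by
  have hK : Easy fun γ : Γ => (wordBinary d (Ctx.word γ)).K := Easy.classes d
  have hD : Easy fun γ : Γ => (wordBinary d (Ctx.word γ)).D := Easy.items d
  exact Easy.ite (EasyP.lt hi (hK.mul hD)) (hi.div hD)
    (hK.add (((hi.sub (hK.mul hD)).div hD).div hD))

theorem EasyP.incident (hi : Easy i) (hj : Easy j) :
    EasyP fun γ => (wordBinary d (Ctx.word γ)).Incident (i γ) (j γ) := by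
  have hK : Easy fun γ : Γ => (wordBinary d (Ctx.word γ)).K := Easy.classes d
  have hD : Easy fun γ : Γ => (wordBinary d (Ctx.word γ)).D := Easy.items d
  have hr := hj.sub (hK.mul hD)
  have hp := (hr.div hD).div hD
  exact (EasyP.lt hi (hK.mul hD)).and ((EasyP.le (hK.mul hD) hj).and
    ((EasyP.constraint d (hp.div hK) ((hr.div hD).mod hD) (hp.mod hK) (hr.mod hD)).and
    ((EasyP.eq hi (((hp.div hK).mul hD).add ((hr.div hD).mod hD))).or
      (EasyP.eq hi (((hp.mod hK).mul hD).add (hr.mod hD))))))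

theorem EasyP.occurs (hi : Easy i) (hj : Easy j) :
    EasyP fun γ => (wordBinary d (Ctx.word γ)).Occurs (i γ) (j γ) := by
  have hK : Easy fun γ : Γ => (wordBinary d (Ctx.word γ)).K := Easy.classes d
  exact (EasyP.lt hi hK).and ((EasyP.le hK hj).and
    ((EasyP.eq hi ((hj.sub hK).div hK)).or (EasyP.eq hi ((hj.sub hK).mod hK))))

/-- The selection problem for the net encoded by a word. -/
def wordSelection (w : List ℕ) : Selection := (wordBinary d w).selection

theorem Easy.selectionClasses : Easy fun γ : Γ => (wordSelection d (Ctx.word γ)).o :=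
  (Easy.classes d).add ((Easy.classes d).mul (Easy.classes d))

theorem Easy.selectionItems : Easy fun γ : Γ => (wordSelection d (Ctx.word γ)).m :=
  ((Easy.classes d).mul (Easy.items d)).add
    ((((Easy.classes d).mul (Easy.classes d)).mul (Easy.items d)).mul (Easy.items d))

theorem EasyP.edge (b : Bool) (hi : Easy i) (hj : Easy j) :
    EasyP fun γ => (wordSelection d (Ctx.word γ)).Edge b (i γ) (j γ) := by
  have ho : Easy fun γ : Γ => (wordSelection d (Ctx.word γ)).o := Easy.selectionClasses d
  have hom : Easy fun γ : Γ =>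
      (wordSelection d (Ctx.word γ)).o + (wordSelection d (Ctx.word γ)).m :=
    ho.add (Easy.selectionItems d)
  exact (EasyP.lt hi hj).and
    (((EasyP.const (b = true)).and ((EasyP.lt hj ho).and (EasyP.occurs d hi hj))).or
    (((EasyP.lt hi ho).and ((EasyP.le ho hj).and ((EasyP.lt hj hom).and
      (EasyP.eq ((hj.sub ho).cl d) hi)))).or
    (((EasyP.le ho hi).and ((EasyP.lt hj hom).and
      (EasyP.incident d (hi.sub ho) (hj.sub ho)))).or
    ((EasyP.le hom hi).and (EasyP.lt hj (hom.add (Easy.const 5)))))))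

theorem Easy.lab (b : Bool) (hi : Easy i) :
    Easy fun γ => (wordSelection d (Ctx.word γ)).lab b (i γ) :=
  Easy.ite (EasyP.lt hi (Easy.selectionClasses d))
    (((Easy.const 2).mul hi).add (Easy.const b.toNat)) (hi.add (Easy.selectionClasses d))

open Classical in
theorem Emits.graph (b : Bool) :
    Emits fun γ : Γ => ((wordSelection d (Ctx.word γ)).graph b).code := by
  have hN : ∀ {Γ : Type} [Ctx Γ], Easy fun γ : Γ => (wordSelection d (Ctx.word γ)).size :=
    ((Easy.selectionClasses d).add (Easy.selectionItems d)).add (Easy.const 5)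
  refine Emits.congr (Emits.cons hN ((Emits.map (F := fun γ i =>
    (wordSelection d (Ctx.word γ)).lab b i) hN (Easy.lab d b Easy.var)).append
    (Emits.flatMap (L := fun γ i => (List.range (wordSelection d (Ctx.word γ)).size).map fun j =>
      if (wordSelection d (Ctx.word γ)).Edge b i j ∨ (wordSelection d (Ctx.word γ)).Edge b j i
        then 1 else 0) hN ?_))) fun γ => Selection.graph_code _ b
  exact Emits.map (Γ := Γ × ℕ) (F := fun p j =>
    if (wordSelection d (Ctx.word p.1)).Edge b p.2 j ∨
      (wordSelection d (Ctx.word p.1)).Edge b j p.2 then 1 else 0) hN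
    (Easy.ite ((EasyP.edge d b Easy.var.fst Easy.var).or (EasyP.edge d b Easy.var Easy.var.fst))
      (Easy.const 1) (Easy.const 0))

theorem Emits.word : Emits fun γ : Γ =>
    (MCLC.restrict (DegeneracyEq 4)).word (wordSelection d (Ctx.word γ)).instance₄ :=
  Emits.cons ((Easy.const 2).mul (Easy.selectionClasses d))
    ((Emits.graph d false).append (Emits.graph d true))

end

/-! ## Hardness -/

theorem Emits.outputs {L : List ℕ → List ℕ} (h : Emits L) :
    ∃ (p : Prog) (e : ℕ), ∀ w, ∃ t ≤ (w.sum + w.length + 2) ^ e, Outputs p w (L w) t := by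
  obtain ⟨p, T, ⟨e, he⟩, H⟩ := h (fun _ => 0) 0 (fun i hi => absurd hi (Nat.not_lt_zero i))
  refine ⟨p, e, fun w => ?_⟩
  obtain ⟨s, t, h1, h2, -, h3⟩ := H w State.init fun i hi => absurd hi (Nat.not_lt_zero i)
  exact ⟨t, h2.trans (he w), s, h1, h3⟩

/-! ### Unary size of circuit encodings and the final reduction -/

theorem Gate.code_le {n : ℕ} (g : Gate n) : ∀ x ∈ g.code, x ≤ n + 3 := by
  intro x hx
  cases g with
  | input => simp only [Gate.code, List.mem_singleton] at hx; omega
  | not i =>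
    simp only [Gate.code, List.mem_cons, List.not_mem_nil, or_false] at hx
    have := i.2
    omega
  | and l =>
    simp only [Gate.code, List.mem_cons, List.mem_map] at hx
    have := l.card_le_univ
    rw [Fintype.card_fin] at this
    rcases hx with rfl | rfl | ⟨a, -, rfl⟩ <;> omega
  | or l =>
    simp only [Gate.code, List.mem_cons, List.mem_map] at hx
    have := l.card_le_univ
    rw [Fintype.card_fin] at this
    rcases hx with rfl | rfl | ⟨a, -, rfl⟩ <;> omega

theorem Circuit.n_le_length (C : Circuit) : C.n + 2 ≤ C.code.length := by
  have : C.n ≤ ((List.finRange C.n).flatMap fun i => (C.gate i).code).length := by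
    rw [List.length_flatMap]
    calc C.n = ((List.finRange C.n).map fun i => (C.gate i).code.length).length • 1 := by simp
      _ ≤ _ := List.card_nsmul_le_sum _ _ fun x hx => by
        obtain ⟨i, -, rfl⟩ := List.mem_map.1 hx
        cases C.gate i <;> simp [Gate.code]
  simp only [Circuit.code, List.length_cons]
  omega

theorem Circuit.sum_code_le (C : Circuit) : C.code.sum ≤ C.code.length * (C.n + 3) := by
  refine (List.sum_le_card_nsmul _ (C.n + 3) fun x hx => ?_).trans (le_of_eq (by simp))
  simp only [Circuit.code, List.mem_cons, List.mem_flatMap] at hx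
  rcases hx with rfl | rfl | ⟨i, -, hx⟩
  · omega
  · have := C.out.2
    omega
  · exact Gate.code_le _ x hx

/-- The unary size is at most `(k + 4)` times the square of the binary size, because only `k` can
exceed the length of the word substantially. The power of `k + 4` goes into the computable factor.
The new parameter is twice the number of selector classes, `K + K * K` with `K = (k + 1) ^ 2 ^ (d +
1)`. -/
theorem fptReducible_restrict (d : ℕ) :
    FPTReducible (WCS 1 d) (MCLC.restrict (DegeneracyEq 4)) := by
  obtain ⟨p, e, hp⟩ := (Emits.word (Γ := List ℕ) d).outputs
  refine ⟨fun x => (wordSelection d ((WCS 1 d).word x)).instance₄, fun x => ?_,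
    ⟨fun k => 2 * ((k + 1) ^ (2 ^ (d + 1)) + (k + 1) ^ (2 ^ (d + 1)) * (k + 1) ^ (2 ^ (d + 1))),
      ?_, fun x => le_rfl⟩, p, fun k => (k + 4) ^ e, 2 * e, ?_, fun x => ?_⟩
  · obtain ⟨⟨C, hw, hd⟩, k⟩ := x
    have hN := C.good_wordNet k hw hd
    rw [Selection.yes_instance₄]
    refine Iff.trans ?_ (Binary.solvable_iff _).symm
    exact ⟨fun h => hN.consistent_of_sat (C.sat_of_weightedSat k h),
      fun h => C.weightedSat_of_sat k (hN.sat_of_consistent h)⟩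
  · have h1 := computable_pow Computable.succ (2 ^ (d + 1))
    exact computable_mul (Computable.const 2) (computable_add h1 (computable_mul h1 h1))
  · exact computable_pow (computable_add Computable.id (Computable.const 4)) e
  · obtain ⟨t, ht, ho⟩ := hp ((WCS 1 d).word x)
    refine ⟨t, ht.trans ?_, ho⟩
    rw [pow_mul, ← mul_pow]
    refine Nat.pow_le_pow_left ?_ e
    obtain ⟨⟨C, hw, hd⟩, k⟩ := x
    have h1 := C.n_le_length
    have h2 := C.sum_code_le
    have h3 := length_le_wordSize (k :: C.code)
    change (k :: C.code).sum + (k :: C.code).length + 2 ≤ (k + 4) * wordSize (k :: C.code) ^ 2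
    simp only [List.sum_cons, List.length_cons] at *
    generalize wordSize (k :: C.code) = W at *
    generalize C.code.length = l at *
    have h4 : l * (C.n + 3) ≤ W * W := Nat.mul_le_mul (by omega) (by omega)
    have h5 : 1 * W ≤ W * W := Nat.mul_le_mul_right W (by omega)
    have h6 : 1 ≤ W * W := Nat.mul_pos (by omega) (by omega)
    rw [pow_two]
    have h7 : (k + 4) * (W * W) = k * (W * W) + 4 * (W * W) := Nat.add_mul _ _ _
    have h8 : k * 1 ≤ k * (W * W) := Nat.mul_le_mul_left k h6
    omega

theorem FPTReducible.of_restrict {P Q : ParamProblem} {S : Set Q.Inst}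
    (h : FPTReducible P (Q.restrict S)) : FPTReducible P Q := by
  obtain ⟨g, h1, h2, h3⟩ := h
  exact ⟨fun x => (g x).1, h1, h2, h3⟩

end ParamComplexity

theorem mainTheorem1 :
    ParamComplexity.WHard 1 ParamComplexity.MCLC ∧
      ParamComplexity.WHard 1
        (ParamComplexity.MCLC.restrict (ParamComplexity.DegeneracyEq 4)) := by
  have h : ParamComplexity.WHard 1
      (ParamComplexity.MCLC.restrict (ParamComplexity.DegeneracyEq 4)) :=
    fun _ ⟨d, hd⟩ => hd.trans (ParamComplexity.fptReducible_restrict d)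
  exact ⟨fun P hP => (h P hP).of_restrict, h⟩
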